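/- **Notation.** For $\tau\in\mathbb C$ with $\operatorname{Im}\tau>0$ put $q^{x}=e^{2\pi i\tau x}$, $\eta(\tau)=q^{1/24}\prod_{n\ge1}(1-q^n)$. For $k\in\mathbb Z_{\ge1}$, $j\in\mathbb Z$ let $\Theta_{j,k}(\tau,z)=\sum_{n\in\mathbb Z+j/2k}q^{kn^2}e^{2\pi i knz}$, and let $$\vartheta_{00}=\Theta_{2,2}+\Theta_{0,2},\quad \vartheta_{01}=-\Theta_{2,2}+\Theta_{0,2},\quad \vartheta_{10}=\Theta_{1,2}+\Theta_{-1,2},\quad \vartheta_{11}=i\Theta_{1,2}-i\Theta_{-1,2}.$$ For $m\in\mathbb Z_{\ge0}$ let $$\Phi^{[m]}(\tau,z_1,z_2,t)=e^{2\pi i(m+1)t}\sum_{j\in\mathbb Z}\left(\frac{e^{2\pi ij(m+1)(z_1+z_2)}q^{j^2(m+1)}}{1-e^{2\pi iz_1}q^j}-\frac{e^{-2\pi ij(m+1)(z_1+z_2)}q^{j^2(m+1)}}{1-e^{-2\pi iz_2}q^j}\right).$$ With $E(x)=2\int_0^xe^{-\pi u^2}du$, let, for $m\ge 1$ and $j\in\mathbb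 Z$, $$R_{m;j}(\tau,v)=\sum_{n\equiv j\bmod 2m}\left(\operatorname{sign}\left(n+\tfrac12\right)-E\left(\left(n+2m\tfrac{\operatorname{Im}v}{\operatorname{Im}\tau}\right)\sqrt{\tfrac{\operatorname{Im}\tau}{m}}\right)\right)e^{-\frac{\pi in^2}{2m}\tau-2\pi inv}.$$ For $m\ge0$ let $\tilde\Phi^{[m]}=\Phi^{[m]}+\Phi^{[m]}_{\rm add}$, where $$\Phi^{[m]}_{\rm add}(\tau,z_1,z_2,t)=-\tfrac12e^{2\pi i(m+1)t}\sum_{j\in\mathbb Z/(2m+2)\mathbb Z}R_{m+1;j}\left(\tau,\tfrac{z_1-z_2}2\right)\left(\Theta_{j,m+1}-\Theta_{-j,m+1}\right)(\tau,z_1+z_2).$$ For $\epsilon,\epsilon'\in\{0,\frac12\}$ and $j,k\in\epsilon'+\mathbb Z$ let $$\tilde\Psi^{[M,m;\epsilon]}_{j,k;\epsilon'}(\tau,z_1,z_2,t)=q^{\frac{(m+1)jk}{M}}e^{\frac{2\pi i(m+1)}{M}(kz_1+jz_2)}\,\tilde\Phi^{[m]}\left(M\tau,z_1+j\tau+\epsilon,z_2+k\tau+\epsilon,\tfrac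 tM\right),$$ and, for $m\ge1$, $$G^{[M,m;\epsilon]}_{j,k;\epsilon'}(\tau,z,t)=\left(D_1\tilde\Psi^{[M,m-1;\epsilon]}_{j,k;\epsilon'}\right)(\tau,z,z,-t),\qquad D_1=\tfrac1{2\pi i}\left(\tfrac{\partial}{\partial z_1}-\tfrac{\partial}{\partial z_2}-\tfrac{z_1-z_2}{2\tau}\tfrac{\partial}{\partial t}\right),$$ where $\partial/\partial z_i=\frac12(\partial/\partial x_i-i\,\partial/\partial y_i)$ for $z_i=x_i+iy_i$ (and similarly for $t$), since the functions are real analytic but not holomorphic. The normalized $N=4$ denominators ($\epsilon=\frac12$) and superdenominators ($\epsilon=0$) in the Neveu–Schwarz ($\epsilon'=\frac12$) and Ramond ($\epsilon'=0$) sectors are $$R^{(\epsilon)}_{\epsilon'}(\tau,z,t)=e^{-2\pi it}\,\eta(\tau)^3\,\frac{\vartheta_{11}(\tau,2z)}{\vartheta_{1-2\epsilon',1-2\epsilon}(\tau,z)^2}.$$ **Modified characters.** Let $M,m$ be positive integers and let $\tilde j,\tilde k\in\epsilon'+\mathbb Z$. The modified characters ($\epsilon=\frac12$) and supercharacters ($\epsilon=0$)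 of the Neveu–Schwarz ($\epsilon'=\frac12$) and Ramond ($\epsilon'=0$) type $N=4$ modules of central charge $6(\frac mM-1)$ attached by quantum Hamiltonian reduction to the admissible $\hat A_{1|1}$-modules (respectively twisted modules) of level $-\frac mM$ are, by definition, the functions $$\widetilde{\rm ch}^{N=4[M,m;\epsilon]}_{\tilde j,\tilde k;\epsilon'}(\tau,z,t)=\frac{G^{[M,m;\epsilon]}_{\tilde j,-\tilde k;\epsilon'}(\tau,z,t)}{R^{(\epsilon)}_{\epsilon'}(\tau,z,t)}.$$ For a positive integer $M$ let $$\Omega^{N=4(M)}_\epsilon=\{(\tilde j,\tilde k)\in(\epsilon+\mathbb Z)^2\mid 0<\tilde j,\ \tilde j+\tilde k<M,\ 0\le\tilde k<M\}.$$ **Theorem 10.7.** Let $m,M$ be coprime positive integers such that $M\ge2$, and $\gcd(M,2m)=1$ if $m>1$. Let $\epsilon,\epsilon'\in\{0,\frac12\}$ and $(\tilde j,\tilde k)\in\Omega^{N=4(M)}_{\epsilon'}$. Then for all $\tau,z,t\in\mathbb C$ with $\operatorname{Im}\tau>0$ and $2z\notin\mathbb Z+\mathbb Z\tau$ (the points excluded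 are the zeros of $\vartheta_{11}(\tau,2z)$; they include the zeros of $\vartheta_{1-2\epsilon',1-2\epsilon}(\tau,z)$ and all singularities of the functions $G$): $$\widetilde{\rm ch}^{N=4[M,m;\epsilon]}_{\tilde j,\tilde k;\epsilon'}\left(-\tfrac1\tau,\tfrac z\tau,t+\tfrac{z^2}\tau\right)=-(-1)^{(1-2\epsilon)(1-2\epsilon')}\frac{2i\tau}{M}\sum_{(\tilde a,\tilde b)\in\Omega^{N=4(M)}_{\epsilon}}e^{-\frac{\pi im}{M}(\tilde a-\tilde b)(\tilde j-\tilde k)}\sin\left(\tfrac{\pi m}{M}(\tilde a+\tilde b)(\tilde j+\tilde k)\right)\widetilde{\rm ch}^{N=4[M,m;\epsilon']}_{\tilde a,\tilde b;\epsilon}(\tau,z,t),$$ $$\widetilde{\rm ch}^{N=4[M,m;\epsilon]}_{\tilde j,\tilde k;\epsilon'}(\tau+1,z,t)=e^{-\frac{2\pi im\tilde j\tilde k}{M}-\pi i\epsilon'}\;\widetilde{\rm ch}^{N=4[M,m;|\epsilon-\epsilon'|]}_{\tilde j,\tilde k;\epsilon'}(\tau,z,t).$$ -/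

import Mathlib

namespace N4

noncomputable section

/-- `e w = e^{2πiw}`, so that `q^x = e (τ * x)`. -/
def e (w : ℂ) : ℂ := Complex.exp (2 * Real.pi * Complex.I * w)

/-- The theta function `Θ_{j,k}(τ,z) = ∑_{n ∈ ℤ + j/2k} q^{k n²} e^{2πi k n z}` of degree `k`. -/
def Theta (j : ℤ) (k : ℕ) (τ z : ℂ) : ℂ :=
  ∑' l : ℤ,
    let n : ℂ := l + j / (2 * k)
    e (τ * (k * n ^ 2)) * e (k * n * z)

/-- The four Jacobi theta functions `ϑ_{ab}(τ,z)`, where `a, b ∈ {0, 1}`. -/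
def vartheta (a b : ℚ) (τ z : ℂ) : ℂ :=
  if a = 0 then
    if b = 0 then Theta 2 2 τ z + Theta 0 2 τ z
    else -Theta 2 2 τ z + Theta 0 2 τ z
  else
    if b = 0 then Theta 1 2 τ z + Theta (-1) 2 τ z
    else Complex.I * Theta 1 2 τ z - Complex.I * Theta (-1) 2 τ z

/-- The mock theta function `Φ^{[m]}(τ,z₁,z₂,t)`. -/
def Phi (m : ℕ) (τ z₁ z₂ t : ℂ) : ℂ :=
  e ((m + 1) * t) * ∑' j : ℤ,
    (e (j * (m + 1) * (z₁ + z₂)) * e (τ * (j ^ 2 * (m + 1))) / (1 - e z₁ * e (τ * j))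
      - e (-(j * (m + 1) * (z₁ + z₂))) * e (τ * (j ^ 2 * (m + 1))) / (1 - e (-z₂) * e (τ * j)))

/-- The odd entire function `E(x) = 2 ∫₀ˣ e^{-πu²} du`, for real `x`. -/
def zwegersE (x : ℝ) : ℝ := 2 * ∫ u in (0 : ℝ)..x, Real.exp (-Real.pi * u ^ 2)

/-- Zwegers' real analytic function `R_{m;j}(τ,v)`: the sum is over all integers
`n ≡ j (mod 2m)`, written as `n = j + 2ml` with `l ∈ ℤ`. -/
def zwegersR (m : ℕ) (j : ℤ) (τ v : ℂ) : ℂ :=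
  ∑' l : ℤ,
    let n : ℤ := j + 2 * m * l
    ((Real.sign (n + 1 / 2) - zwegersE ((n + 2 * m * (v.im / τ.im)) * √(τ.im / m)) : ℝ) : ℂ)
      * Complex.exp (-(Real.pi * Complex.I * n ^ 2 / (2 * m) * τ)
          - 2 * Real.pi * Complex.I * n * v)

/-- The real analytic correction `Φ^{[m]}_add`; `j` runs over representatives of
`ℤ/(2m+2)ℤ`. -/
def PhiAdd (m : ℕ) (τ z₁ z₂ t : ℂ) : ℂ :=
  -(1 / 2) * e ((m + 1) * t) * ∑ j ∈ Finset.range (2 * m + 2),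
    zwegersR (m + 1) j τ ((z₁ - z₂) / 2)
      * (Theta j (m + 1) τ (z₁ + z₂) - Theta (-j) (m + 1) τ (z₁ + z₂))

/-- The modified function `Φ̃^{[m]} = Φ^{[m]} + Φ^{[m]}_add`. -/
def PhiTilde (m : ℕ) (τ z₁ z₂ t : ℂ) : ℂ := Phi m τ z₁ z₂ t + PhiAdd m τ z₁ z₂ t

/-- The function `Ψ̃^{[M,m;ε]}_{j,k;ε'}(τ,z₁,z₂,t)`. The index `ε'` only records that
`j, k ∈ ε' + ℤ`; it does not enter the formula. -/
def PsiTilde (M m : ℕ) (ε j k : ℚ) (τ z₁ z₂ t : ℂ) : ℂ :=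
  e (τ * ((m + 1) * j * k / M)) * e ((m + 1) / M * (k * z₁ + j * z₂))
    * PhiTilde m (M * τ) (z₁ + j * τ + ε) (z₂ + k * τ + ε) (t / M)

/-- The Wirtinger derivative `∂f/∂z = (∂f/∂x - i ∂f/∂y)/2` of a function of `z = x + iy` that
need not be holomorphic. -/
def dWirtinger (f : ℂ → ℂ) (z : ℂ) : ℂ :=
  (fderiv ℝ f z 1 - Complex.I * fderiv ℝ f z Complex.I) / 2

/-- The differential operator
`D₁ = (1/2πi) (∂/∂z₁ - ∂/∂z₂ - ((z₁ - z₂)/2τ) ∂/∂t)`. -/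
def D1 (F : ℂ → ℂ → ℂ → ℂ → ℂ) (τ z₁ z₂ t : ℂ) : ℂ :=
  1 / (2 * Real.pi * Complex.I) *
    (dWirtinger (fun w => F τ w z₂ t) z₁ - dWirtinger (fun w => F τ z₁ w t) z₂
      - (z₁ - z₂) / (2 * τ) * dWirtinger (fun s => F τ z₁ z₂ s) t)

/-- The function `G^{[M,m;ε]}_{j,k;ε'}(τ,z,t) = (D₁ Ψ̃^{[M,m-1;ε]}_{j,k;ε'})(τ,z,z,-t)`,
for `m ≥ 1`. -/
def G (M m : ℕ) (ε j k : ℚ) (τ z t : ℂ) : ℂ := D1 (PsiTilde M (m - 1) ε j k) τ z z (-t)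

/-- The normalized `N = 4` denominator (`ε = 1/2`) or superdenominator (`ε = 0`) in the
Neveu–Schwarz (`ε' = 1/2`) or Ramond (`ε' = 0`) sector,
`e^{-2πit} η(τ)³ ϑ₁₁(τ,2z) / ϑ_{1-2ε',1-2ε}(τ,z)²`. -/
def denominator (ε ε' : ℚ) (τ z t : ℂ) : ℂ :=
  e (-t) * (ModularForm.eta τ ^ 3 * vartheta 1 1 τ (2 * z)
    / vartheta (1 - 2 * ε') (1 - 2 * ε) τ z ^ 2)

/-- The modified `N = 4` character (`ε = 1/2`) or supercharacter (`ε = 0`) in the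
Neveu–Schwarz (`ε' = 1/2`) or Ramond (`ε' = 0`) sector, with parameters `j, k ∈ ε' + ℤ`. -/
def modifiedCharacter (M m : ℕ) (ε ε' j k : ℚ) (τ z t : ℂ) : ℂ :=
  G M m ε j (-k) τ z t / denominator ε ε' τ z t

/-- The index set: all `(j, k)` with `j, k ∈ ε + ℤ`, `0 < j`, `j + k < M` and `0 ≤ k < M`. -/
def Omega (M : ℕ) (ε : ℚ) : Set (ℚ × ℚ) :=
  {p | (∃ a : ℤ, p.1 = ε + a) ∧ (∃ b : ℤ, p.2 = ε + b) ∧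
    0 < p.1 ∧ p.1 + p.2 < M ∧ 0 ≤ p.2 ∧ p.2 < M}

theorem Omega_finite (M : ℕ) (ε : ℚ) : (Omega M ε).Finite := by
  refine ((((Set.finite_Icc ⌊-ε⌋ ⌈(M : ℚ) - ε⌉).prod
    (Set.finite_Icc ⌊-ε⌋ ⌈(M : ℚ) - ε⌉)).image
      (fun p : ℤ × ℤ => ((ε + p.1 : ℚ), (ε + p.2 : ℚ)))).subset ?_)
  rintro ⟨x, y⟩ ⟨⟨a, ha⟩, ⟨b, hb⟩, h1, h2, h3, h4⟩
  simp only at ha hb h1 h2 h3 h4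
  subst ha hb
  refine ⟨(a, b), ⟨⟨?_, ?_⟩, ?_, ?_⟩, rfl⟩
  · exact_mod_cast (Int.floor_le (-ε)).trans (by linarith : -ε ≤ (a : ℚ))
  · exact_mod_cast (by linarith : (a : ℚ) ≤ M - ε).trans (Int.le_ceil _)
  · exact_mod_cast (Int.floor_le (-ε)).trans (by linarith : -ε ≤ (b : ℚ))
  · exact_mod_cast (by linarith : (b : ℚ) ≤ M - ε).trans (Int.le_ceil _)

/-- The index set as a finite set, for use as the range of a sum. -/
def OmegaFinset (M : ℕ) (ε : ℚ) : Finset (ℚ × ℚ) := (Omega_finite M ε).toFinset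

end

end N4

namespace N4

open Complex MeasureTheory Filter Topology ComplexConjugate

/-! The completed function Φ̃ is a disguised sum over a lattice on which the modular group acts by
permuting points. For degree s and X = z₁ + Jτ + N, let L(z₁, z₂) be -1/(2πi) times the sum over all
integers J, N of e(s(J z₂ - X Im z₂ / Im τ)) exp(-πs|X|²/Im τ) / X (`latticeSum`). With s = m + 1,
Φ̃ = e(st)(L(z₁, z₂) + L(z₂, z₁)) (`PhiTilde_eq`). This follows row by row in J from a partial
fraction expansion of 1/(1 - e(X)) minus an error-function series (`tsum_fracTerm`), which is
Poisson summation for a Gaussian, integrated over a half-line of centres. The error-function series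
then add up to Zwegers' correction (`sum_zwegersR_mul_Theta`).

The quantity |X|²/Im τ is modular invariant, so τ ↦ -1/τ only exchanges the indices and produces τ
e(s z₁ z₂/τ) (`latticeTerm_S`), while τ ↦ τ + 1 shifts N by J (`latticeTerm_T`). The sums converge
absolutely, so they may be rearranged.

Each half of Ψ̃ is such a sum, of degree m/M, over J in j + Mℤ and N in ε + ℤ, twisted by a
character. After inversion the congruence modulo M falls on the other index; it is expanded in
characters by orthogonality of roots of unity, which needs m prime to M (`halfPsi_S`). This gives a
sum over an M × M square of indices.

On the diagonal z₁ = z₂ the operator D₁ becomes the difference of two partial derivatives. It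
ignores the symmetric factor e(m z₁z₂/(Mτ)) up to evaluation, and it makes G antisymmetric in its
two indices (`G_S`, `G_swap`). With quasi-periodicity modulo M, the reflection (a, b) ↦ (M - b, M -
a) folds the square onto the triangle Ω: paired exponentials become sines, and the fixed line a + b
= M contributes zero (`G_S_fold`). Division by the denominators uses the classical transformations
of η and of theta functions with characteristics (`denominator_S`, `denominator_T`). -/

theorem e_add (a b : ℂ) : e (a + b) = e a * e b := by
  simp only [e, mul_add, Complex.exp_add]

theorem e_zero : e 0 = 1 := by simp [e]

theorem e_neg (a : ℂ) : e (-a) = (e a)⁻¹ := by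
  simp only [e, mul_neg, Complex.exp_neg]

theorem e_ne_zero (a : ℂ) : e a ≠ 0 := Complex.exp_ne_zero _

theorem e_int (n : ℤ) : e n = 1 := by
  rw [e, show (2 * Real.pi * I * n : ℂ) = n * (2 * Real.pi * I) by ring]
  exact Complex.exp_int_mul_two_pi_mul_I n

theorem e_add_int (a : ℂ) (n : ℤ) : e (a + n) = e a := by rw [e_add, e_int, mul_one]

theorem e_eq_one_iff (a : ℂ) : e a = 1 ↔ ∃ n : ℤ, a = n := by
  rw [e, Complex.exp_eq_one_iff]
  refine exists_congr fun n => ?_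
  rw [mul_comm, mul_left_inj' Complex.two_pi_I_ne_zero]

theorem e_int_mul (n : ℤ) (a : ℂ) : e (n * a) = e a ^ n := by
  rw [e, e, ← Complex.exp_int_mul]; congr 1; ring

theorem norm_e (a : ℂ) : ‖e a‖ = Real.exp (-(2 * Real.pi * a.im)) := by
  rw [e, Complex.norm_exp]
  congr 1
  simp [Complex.mul_re, Complex.mul_im]

theorem continuous_e : Continuous e := by unfold e; fun_prop

/-! ### Gaussian sums -/

/-- Up to the factor exp c, these are the norms of Jacobi theta terms at purely imaginary arguments.
-/
theorem summable_exp_quadratic {a : ℝ} (ha : 0 < a) (b c : ℝ) :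
    Summable fun n : ℤ => Real.exp (-(a * n ^ 2) + b * n + c) := by
  have h := ((summable_jacobiTheta₂_term_iff (-(b / (2 * Real.pi)) * I) (a / Real.pi * I)).2
    (by simp [Complex.mul_im]; positivity)).norm.mul_left (Real.exp c)
  refine h.congr fun n => ?_
  rw [norm_jacobiTheta₂_term, ← Real.exp_add]
  congr 1
  have : Real.pi ≠ 0 := Real.pi_ne_zero
  have h1 : ((a / Real.pi * I : ℂ)).im = a / Real.pi := by
    rw [← Complex.ofReal_div]; simp
  have h2 : ((-(b / (2 * Real.pi)) * I : ℂ)).im = -(b / (2 * Real.pi)) := by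
    rw [show (-(b / (2 * Real.pi)) * I : ℂ) = ((-(b / (2 * Real.pi)) : ℝ) : ℂ) * I by push_cast; ring]
    rw [Complex.im_ofReal_mul, Complex.I_im, mul_one]
  rw [h1, h2]
  field_simp
  ring

/-! ### The function `E` -/

theorem integrable_gaussian_pi : Integrable fun u : ℝ => Real.exp (-Real.pi * u ^ 2) :=
  integrable_exp_neg_mul_sq Real.pi_pos

theorem integral_gaussian_pi_Ioi_zero :
    ∫ u in Set.Ioi (0 : ℝ), Real.exp (-Real.pi * u ^ 2) = 1 / 2 := by
  rw [integral_gaussian_Ioi, div_self Real.pi_ne_zero, Real.sqrt_one]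

theorem zwegersE_eq (x : ℝ) :
    zwegersE x = 1 - 2 * ∫ u in Set.Ioi x, Real.exp (-Real.pi * u ^ 2) := by
  have h := intervalIntegral.integral_interval_add_Ioi (a := (0 : ℝ)) (b := x)
    (f := fun u : ℝ => Real.exp (-Real.pi * u ^ 2)) integrable_gaussian_pi.integrableOn
    integrable_gaussian_pi.integrableOn
  rw [integral_gaussian_pi_Ioi_zero] at h
  rw [zwegersE]
  linarith

theorem zwegersE_neg (x : ℝ) : zwegersE (-x) = -zwegersE x := by
  have h := intervalIntegral.integral_comp_neg (a := 0) (b := x)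
    (fun u : ℝ => Real.exp (-Real.pi * u ^ 2))
  simp only [neg_sq, neg_zero] at h
  rw [zwegersE, zwegersE, h, intervalIntegral.integral_symm (-x) 0]
  ring

theorem integral_Ioi_comp_add (g : ℝ → ℝ) (a x : ℝ) :
    ∫ u in Set.Ioi a, g (u + x) = ∫ u in Set.Ioi (a + x), g u := by
  have h := (measurePreserving_add_right volume x).setIntegral_preimage_emb
    (MeasurableEquiv.addRight x).measurableEmbedding g (Set.Ioi (a + x))
  rw [← h]
  congr 2
  ext u
  simp

/-- For u, x ≥ 0 one has (u + x)² ≥ u² + x², so the translated Gaussian splits off exp(-πx²). -/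
theorem gaussian_tail_le {x : ℝ} (hx : 0 ≤ x) :
    ∫ u in Set.Ioi x, Real.exp (-Real.pi * u ^ 2) ≤ 1 / 2 * Real.exp (-Real.pi * x ^ 2) := by
  have h1 : ∫ u in Set.Ioi x, Real.exp (-Real.pi * u ^ 2)
      = ∫ u in Set.Ioi (0 : ℝ), Real.exp (-Real.pi * (u + x) ^ 2) := by
    rw [integral_Ioi_comp_add (fun u : ℝ => Real.exp (-Real.pi * u ^ 2)), zero_add]
  have h2 : ∫ u in Set.Ioi (0 : ℝ), Real.exp (-Real.pi * (u + x) ^ 2)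
      ≤ ∫ u in Set.Ioi (0 : ℝ), Real.exp (-Real.pi * u ^ 2) * Real.exp (-Real.pi * x ^ 2) := by
    refine setIntegral_mono_on ?_ ?_ measurableSet_Ioi ?_
    · exact (integrable_gaussian_pi.comp_add_right x).integrableOn
    · exact (integrable_gaussian_pi.mul_const _).integrableOn
    · intro u hu
      rw [← Real.exp_add]
      apply Real.exp_le_exp.2
      have : 0 ≤ Real.pi * (u * x) := by have := Real.pi_pos; have := hu.out; positivity
      nlinarith
  rw [integral_mul_const, integral_gaussian_pi_Ioi_zero] at h2
  exact h1.trans_le h2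

theorem gaussian_tail_nonneg (x : ℝ) :
    0 ≤ ∫ u in Set.Ioi x, Real.exp (-Real.pi * u ^ 2) :=
  setIntegral_nonneg measurableSet_Ioi fun _ _ => (Real.exp_pos _).le

theorem abs_one_sub_zwegersE_le {x : ℝ} (hx : 0 ≤ x) :
    |1 - zwegersE x| ≤ Real.exp (-Real.pi * x ^ 2) := by
  have h1 := gaussian_tail_le hx
  have h2 := gaussian_tail_nonneg x
  rw [zwegersE_eq, abs_le]
  constructor <;> linarith

theorem abs_neg_one_sub_zwegersE_le {x : ℝ} (hx : x ≤ 0) :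
    |-1 - zwegersE x| ≤ Real.exp (-Real.pi * x ^ 2) := by
  have h := abs_one_sub_zwegersE_le (x := -x) (by linarith)
  rw [zwegersE_neg, neg_sq] at h
  rwa [show -1 - zwegersE x = -(1 - -zwegersE x) by ring, abs_neg]

theorem abs_zwegersE_le_one (x : ℝ) : |zwegersE x| ≤ 1 := by
  wlog hx : 0 ≤ x generalizing x
  · have := this (-x) (by linarith)
    rwa [zwegersE_neg, abs_neg] at this
  have h1 := gaussian_tail_le hx
  have h2 := gaussian_tail_nonneg x
  have h3 : Real.exp (-Real.pi * x ^ 2) ≤ 1 := by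
    rw [Real.exp_le_one_iff]; have := Real.pi_pos; nlinarith [sq_nonneg x]
  rw [zwegersE_eq, abs_le]
  constructor <;> linarith

theorem sign_add_half_of_nonneg {n : ℤ} (hn : 0 ≤ n) : Real.sign ((n : ℝ) + 1 / 2) = 1 := by
  apply Real.sign_of_pos
  have : (0 : ℝ) ≤ n := by exact_mod_cast hn
  linarith

theorem sign_add_half_of_neg {n : ℤ} (hn : n < 0) : Real.sign ((n : ℝ) + 1 / 2) = -1 := by
  apply Real.sign_of_neg
  have : (n : ℝ) ≤ -1 := by exact_mod_cast (by omega : n ≤ -1)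
  linarith

/-- The shift by 1/2 counts 0 as positive, so oddness fails exactly at n = 0. The resulting 2
reappears in every reflection n ↦ -n below. -/
theorem sign_neg_add_half (n : ℤ) : Real.sign (((-n : ℤ) : ℝ) + 1 / 2)
    = -Real.sign ((n : ℝ) + 1 / 2) + if n = 0 then 2 else 0 := by
  rcases lt_trichotomy n 0 with h | h | h
  · rw [sign_add_half_of_neg h, sign_add_half_of_nonneg (by omega), if_neg h.ne]; norm_num
  · subst h; rw [if_pos rfl, neg_zero, sign_add_half_of_nonneg le_rfl]; norm_num
  · rw [sign_add_half_of_nonneg h.le, sign_add_half_of_neg (by omega), if_neg h.ne']; norm_num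

/-- The weight `sign (n + 1/2) - E ((n - β) c)`. -/
noncomputable def signE (c β : ℝ) (n : ℤ) : ℝ := Real.sign ((n : ℝ) + 1 / 2) - zwegersE ((n - β) * c)

theorem signE_neg (c β : ℝ) (n : ℤ) :
    signE c β (-n) = -signE c (-β) n + if n = 0 then 2 else 0 := by
  rw [signE, signE, sign_neg_add_half,
    show (((-n : ℤ) : ℝ) - β) * c = -((n - -β) * c) by push_cast; ring, zwegersE_neg]
  ring

/-- A constant for which the weight `signE` is bounded by a Gaussian. -/
noncomputable def signEBound (c β : ℝ) : ℝ := 2 * Real.exp (Real.pi * ((|β| + 1) * c) ^ 2)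

theorem signEBound_pos (c β : ℝ) : 0 < signEBound c β := by unfold signEBound; positivity

/-- When n is on the side of β predicted by its sign, the Gaussian tail estimate applies. Otherwise
n lies between 0 and β, and the trivial bound 2 is enough, because `signEBound` compensates the
Gaussian at distance at most |β| + 1 from the centre. -/
theorem abs_signE_le {c : ℝ} (hc : 0 < c) (β : ℝ) (n : ℤ) :
    |signE c β n| ≤ signEBound c β * Real.exp (-Real.pi * ((n - β) * c) ^ 2) := by
  have hK : 1 ≤ signEBound c β := by
    have : 1 ≤ Real.exp (Real.pi * ((|β| + 1) * c) ^ 2) := Real.one_le_exp (by positivity)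
    unfold signEBound; linarith
  have key : |(n : ℝ) - β| ≤ |β| + 1 →
      |signE c β n| ≤ signEBound c β * Real.exp (-Real.pi * ((n - β) * c) ^ 2) := by
    intro h
    have h1 : |signE c β n| ≤ 2 := by
      have hE := abs_zwegersE_le_one ((n - β) * c)
      have hs : |Real.sign ((n : ℝ) + 1 / 2)| ≤ 1 := by
        rcases le_or_gt 0 n with hn | hn
        · rw [sign_add_half_of_nonneg hn]; simp
        · rw [sign_add_half_of_neg hn]; simp
      exact (abs_sub _ _).trans (by linarith)
    refine h1.trans ?_
    rw [signEBound, mul_assoc, ← Real.exp_add]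
    have : 1 ≤ Real.exp (Real.pi * ((|β| + 1) * c) ^ 2 + -Real.pi * ((n - β) * c) ^ 2) := by
      apply Real.one_le_exp
      have h2 : ((n - β) * c) ^ 2 ≤ ((|β| + 1) * c) ^ 2 := by
        rw [mul_pow, mul_pow]
        have : ((n : ℝ) - β) ^ 2 ≤ (|β| + 1) ^ 2 := by
          rw [← sq_abs]; gcongr
        gcongr
      nlinarith [Real.pi_pos]
    linarith
  have hexp := Real.exp_pos (-Real.pi * ((n - β) * c) ^ 2)
  rcases le_or_gt 0 n with hn | hn
  · rcases le_or_gt β n with hb | hb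
    · have : |signE c β n| ≤ Real.exp (-Real.pi * ((n - β) * c) ^ 2) := by
        rw [signE, sign_add_half_of_nonneg hn]
        exact abs_one_sub_zwegersE_le (mul_nonneg (by linarith) hc.le)
      nlinarith
    · apply key
      have hn' : (0 : ℝ) ≤ n := by exact_mod_cast hn
      rw [abs_le]; constructor <;> linarith [le_abs_self β]
  · rcases le_or_gt (n : ℝ) β with hb | hb
    · have : |signE c β n| ≤ Real.exp (-Real.pi * ((n - β) * c) ^ 2) := by
        rw [signE, sign_add_half_of_neg hn]
        exact abs_neg_one_sub_zwegersE_le (mul_nonpos_of_nonpos_of_nonneg (by linarith) hc.le)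
      nlinarith
    · apply key
      have hn' : (n : ℝ) ≤ -1 := by exact_mod_cast (by omega : n ≤ -1)
      rw [abs_le]; constructor <;> linarith [neg_abs_le β]

/-- Exhibits the error function as an integral over the centre b of the Gaussian; this is how E
arises when the Poisson identity is integrated over b > β. -/
theorem integral_gaussian_shifted {c : ℝ} (hc : 0 < c) (β x : ℝ) :
    ∫ b in Set.Ioi β, c * Real.exp (-Real.pi * ((x - b) * c) ^ 2)
      = 1 / 2 * (1 + zwegersE ((x - β) * c)) := by
  have h1 := integral_Ioi_comp_add (fun u => c * Real.exp (-Real.pi * (u * c) ^ 2)) β (-x)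
  have h2 := integral_comp_mul_right_Ioi (fun u => Real.exp (-Real.pi * u ^ 2)) (β + -x) hc
  simp only [integral_const_mul] at h1
  rw [h2, smul_eq_mul, mul_inv_cancel_left₀ hc.ne', ← integral_const_mul] at h1
  rw [show (x - β) * c = -((β + -x) * c) by ring, zwegersE_neg, zwegersE_eq]
  rw [show 1 / 2 * (1 + -(1 - 2 * ∫ u in Set.Ioi ((β + -x) * c), Real.exp (-Real.pi * u ^ 2)))
    = ∫ u in Set.Ioi ((β + -x) * c), Real.exp (-Real.pi * u ^ 2) by ring, ← h1]
  congr 1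
  ext u
  ring_nf

theorem integrable_gaussian_shifted {c : ℝ} (hc : 0 < c) (x : ℝ) :
    Integrable fun b : ℝ => c * Real.exp (-Real.pi * ((x - b) * c) ^ 2) := by
  have h := ((integrable_exp_neg_mul_sq (b := Real.pi * c ^ 2)
    (by have := Real.pi_pos; positivity)).comp_sub_left x).const_mul c
  refine h.congr (Eventually.of_forall fun b => ?_)
  simp only
  ring_nf

theorem summable_norm_e_mul_gaussian {c : ℝ} (hc : 0 < c) (β : ℝ) (X : ℂ) :
    Summable fun n : ℤ => Real.exp (-Real.pi * ((n - β) * c) ^ 2) * ‖e (n * X)‖ := by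
  have hp := Real.pi_pos
  refine (summable_exp_quadratic (a := Real.pi * c ^ 2) (by positivity)
    (2 * Real.pi * c ^ 2 * β - 2 * Real.pi * X.im) (-(Real.pi * c ^ 2 * β ^ 2))).congr fun n => ?_
  rw [norm_e, ← Real.exp_add]
  congr 1
  simp only [Complex.mul_im, Complex.intCast_re, Complex.intCast_im]
  ring

theorem summable_signE_mul_e {c : ℝ} (hc : 0 < c) (β : ℝ) (X : ℂ) :
    Summable fun n : ℤ => (signE c β n : ℂ) * e (n * X) := by
  refine Summable.of_norm_bounded ((summable_norm_e_mul_gaussian hc β X).mul_left (signEBound c β))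
    fun n => ?_
  rw [norm_mul, Complex.norm_real, Real.norm_eq_abs, ← mul_assoc]
  exact mul_le_mul_of_nonneg_right (abs_signE_le hc β n) (norm_nonneg _)

/-! ### Poisson summation and the partial fraction expansion -/

/-- The weight (1 + sign(n + 1/2))/2 is the indicator of n ≥ 0, so this is the geometric series. -/
theorem hasSum_sign_add_one {X : ℂ} (hX : 0 < X.im) :
    HasSum (fun n : ℤ => ((1 / 2 * (1 + Real.sign ((n : ℝ) + 1 / 2)) : ℝ) : ℂ) * e (n * X))
      (1 / (1 - e X)) := by
  have h1 : ‖e X‖ < 1 := by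
    rw [norm_e, Real.exp_lt_one_iff]; have := Real.pi_pos; nlinarith [mul_pos this hX]
  have h2 := hasSum_geometric_of_norm_lt_one h1
  rw [one_div (1 - e X)]
  refine (Function.Injective.hasSum_iff (f := fun n : ℤ =>
    ((1 / 2 * (1 + Real.sign ((n : ℝ) + 1 / 2)) : ℝ) : ℂ) * e (n * X)) (g := fun n : ℕ => (n : ℤ))
    Nat.cast_injective ?_).1 ?_
  · intro n hn
    have : n < 0 := by
      by_contra h
      exact hn ⟨n.toNat, by simp; omega⟩
    rw [sign_add_half_of_neg this]
    norm_num
  · have heq : ((fun n : ℤ => ((1 / 2 * (1 + Real.sign ((n : ℝ) + 1 / 2)) : ℝ) : ℂ) * e (n * X)) ∘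
        fun n : ℕ => (n : ℤ)) = fun n => e X ^ n := by
      funext n
      have := sign_add_half_of_nonneg (Int.natCast_nonneg n)
      simp only [Function.comp_apply, this, e_int_mul]
      norm_num
    rw [heq]
    exact h2

/-- Poisson summation for a shifted Gaussian. -/
theorem tsum_gaussian_mul_e {c : ℝ} (hc : 0 < c) (b : ℝ) (X : ℂ) :
    ∑' m : ℤ, cexp (-Real.pi * (X + m) ^ 2 / c ^ 2) * e (b * (X + m))
      = ∑' n : ℤ, ((c * Real.exp (-Real.pi * ((n - b) * c) ^ 2) : ℝ) : ℂ) * e (n * X) := by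
  have hc' : (c : ℂ) ≠ 0 := by exact_mod_cast hc.ne'
  have ha : 0 < ((1 / c ^ 2 : ℝ) : ℂ).re := by rw [Complex.ofReal_re]; positivity
  have h := Complex.tsum_exp_neg_quadratic ha (-X / c ^ 2 + I * b)
  have hroot : 1 / ((1 / c ^ 2 : ℝ) : ℂ) ^ (1 / 2 : ℂ) = c := by
    rw [show (1 / 2 : ℂ) = ((1 / 2 : ℝ) : ℂ) by push_cast; ring,
      ← Complex.ofReal_cpow (by positivity), ← Real.sqrt_eq_rpow, Real.sqrt_div zero_le_one,
      Real.sqrt_one, Real.sqrt_sq hc.le]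
    push_cast; rw [one_div_one_div]
  rw [hroot] at h
  -- This factor completes the square on the left and cancels the terms free of n on the right,
  -- leaving exactly e(nX) and the Gaussian centred at b.
  have h3 := congrArg (fun w => cexp (-Real.pi * X ^ 2 / c ^ 2 + 2 * Real.pi * I * b * X) * w) h
  simp only [← tsum_mul_left] at h3
  refine Eq.trans (tsum_congr fun m => ?_) (h3.trans (tsum_congr fun n => ?_))
  · rw [e, ← Complex.exp_add, ← Complex.exp_add]
    congr 1
    push_cast
    field_simp
    ring
  · rw [e]
    push_cast
    rw [mul_assoc (c : ℂ), ← Complex.exp_add, mul_left_comm, ← Complex.exp_add]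
    congr 2
    field_simp
    ring_nf
    simp only [I_sq, I_pow_four, I_pow_three]
    ring

/-- The `m`-th term of the partial fraction side. -/
noncomputable def fracTerm (c β : ℝ) (X : ℂ) (m : ℤ) : ℂ :=
  e (β * (X + m)) * cexp (-Real.pi * (X + m) ^ 2 / c ^ 2) / (X + m)

theorem norm_cexp_gaussian {c : ℝ} (X : ℂ) (m : ℤ) :
    ‖cexp (-Real.pi * (X + m) ^ 2 / c ^ 2)‖
      = Real.exp (-Real.pi * ((X.re + m) ^ 2 - X.im ^ 2) / c ^ 2) := by
  rw [Complex.norm_exp]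
  congr 1
  rw [show (-Real.pi * (X + m) ^ 2 / c ^ 2 : ℂ) = ((-Real.pi / c ^ 2 : ℝ) : ℂ) * (X + m) ^ 2 by
    push_cast; ring, Complex.re_ofReal_mul, pow_two (X + m : ℂ), Complex.mul_re]
  simp only [Complex.add_re, Complex.add_im, Complex.intCast_re, Complex.intCast_im]
  ring

/-- Both sides are the integral over b > β of the two sides of `tsum_gaussian_mul_e`. One side
integrates termwise to (1 + E)/2 = (1 + sign)/2 - `signE`/2, a geometric series minus the error
series. On the other, Im X > 0 makes e(b(X + m)) decay, and its integral produces the pole 1/(X +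
m). -/
theorem tsum_fracTerm_of_im_pos {c : ℝ} (hc : 0 < c) (β : ℝ) {X : ℂ} (hX : 0 < X.im) :
    1 / (1 - e X) - 1 / 2 * ∑' n : ℤ, (signE c β n : ℂ) * e (n * X)
      = -1 / (2 * Real.pi * I) * ∑' m : ℤ, fracTerm c β X m := by
  have hp := Real.pi_pos
  set μ := volume.restrict (Set.Ioi β)
  -- the left hand side as an integral
  have hL0 : HasSum (fun n : ℤ =>
      ((1 / 2 * (1 + zwegersE ((n - β) * c)) : ℝ) : ℂ) * e (n * X))
      (1 / (1 - e X) - 1 / 2 * ∑' n : ℤ, (signE c β n : ℂ) * e (n * X)) := by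
    have h := (hasSum_sign_add_one hX).sub
      ((summable_signE_mul_e hc β X).hasSum.mul_left (1 / 2))
    refine (congrArg (HasSum · _) (funext fun n => ?_)).mp h
    simp only [signE]
    push_cast
    ring
  have hLint : ∀ n : ℤ, ∫ b, ((c * Real.exp (-Real.pi * ((n - b) * c) ^ 2) : ℝ) : ℂ) * e (n * X) ∂μ
      = ((1 / 2 * (1 + zwegersE ((n - β) * c)) : ℝ) : ℂ) * e (n * X) := by
    intro n
    rw [integral_mul_const, integral_complex_ofReal, integral_gaussian_shifted hc]
  have hL := hasSum_integral_of_summable_integral_norm (μ := μ)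
    (F := fun (n : ℤ) (b : ℝ) =>
      ((c * Real.exp (-Real.pi * ((n - b) * c) ^ 2) : ℝ) : ℂ) * e (n * X))
    (fun n => ((integrable_gaussian_shifted hc n).ofReal.mul_const _).integrableOn)
    (by
      refine hL0.summable.norm.congr fun n => ?_
      simp only [norm_mul (_ : ℂ), Complex.norm_real]
      rw [integral_mul_const]
      congr 1
      rw [← integral_gaussian_shifted hc, Real.norm_of_nonneg]
      · refine integral_congr_ae (Eventually.of_forall fun b => ?_)
        simp only
        rw [Real.norm_of_nonneg (by positivity)]
      · exact integral_nonneg fun b => by positivity)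
  simp only [hLint] at hL
  rw [hL0.unique hL]
  -- the right hand side as an integral
  have hX0 : ∀ m : ℤ, (X + m : ℂ) ≠ 0 := fun m h => by
    have := congrArg Complex.im h
    simp at this
    linarith
  have hre : ∀ m : ℤ, (2 * Real.pi * I * (X + m)).re = -(2 * Real.pi * X.im) := fun m => by
    simp [Complex.mul_re, Complex.mul_im]
  have hneg : ∀ m : ℤ, (2 * Real.pi * I * (X + m)).re < 0 := fun m => by
    rw [hre]; have := mul_pos hp hX; linarith
  have hint : ∀ m : ℤ, Integrable (fun b : ℝ => e (b * (X + m))) μ := fun m => by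
    refine (integrableOn_exp_mul_complex_Ioi (hneg m) β).congr (Eventually.of_forall fun b => ?_)
    simp only [e]
    ring_nf
  have hRint : ∀ m : ℤ, ∫ b : ℝ, cexp (-Real.pi * (X + m) ^ 2 / c ^ 2) * e (b * (X + m)) ∂μ
      = -1 / (2 * Real.pi * I) * fracTerm c β X m := by
    intro m
    have h := integral_exp_mul_complex_Ioi (hneg m) β
    rw [integral_const_mul]
    have h' : ∫ b : ℝ, e (b * (X + m)) ∂μ = -e (β * (X + m)) / (2 * Real.pi * I * (X + m)) := by
      rw [e, show (2 * Real.pi * I * (β * (X + m)) : ℂ) = 2 * Real.pi * I * (X + m) * β by ring, ← h]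
      refine integral_congr_ae (Eventually.of_forall fun b => ?_)
      simp only [e]
      ring_nf
    rw [h', fracTerm]
    have := hX0 m
    have hpi : (Real.pi : ℂ) ≠ 0 := by exact_mod_cast hp.ne'
    field_simp
  have hR := hasSum_integral_of_summable_integral_norm (μ := μ)
    (F := fun (m : ℤ) (b : ℝ) => cexp (-Real.pi * (X + m) ^ 2 / c ^ 2) * e (b * (X + m)))
    (fun m => (hint m).const_mul _)
    (by
      have hs := (summable_exp_quadratic (a := Real.pi / c ^ 2) (by positivity)
        (-(2 * Real.pi * X.re / c ^ 2)) (-Real.pi * (X.re ^ 2 - X.im ^ 2) / c ^ 2)).mul_right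
        (∫ b : ℝ, ‖e (b * X)‖ ∂μ)
      refine hs.congr fun m => ?_
      simp only [norm_mul]
      rw [integral_const_mul, norm_cexp_gaussian]
      congr 1
      · congr 1; ring
      · refine integral_congr_ae (Eventually.of_forall fun b => ?_)
        simp only [norm_e]
        congr 1
        simp [Complex.mul_im])
  simp only [hRint] at hR
  rw [← tsum_mul_left, hR.tsum_eq]
  refine integral_congr_ae (Eventually.of_forall fun b => ?_)
  exact (tsum_gaussian_mul_e hc b X).symm

theorem fracTerm_neg (c β : ℝ) (X : ℂ) (m : ℤ) :
    fracTerm c (-β) (-X) (-m) = -fracTerm c β X m := by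
  have h : (-X + ((-m : ℤ) : ℂ)) = -(X + m) := by push_cast; ring
  rw [fracTerm, fracTerm, h, neg_sq, div_neg]
  push_cast
  rw [neg_mul_neg]

theorem tsum_signE_mul_e_neg {c : ℝ} (hc : 0 < c) (β : ℝ) (X : ℂ) :
    ∑' n : ℤ, (signE c (-β) n : ℂ) * e (n * -X)
      = 2 - ∑' n : ℤ, (signE c β n : ℂ) * e (n * X) := by
  rw [← (Equiv.neg ℤ).tsum_eq]
  have h : ∀ n : ℤ, (signE c (-β) ((Equiv.neg ℤ) n) : ℂ) * e (((Equiv.neg ℤ) n : ℤ) * -X)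
      = (if n = 0 then 2 else 0) - (signE c β n : ℂ) * e (n * X) := by
    intro n
    rw [Equiv.neg_apply, signE_neg, neg_neg]
    push_cast
    rw [neg_mul_neg]
    split_ifs with h0
    · subst h0; simp [e_zero]; ring
    · simp
  simp only [h]
  rw [((hasSum_ite_eq (0 : ℤ) (2 : ℂ)).summable).tsum_sub (summable_signE_mul_e hc β X),
    tsum_ite_eq]

theorem e_eq_one_iff_mem (X : ℂ) : 1 - e X = 0 ↔ ∃ n : ℤ, X = n := by
  rw [sub_eq_zero, eq_comm, e_eq_one_iff]

theorem one_div_one_sub_e_neg {X : ℂ} (hX : ∀ n : ℤ, X ≠ n) :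
    1 / (1 - e (-X)) = 1 - 1 / (1 - e X) := by
  have h1 : 1 - e X ≠ 0 := fun h => by
    obtain ⟨n, hn⟩ := (e_eq_one_iff_mem X).1 h; exact hX n hn
  have h0 := e_ne_zero X
  rw [e_neg]
  have h2 : 1 - (e X)⁻¹ ≠ 0 := fun h => h1 (by
    have : e X * (1 - (e X)⁻¹) = 0 := by rw [h, mul_zero]
    rw [mul_sub, mul_inv_cancel₀ h0] at this
    linear_combination -this)
  field_simp
  have h3 : e X - 1 ≠ 0 := fun h => h1 (by linear_combination -h)
  field_simp
  ring

/-- The reflection (X, β) ↦ (-X, -β) reduces to the upper half-plane. The 1 in 1/(1 - e(-X)) = 1 -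
1/(1 - e(X)) cancels half of the 2 coming from n = 0. -/
theorem tsum_fracTerm_of_im_neg {c : ℝ} (hc : 0 < c) (β : ℝ) {X : ℂ} (hX : X.im < 0) :
    1 / (1 - e X) - 1 / 2 * ∑' n : ℤ, (signE c β n : ℂ) * e (n * X)
      = -1 / (2 * Real.pi * I) * ∑' m : ℤ, fracTerm c β X m := by
  have hX' : ∀ n : ℤ, X ≠ n := fun n h => by rw [h] at hX; simp at hX
  have h := tsum_fracTerm_of_im_pos hc (-β) (X := -X) (by simpa using hX)
  have hsum : ∑' m : ℤ, fracTerm c (-β) (-X) m = -∑' m : ℤ, fracTerm c β X m := by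
    rw [← (Equiv.neg ℤ).tsum_eq, ← tsum_neg]
    exact tsum_congr fun m => fracTerm_neg c β X m
  rw [tsum_signE_mul_e_neg hc, one_div_one_sub_e_neg hX', hsum] at h
  linear_combination -h

theorem continuousAt_signE_sum {c : ℝ} (hc : 0 < c) (β x : ℝ) :
    ContinuousAt (fun X : ℂ => ∑' n : ℤ, (signE c β n : ℂ) * e (n * X)) x := by
  have hs : {X : ℂ | |X.im| < 1} ∈ 𝓝 (x : ℂ) := by
    apply IsOpen.mem_nhds
    · exact isOpen_lt (by fun_prop) continuous_const
    · simp
  -- On the strip |Im X| < 1, ‖e(nX)‖ is at most the larger of ‖e(nI)‖ and ‖e(-nI)‖, hence at most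
  -- their sum.
  refine (continuousOn_tsum (u := fun n : ℤ => signEBound c β *
    (Real.exp (-Real.pi * ((n - β) * c) ^ 2) * ‖e (n * I)‖ +
      Real.exp (-Real.pi * ((n - β) * c) ^ 2) * ‖e (n * -I)‖)) (s := {X : ℂ | |X.im| < 1})
    ?_ ?_ ?_).continuousAt hs
  · intro n
    exact (continuous_const.mul (continuous_e.comp (by fun_prop))).continuousOn
  · exact ((summable_norm_e_mul_gaussian hc β I).add
      (summable_norm_e_mul_gaussian hc β (-I))).mul_left _
  · intro n X hX
    have hX := abs_lt.1 (show |X.im| < 1 from hX)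
    rw [norm_mul, Complex.norm_real, Real.norm_eq_abs, ← mul_add, ← mul_assoc]
    refine mul_le_mul (abs_signE_le hc β n) ?_ (norm_nonneg _)
      (mul_nonneg (signEBound_pos c β).le (Real.exp_pos _).le)
    simp only [norm_e, Complex.mul_im, Complex.intCast_re, Complex.intCast_im, Complex.neg_im,
      Complex.I_im]
    have hp := Real.pi_pos
    rcases le_total 0 (n : ℝ) with hn | hn
    · refine le_add_of_nonneg_of_le (Real.exp_pos _).le (Real.exp_le_exp.2 ?_)
      nlinarith [mul_nonneg hp.le (mul_nonneg hn (by linarith : 0 ≤ 1 + X.im))]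
    · refine le_add_of_le_of_nonneg (Real.exp_le_exp.2 ?_) (Real.exp_pos _).le
      nlinarith [mul_nonneg hp.le (mul_nonneg (neg_nonneg.2 hn) (by linarith : 0 ≤ 1 - X.im))]

theorem continuousAt_fracTerm_sum {c : ℝ} (hc : 0 < c) (β x : ℝ) (hx : ∀ n : ℤ, x ≠ n) :
    ContinuousAt (fun X : ℂ => ∑' m : ℤ, fracTerm c β X m) x := by
  have hp := Real.pi_pos
  -- At most half the distance from x to the integers, so that every point of the δ-ball stays at
  -- distance at least δ from all poles.
  obtain ⟨δ, hδ, hδ1, hδx⟩ : ∃ δ : ℝ, 0 < δ ∧ δ ≤ 1 ∧ ∀ m : ℤ, 2 * δ ≤ |x + m| := by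
    have h0 : 0 < |x - round x| := abs_pos.2 (sub_ne_zero.2 (hx _))
    refine ⟨min 1 (|x - round x| / 2), by positivity, min_le_left _ _, fun m => ?_⟩
    have := round_le x (-m)
    have h2 := min_le_right 1 (|x - round x| / 2)
    push_cast at this
    rw [sub_neg_eq_add] at this
    linarith
  set s : Set ℂ := Metric.ball (x : ℂ) δ
  have hre : ∀ X ∈ s, |X.re - x| < δ ∧ |X.im| < δ := by
    intro X hX
    rw [Metric.mem_ball, Complex.dist_eq] at hX
    exact ⟨by simpa using (Complex.abs_re_le_norm (X - x)).trans_lt hX,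
      by simpa using (Complex.abs_im_le_norm (X - x)).trans_lt hX⟩
  have hlow : ∀ X ∈ s, ∀ m : ℤ, δ ≤ ‖X + m‖ := by
    intro X hX m
    have h1 := (hre X hX).1
    have h2 := hδx m
    have h3 := Complex.abs_re_le_norm (X + m)
    simp only [Complex.add_re, Complex.intCast_re] at h3
    have h4 : |x + m| ≤ |X.re + m| + |X.re - x| := by
      rw [show x + m = (X.re + m) - (X.re - x) by ring]; exact abs_sub _ _
    linarith
  have hne : ∀ X ∈ s, ∀ m : ℤ, (X + m : ℂ) ≠ 0 := fun X hX m h => by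
    have := hlow X hX m
    rw [h, norm_zero] at this
    linarith
  refine (continuousOn_tsum (u := fun m : ℤ => Real.exp (2 * Real.pi * |β|) *
      Real.exp (-(Real.pi / (2 * c ^ 2) * m ^ 2) + (-(Real.pi * x / c ^ 2)) * m
        + (-(Real.pi * x ^ 2 / (2 * c ^ 2)) + 2 * Real.pi / c ^ 2)) / δ) (s := s)
    ?_ ?_ ?_).continuousAt (Metric.ball_mem_nhds _ hδ)
  · intro m
    unfold fracTerm
    refine ContinuousOn.div (Continuous.continuousOn ?_) (by fun_prop) fun X hX => hne X hX m
    exact (continuous_e.comp (by fun_prop)).mul (by fun_prop)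
  · exact ((summable_exp_quadratic (by positivity) _ _).mul_left _).div_const _
  · intro m X hX
    obtain ⟨h1, h2⟩ := hre X hX
    rw [abs_lt] at h1 h2
    rw [fracTerm, norm_div, norm_mul, norm_cexp_gaussian, norm_e]
    refine div_le_div₀ (by positivity) (mul_le_mul (Real.exp_le_exp.2 ?_) (Real.exp_le_exp.2 ?_)
      (Real.exp_pos _).le (Real.exp_pos _).le) hδ (hlow X hX m)
    · simp only [Complex.mul_im, Complex.ofReal_re, Complex.ofReal_im, Complex.add_im,
        Complex.intCast_im, zero_mul, add_zero]
      have : -(β * X.im) ≤ |β| := by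
        rw [← neg_mul]
        refine (le_abs_self _).trans ?_
        rw [abs_mul, abs_neg]
        exact mul_le_of_le_one_right (abs_nonneg _) (abs_le.2 ⟨by linarith, by linarith⟩)
      nlinarith
    · have h3 : (x + m) ^ 2 / 2 - 2 ≤ (X.re + m) ^ 2 - X.im ^ 2 := by
        nlinarith [sq_nonneg ((x + m) + 2 * (X.re - x))]
      have h4 := mul_le_mul_of_nonneg_left h3 (show 0 ≤ Real.pi / c ^ 2 by positivity)
      rw [show -Real.pi * ((X.re + m) ^ 2 - X.im ^ 2) / c ^ 2
        = -(Real.pi / c ^ 2 * ((X.re + m) ^ 2 - X.im ^ 2)) by ring]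
      refine (neg_le_neg h4).trans (le_of_eq ?_)
      field_simp
      ring

/-- Partial fraction expansion of the completed geometric series. -/
theorem tsum_fracTerm {c : ℝ} (hc : 0 < c) (β : ℝ) {X : ℂ} (hX : ∀ n : ℤ, X ≠ n) :
    1 / (1 - e X) - 1 / 2 * ∑' n : ℤ, (signE c β n : ℂ) * e (n * X)
      = -1 / (2 * Real.pi * I) * ∑' m : ℤ, fracTerm c β X m := by
  rcases lt_trichotomy X.im 0 with h | h | h
  · exact tsum_fracTerm_of_im_neg hc β h
  · obtain ⟨x, rfl⟩ : ∃ x : ℝ, X = x := ⟨X.re, Complex.ext (by simp) (by simpa using h)⟩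
    have hx : ∀ n : ℤ, x ≠ n := fun n hn => hX n (by rw [hn]; simp)
    have hL : ContinuousAt (fun X : ℂ =>
        1 / (1 - e X) - 1 / 2 * ∑' n : ℤ, (signE c β n : ℂ) * e (n * X)) x := by
      refine ContinuousAt.sub (ContinuousAt.div continuousAt_const
        (continuousAt_const.sub continuous_e.continuousAt) fun h0 => ?_)
        (continuousAt_const.mul (continuousAt_signE_sum hc β x))
      obtain ⟨n, hn⟩ := (e_eq_one_iff_mem _).1 h0
      exact hX n hn
    have hR := (continuousAt_const (y := -1 / (2 * Real.pi * I))).mul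
      (continuousAt_fracTerm_sum hc β x hx)
    -- A real non-integral point is approached vertically from the upper half-plane, where the
    -- identity is known.
    have hpath : Tendsto (fun t : ℝ => (x : ℂ) + t * I) (𝓝[>] 0) (𝓝 (x : ℂ)) := by
      have : Continuous fun t : ℝ => (x : ℂ) + t * I := by fun_prop
      have h := this.tendsto 0
      simp only [Complex.ofReal_zero, zero_mul, add_zero] at h
      exact h.mono_left nhdsWithin_le_nhds
    refine tendsto_nhds_unique (hL.tendsto.comp hpath) ((hR.tendsto.comp hpath).congr' ?_)
    filter_upwards [self_mem_nhdsWithin] with t ht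
    exact (tsum_fracTerm_of_im_pos hc β (by simpa using ht)).symm
  · exact tsum_fracTerm_of_im_pos hc β h

/-! ### Gaussian sums over a lattice -/

theorem summable_gaussian_lattice {c : ℝ} (hc : 0 < c) {τ : ℂ} (hτ : 0 < τ.im) (z : ℂ) :
    Summable fun p : ℤ × ℤ => Real.exp (-c * ‖z + p.1 * τ + p.2‖ ^ 2) := by
  set y := τ.im
  set u := τ.re
  -- The real part of the lattice vector is used only with weight θ, small enough that the loss
  -- 2θu²l² from the skewness of τ is absorbed by y²l²/4. A positive definite diagonal form in (l,
  -- n) remains.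
  set θ := y ^ 2 / (8 * u ^ 2 + y ^ 2)
  have hden : 0 < 8 * u ^ 2 + y ^ 2 := by positivity
  have hθ : 0 < θ := by positivity
  have hθ1 : θ ≤ 1 := by rw [div_le_one hden]; nlinarith [sq_nonneg u]
  have hθu : 2 * θ * u ^ 2 ≤ y ^ 2 / 4 := by
    have : θ * (8 * u ^ 2 + y ^ 2) = y ^ 2 := div_mul_cancel₀ _ hden.ne'
    nlinarith [mul_pos hθ (pow_pos hτ 2)]
  have h1 := summable_exp_quadratic (a := c * (y ^ 2 / 4)) (by positivity) 0
    (c * (2 * z.re ^ 2 + z.im ^ 2))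
  have h2 := summable_exp_quadratic (a := c * (θ / 2)) (by positivity) 0 0
  refine Summable.of_nonneg_of_le (fun p => (Real.exp_pos _).le) (fun p => ?_)
    (h1.mul_of_nonneg h2 (fun _ => (Real.exp_pos _).le) (fun _ => (Real.exp_pos _).le))
  rw [← Real.exp_add]
  apply Real.exp_le_exp.2
  obtain ⟨l, n⟩ := p
  have hn : ‖z + l * τ + n‖ ^ 2 = (z.re + l * u + n) ^ 2 + (z.im + l * y) ^ 2 := by
    rw [Complex.sq_norm, Complex.normSq_apply]
    simp only [Complex.add_re, Complex.add_im, Complex.mul_re, Complex.mul_im, Complex.intCast_re,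
      Complex.intCast_im]
    ring
  simp only [hn]
  have hb : (l : ℝ) ^ 2 * y ^ 2 / 2 - z.im ^ 2 ≤ (z.im + l * y) ^ 2 := by
    nlinarith [sq_nonneg (l * y + 2 * z.im)]
  have ha : (z.re + l * u) ^ 2 ≤ 2 * z.re ^ 2 + 2 * (l ^ 2 * u ^ 2) := by
    nlinarith [sq_nonneg (z.re - l * u)]
  have ha2 : (n : ℝ) ^ 2 / 2 - (z.re + l * u) ^ 2 ≤ (z.re + l * u + n) ^ 2 := by
    nlinarith [sq_nonneg (n + 2 * (z.re + l * u))]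
  have ha3 : θ * ((n : ℝ) ^ 2 / 2 - (z.re + l * u) ^ 2) ≤ (z.re + l * u + n) ^ 2 := by
    have := mul_le_mul_of_nonneg_left ha2 hθ.le
    nlinarith [mul_nonneg (sub_nonneg.2 hθ1) (sq_nonneg (z.re + l * u + n))]
  have ha4 : θ * (z.re + l * u) ^ 2 ≤ 2 * z.re ^ 2 + y ^ 2 / 4 * l ^ 2 := by
    have h3 := mul_le_mul_of_nonneg_left ha hθ.le
    have h4 := mul_le_mul_of_nonneg_right hθu (sq_nonneg (l : ℝ))
    nlinarith [mul_nonneg (sub_nonneg.2 hθ1) (sq_nonneg z.re)]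
  have key : y ^ 2 / 4 * l ^ 2 + θ / 2 * n ^ 2 - (2 * z.re ^ 2 + z.im ^ 2)
      ≤ (z.re + l * u + n) ^ 2 + (z.im + l * y) ^ 2 := by nlinarith
  have := mul_le_mul_of_nonneg_left key hc.le
  linarith

/-- Half of the Gaussian absorbs the linear factor. Such sums majorize the differentiated lattice
series. -/
theorem summable_gaussian_mul_norm_lattice {c : ℝ} (hc : 0 < c) {τ : ℂ} (hτ : 0 < τ.im) (z : ℂ) :
    Summable fun p : ℤ × ℤ =>
      Real.exp (-c * ‖z + p.1 * τ + p.2‖ ^ 2) * ‖z + p.1 * τ + p.2‖ := by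
  refine Summable.of_nonneg_of_le (fun p => by positivity) (fun p => ?_)
    ((summable_gaussian_lattice (half_pos hc) hτ z).mul_left (1 + 1 / (c / 2)))
  set t := ‖z + p.1 * τ + p.2‖
  have h1 : c / 2 * t ^ 2 + 1 ≤ Real.exp (c / 2 * t ^ 2) := Real.add_one_le_exp _
  have h2 : t ≤ (1 + 1 / (c / 2)) * Real.exp (c / 2 * t ^ 2) := by
    have h3 : 1 / (c / 2) * (c / 2 * t ^ 2) = t ^ 2 := by field_simp
    have h4 := mul_le_mul_of_nonneg_left h1 (show 0 ≤ 1 / (c / 2) by positivity)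
    have h5 : 0 ≤ c / 2 * t ^ 2 := by positivity
    have h6 : 0 < 1 / (c / 2) := by positivity
    nlinarith [sq_nonneg (t - 1)]
  calc Real.exp (-c * t ^ 2) * t
      ≤ Real.exp (-c * t ^ 2) * ((1 + 1 / (c / 2)) * Real.exp (c / 2 * t ^ 2)) := by gcongr
    _ = (1 + 1 / (c / 2)) * Real.exp (-(c / 2) * t ^ 2) := by
        rw [mul_left_comm, ← Real.exp_add]; ring_nf

/-- Summability of the Gaussians forces only finitely many points of the coset into the unit disc,
so a nearest one exists. The factor 2 leaves room to move z inside a ball of radius δ. -/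
theorem exists_lattice_dist_pos {τ : ℂ} (hτ : 0 < τ.im) {z : ℂ}
    (hz : ∀ l n : ℤ, z + l * τ + n ≠ 0) :
    ∃ δ : ℝ, 0 < δ ∧ δ ≤ 1 ∧ ∀ l n : ℤ, 2 * δ ≤ ‖z + l * τ + n‖ := by
  have hfin : {p : ℤ × ℤ | ‖z + p.1 * τ + p.2‖ < 1}.Finite := by
    have h := (summable_gaussian_lattice one_pos hτ z).tendsto_cofinite_zero
    have h2 := h.eventually (gt_mem_nhds (Real.exp_pos (-1)))
    refine (Filter.eventually_cofinite.1 h2).subset fun p hp => ?_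
    have hp : ‖z + p.1 * τ + p.2‖ < 1 := hp
    show ¬ (Real.exp (-1 * ‖z + p.1 * τ + p.2‖ ^ 2) < Real.exp (-1))
    rw [not_lt, Real.exp_le_exp]
    nlinarith [norm_nonneg (z + p.1 * τ + p.2)]
  obtain ⟨p, hp⟩ | hne := em (∃ p : ℤ × ℤ, ‖z + p.1 * τ + p.2‖ < 1)
  · obtain ⟨q, hq, hmin⟩ := hfin.exists_minimalFor (fun p => ‖z + p.1 * τ + p.2‖) _ ⟨p, hp⟩
    have hq1 : ‖z + q.1 * τ + q.2‖ < 1 := hq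
    refine ⟨‖z + q.1 * τ + q.2‖ / 2, half_pos (norm_pos_iff.2 (hz _ _)), by linarith, ?_⟩
    intro l n
    by_contra hlt
    rw [not_le] at hlt
    have h1 : ‖z + l * τ + n‖ < 1 := by linarith
    have := hmin (j := (l, n)) h1 (by simp only; linarith)
    simp only at this
    linarith
  · refine ⟨1 / 2, by norm_num, by norm_num, fun l n => ?_⟩
    by_contra hlt
    exact hne ⟨(l, n), by simp only; linarith⟩

/-! ### The lattice sum -/

/-- The summand, as a function of the lattice point `X`. -/
noncomputable def kernel (κ y : ℝ) (J w X : ℂ) : ℂ :=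
  e (κ * (J * w - X * (w.im / y))) * cexp (-(Real.pi * κ / y) * (X * conj X)) / X

/-- As Im X = Im z + Jy, the terms in J cancel in the exponent, and the first factor has constant
norm along the coset. Only the Gaussian and 1/‖X‖ vary, which gives absolute convergence. -/
theorem norm_kernel {κ y : ℝ} (hy : y ≠ 0) (J : ℝ) (w z X : ℂ) (hX : X.im = z.im + J * y) :
    ‖kernel κ y J w X‖ = Real.exp (2 * Real.pi * κ * (z.im * w.im / y))
      * Real.exp (-(Real.pi * κ / y) * ‖X‖ ^ 2) / ‖X‖ := by
  rw [kernel, norm_div, norm_mul, norm_e, Complex.norm_exp, Complex.mul_conj, Complex.sq_norm]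
  congr 3
  · rw [Complex.im_ofReal_mul, Complex.sub_im, Complex.im_ofReal_mul,
      show (X * (w.im / y) : ℂ) = ((w.im / y : ℝ) : ℂ) * X by push_cast; ring,
      Complex.im_ofReal_mul, hX]
    field_simp
    ring
  · rw [show (-(Real.pi * κ / y) * (Complex.normSq X : ℂ) : ℂ)
      = ((-(Real.pi * κ / y) * Complex.normSq X : ℝ) : ℂ) by push_cast; ring, Complex.ofReal_re]

theorem hasFDerivAt_kernel_right (κ y : ℝ) (J w : ℂ) {X : ℂ} (hX : X ≠ 0) :
    HasFDerivAt (𝕜 := ℝ) (kernel κ y J w)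
      (kernel κ y J w X •
        ((-(2 * Real.pi * I * κ * (w.im / y)) - Real.pi * κ / y * conj X - 1 / X)
            • (ContinuousLinearMap.id ℝ ℂ)
          + (-(Real.pi * κ / y * X)) • (Complex.conjCLE : ℂ →L[ℝ] ℂ))) X := by
  have hid : HasFDerivAt (𝕜 := ℝ) (fun X : ℂ => X) (ContinuousLinearMap.id ℝ ℂ) X :=
    hasFDerivAt_id X
  have hconj : HasFDerivAt (𝕜 := ℝ) (fun X : ℂ => conj X) (Complex.conjCLE : ℂ →L[ℝ] ℂ) X :=
    (Complex.conjCLE : ℂ →L[ℝ] ℂ).hasFDerivAt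
  have h1 := (((hid.mul_const ((w.im / y : ℂ))).const_sub (J * w)).const_mul
    (κ : ℂ)).const_mul (2 * Real.pi * I : ℂ)
  have h2 := (hid.mul hconj).const_mul (-(Real.pi * κ / y) : ℂ)
  have hinv : HasFDerivAt (𝕜 := ℝ) (fun X : ℂ => X⁻¹) ((-(X ^ 2)⁻¹) • ContinuousLinearMap.id ℝ ℂ) X := by
    have := ((hasDerivAt_inv hX).hasFDerivAt.restrictScalars ℝ)
    refine this.congr_fderiv ?_
    ext v
    simp [mul_comm]
  have h := (h1.cexp.mul h2.cexp).mul hinv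
  refine (h.congr_fderiv ?_)
  ext v
  simp [kernel, e]
  field_simp
  ring

theorem hasFDerivAt_kernel_left (κ y : ℝ) (J X w : ℂ) :
    HasFDerivAt (𝕜 := ℝ) (fun w => kernel κ y J w X)
      (kernel κ y J w X • ((2 * Real.pi * I * κ * J) • (ContinuousLinearMap.id ℝ ℂ)
          + (-(2 * Real.pi * I * κ * X / y)) •
            (Complex.ofRealCLM.comp Complex.imCLM : ℂ →L[ℝ] ℂ))) w := by
  have hid : HasFDerivAt (𝕜 := ℝ) (fun X : ℂ => X) (ContinuousLinearMap.id ℝ ℂ) w :=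
    hasFDerivAt_id w
  have him : HasFDerivAt (𝕜 := ℝ) (fun w : ℂ => (w.im : ℂ))
    (Complex.ofRealCLM.comp Complex.imCLM : ℂ →L[ℝ] ℂ) w :=
    (Complex.ofRealCLM.comp Complex.imCLM : ℂ →L[ℝ] ℂ).hasFDerivAt
  have h1 := (((hid.const_mul J).sub ((him.mul_const ((y : ℂ)⁻¹)).const_mul X)).const_mul
    (κ : ℂ)).const_mul (2 * Real.pi * I : ℂ)
  have h := (h1.cexp.mul_const (cexp (-(Real.pi * κ / y) * (X * conj X)))).mul_const X⁻¹
  refine (h.congr_fderiv ?_)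
  ext v
  simp [kernel, e]
  ring_nf

/-- The summand of the lattice sum attached to the lattice point `Jτ + N`. -/
noncomputable def latticeTerm (κ : ℝ) (τ z₁ z₂ J N : ℂ) : ℂ :=
  kernel κ τ.im J z₂ (z₁ + J * τ + N)

/-- The non-holomorphic lattice sum which computes the completed Appell function. -/
noncomputable def latticeSum (κ : ℝ) (τ z₁ z₂ : ℂ) : ℂ :=
  -1 / (2 * Real.pi * I) * ∑' p : ℤ × ℤ, latticeTerm κ τ z₁ z₂ p.1 p.2

/-- The point `z` is not in the lattice `ℤτ + ℤ`. -/
def OffLattice (τ z : ℂ) : Prop := ∀ l n : ℤ, z + l * τ + n ≠ 0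

theorem norm_latticeTerm (κ : ℝ) {τ : ℂ} (hτ : 0 < τ.im) (z₁ z₂ : ℂ) (l n : ℤ) :
    ‖latticeTerm κ τ z₁ z₂ l n‖ = Real.exp (2 * Real.pi * κ * (z₁.im * z₂.im / τ.im))
      * Real.exp (-(Real.pi * κ / τ.im) * ‖z₁ + l * τ + n‖ ^ 2) / ‖z₁ + l * τ + n‖ := by
  have h := norm_kernel (κ := κ) hτ.ne' (l : ℝ) z₂ z₁ (z₁ + l * τ + n) (by simp)
  rw [← h, latticeTerm, Complex.ofReal_intCast]

theorem summable_latticeTerm {κ : ℝ} (hκ : 0 < κ) {τ : ℂ} (hτ : 0 < τ.im) {z₁ : ℂ}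
    (hz : OffLattice τ z₁) (z₂ : ℂ) :
    Summable fun p : ℤ × ℤ => latticeTerm κ τ z₁ z₂ p.1 p.2 := by
  obtain ⟨δ, hδ, -, hδX⟩ := exists_lattice_dist_pos hτ hz
  have hc : 0 < Real.pi * κ / τ.im := by have := Real.pi_pos; positivity
  refine Summable.of_norm_bounded (((summable_gaussian_lattice hc hτ z₁).mul_left
    (Real.exp (2 * Real.pi * κ * (z₁.im * z₂.im / τ.im)))).div_const (2 * δ)) fun p => ?_
  rw [norm_latticeTerm κ hτ]
  exact div_le_div_of_nonneg_left (by positivity) (by positivity) (hδX _ _)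

/-! ### Differentiability of the lattice sum -/

/-- The derivative of `kernel` in the lattice point. -/
noncomputable def kernelDerivRight (κ y : ℝ) (J w X : ℂ) : ℂ →L[ℝ] ℂ :=
  kernel κ y J w X •
    ((-(2 * Real.pi * I * κ * (w.im / y)) - Real.pi * κ / y * conj X - 1 / X)
        • (ContinuousLinearMap.id ℝ ℂ)
      + (-(Real.pi * κ / y * X)) • (Complex.conjCLE : ℂ →L[ℝ] ℂ))

/-- The derivative of `kernel` in the elliptic variable `w`. -/
noncomputable def kernelDerivLeft (κ y : ℝ) (J X w : ℂ) : ℂ →L[ℝ] ℂ :=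
  kernel κ y J w X • ((2 * Real.pi * I * κ * J) • (ContinuousLinearMap.id ℝ ℂ)
    + (-(2 * Real.pi * I * κ * X / y)) •
      (Complex.ofRealCLM.comp Complex.imCLM : ℂ →L[ℝ] ℂ))

theorem norm_kernelDerivRight_le {κ y : ℝ} (hκ : 0 < κ) (hy : 0 < y) (J w X : ℂ) :
    ‖kernelDerivRight κ y J w X‖ ≤ ‖kernel κ y J w X‖ *
      (2 * Real.pi * κ * (|w.im| / y) + 2 * (Real.pi * κ / y) * ‖X‖ + 1 / ‖X‖) := by
  have hpi := Real.pi_pos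
  rw [kernelDerivRight, norm_smul]
  refine mul_le_mul_of_nonneg_left ?_ (norm_nonneg _)
  have hn1 : ‖(-(2 * Real.pi * I * κ * (w.im / y)) - Real.pi * κ / y * conj X - 1 / X : ℂ)‖
      ≤ 2 * Real.pi * κ * (|w.im| / y) + Real.pi * κ / y * ‖X‖ + 1 / ‖X‖ := by
    refine (norm_sub_le _ _).trans (add_le_add ((norm_sub_le _ _).trans
      (add_le_add (le_of_eq ?_) (le_of_eq ?_))) (le_of_eq ?_))
    · rw [norm_neg]
      simp only [norm_mul, norm_div, Complex.norm_real, Complex.norm_I, Real.norm_eq_abs,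
        abs_of_pos hpi, abs_of_pos hκ, abs_of_pos hy, Complex.norm_ofNat, mul_one]
    · rw [norm_mul, RCLike.norm_conj, norm_div, norm_mul, Complex.norm_real, Complex.norm_real,
        Complex.norm_real, Real.norm_of_nonneg hpi.le, Real.norm_of_nonneg hκ.le,
        Real.norm_of_nonneg hy.le]
    · rw [norm_div, norm_one]
  have hn2 : ‖(-(Real.pi * κ / y * X) : ℂ)‖ = Real.pi * κ / y * ‖X‖ := by
    rw [norm_neg, norm_mul, norm_div, norm_mul, Complex.norm_real, Complex.norm_real,
        Complex.norm_real, Real.norm_of_nonneg hpi.le, Real.norm_of_nonneg hκ.le,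
        Real.norm_of_nonneg hy.le]
  have hid : ‖ContinuousLinearMap.id ℝ ℂ‖ ≤ 1 := ContinuousLinearMap.norm_id_le
  have hconj : ‖(Complex.conjCLE : ℂ →L[ℝ] ℂ)‖ ≤ 1 := Complex.conjCLE_norm.le
  refine (norm_add_le _ _).trans ?_
  rw [norm_smul, norm_smul, hn2]
  have hm1 := mul_le_mul hn1 hid (norm_nonneg _) (by positivity)
  have hm2 := mul_le_mul_of_nonneg_left hconj (show 0 ≤ Real.pi * κ / y * ‖X‖ by positivity)
  linarith

theorem norm_kernelDerivLeft_le {κ y : ℝ} (hκ : 0 < κ) (hy : 0 < y) (J X w : ℂ) :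
    ‖kernelDerivLeft κ y J X w‖ ≤ ‖kernel κ y J w X‖ *
      (2 * Real.pi * κ * (‖J‖ + ‖X‖ / y)) := by
  have hpi := Real.pi_pos
  rw [kernelDerivLeft, norm_smul]
  refine mul_le_mul_of_nonneg_left ?_ (norm_nonneg _)
  have hn1 : ‖(2 * Real.pi * I * κ * J : ℂ)‖ = 2 * Real.pi * κ * ‖J‖ := by
    simp only [norm_mul, Complex.norm_real, Complex.norm_I, Real.norm_eq_abs,
        abs_of_pos hpi, abs_of_pos hκ, Complex.norm_ofNat, mul_one]
  have hn2 : ‖(-(2 * Real.pi * I * κ * X / y) : ℂ)‖ = 2 * Real.pi * κ * (‖X‖ / y) := by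
    rw [norm_neg]
    simp only [norm_mul, norm_div, Complex.norm_real, Complex.norm_I, Real.norm_eq_abs,
        abs_of_pos hpi, abs_of_pos hκ, abs_of_pos hy, Complex.norm_ofNat, mul_one]
    ring
  have hid : ‖ContinuousLinearMap.id ℝ ℂ‖ ≤ 1 := ContinuousLinearMap.norm_id_le
  have him : ‖(Complex.ofRealCLM.comp Complex.imCLM : ℂ →L[ℝ] ℂ)‖ ≤ 1 := by
    refine (ContinuousLinearMap.opNorm_comp_le _ _).trans ?_
    rw [Complex.ofRealCLM_norm, Complex.imCLM_norm, one_mul]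
  refine (norm_add_le _ _).trans ?_
  rw [norm_smul, norm_smul, hn1, hn2]
  have hm1 := mul_le_mul_of_nonneg_left hid (show 0 ≤ 2 * Real.pi * κ * ‖J‖ by positivity)
  have hm2 := mul_le_mul_of_nonneg_left him
    (show 0 ≤ 2 * Real.pi * κ * (‖X‖ / y) by positivity)
  linarith

theorem mem_ball_lattice_bounds {τ z₁ w : ℂ} {δ : ℝ} {l n : ℤ} (hδ1 : δ ≤ 1)
    (h1 : 2 * δ ≤ ‖z₁ + l * τ + n‖) (hw : w ∈ Metric.ball z₁ δ) :
    δ ≤ ‖w + l * τ + n‖ ∧ ‖z₁ + l * τ + n‖ / 2 ≤ ‖w + l * τ + n‖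
      ∧ ‖w + l * τ + n‖ ≤ 2 * ‖z₁ + l * τ + n‖ ∧ |w.im| ≤ |z₁.im| + 1 := by
  rw [Metric.mem_ball, Complex.dist_eq] at hw
  have h2 : ‖z₁ + l * τ + n‖ ≤ ‖w + l * τ + n‖ + ‖w - z₁‖ := by
    rw [show z₁ + l * τ + n = (w + l * τ + n) - (w - z₁) by ring]; exact norm_sub_le _ _
  have h3 : ‖w + l * τ + n‖ ≤ ‖z₁ + l * τ + n‖ + ‖w - z₁‖ := by
    rw [show w + l * τ + n = (z₁ + l * τ + n) + (w - z₁) by ring]; exact norm_add_le _ _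
  have h4 := (Complex.abs_im_le_norm (w - z₁))
  rw [Complex.sub_im] at h4
  have h5 := abs_sub_abs_le_abs_sub w.im z₁.im
  refine ⟨by linarith, by linarith, by linarith, by linarith⟩

/-- Moving z₁ inside the δ-ball changes the size of a lattice point by at most a factor 2, so the
Gaussian exponent at the centre loses a factor 4. The bound no longer depends on w. -/
theorem norm_latticeTerm_deriv_left_le {κ : ℝ} (hκ : 0 < κ) {τ z₁ z₂ w : ℂ} (hτ : 0 < τ.im)
    {δ : ℝ} (hδ : 0 < δ) (hδ1 : δ ≤ 1) {l n : ℤ}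
    (h1 : 2 * δ ≤ ‖z₁ + l * τ + n‖) (hw : w ∈ Metric.ball z₁ δ) :
    ‖kernelDerivRight κ τ.im l z₂ (w + l * τ + n)‖ ≤
      Real.exp (2 * Real.pi * κ * ((|z₁.im| + 1) * |z₂.im| / τ.im)) / δ *
      ((2 * Real.pi * κ * (|z₂.im| / τ.im) + 1 / δ) *
      Real.exp (-(Real.pi * κ / τ.im / 4) * ‖z₁ + l * τ + n‖ ^ 2) + 4 * (Real.pi * κ / τ.im) *
      (Real.exp (-(Real.pi * κ / τ.im / 4) * ‖z₁ + l * τ + n‖ ^ 2) * ‖z₁ + l * τ + n‖)) := by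
  have hpi := Real.pi_pos
  obtain ⟨h7, h2, h3, h4⟩ := mem_ball_lattice_bounds hδ1 h1 hw
  have hk := norm_latticeTerm κ hτ w z₂ l n
  refine (norm_kernelDerivRight_le hκ hτ _ _ _).trans ?_
  rw [latticeTerm] at hk
  rw [hk]
  set X := w + l * τ + n
  set t := ‖z₁ + l * τ + n‖
  set c := Real.pi * κ / τ.im
  have hc : 0 < c := by positivity
  have ht : 0 ≤ t := norm_nonneg _
  have hexp1 : Real.exp (2 * Real.pi * κ * (w.im * z₂.im / τ.im))
      ≤ Real.exp (2 * Real.pi * κ * ((|z₁.im| + 1) * |z₂.im| / τ.im)) := by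
    apply Real.exp_le_exp.2
    refine mul_le_mul_of_nonneg_left (div_le_div_of_nonneg_right ?_ hτ.le) (by positivity)
    refine (le_abs_self _).trans ?_
    rw [abs_mul]
    exact mul_le_mul_of_nonneg_right h4 (abs_nonneg _)
  have hexp2 : Real.exp (-c * ‖X‖ ^ 2) ≤ Real.exp (-(c / 4) * t ^ 2) := by
    apply Real.exp_le_exp.2
    have : (t / 2) ^ 2 ≤ ‖X‖ ^ 2 := by gcongr
    nlinarith
  have hop : 2 * Real.pi * κ * (|z₂.im| / τ.im) + 2 * c * ‖X‖ + 1 / ‖X‖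
      ≤ (2 * Real.pi * κ * (|z₂.im| / τ.im) + 1 / δ) + 4 * c * t := by
    have h5 : 1 / ‖X‖ ≤ 1 / δ := div_le_div_of_nonneg_left zero_le_one hδ h7
    have h6 := mul_le_mul_of_nonneg_left h3 hc.le
    linarith
  calc _ ≤ Real.exp (2 * Real.pi * κ * ((|z₁.im| + 1) * |z₂.im| / τ.im))
        * Real.exp (-(c / 4) * t ^ 2) / δ
        * ((2 * Real.pi * κ * (|z₂.im| / τ.im) + 1 / δ) + 4 * c * t) := by
        refine mul_le_mul ?_ hop (by positivity) (by positivity)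
        exact div_le_div₀ (by positivity) (mul_le_mul hexp1 hexp2 (Real.exp_pos _).le
          (Real.exp_pos _).le) hδ h7
    _ = _ := by ring

theorem norm_latticeTerm_deriv_right_le {κ : ℝ} (hκ : 0 < κ) {τ z₁ z₂ w : ℂ} (hτ : 0 < τ.im)
    {δ : ℝ} (hδ : 0 < δ) {l n : ℤ}
    (h1 : 2 * δ ≤ ‖z₁ + l * τ + n‖) (hw : w ∈ Metric.ball z₂ 1) :
    ‖kernelDerivLeft κ τ.im l (z₁ + l * τ + n) w‖ ≤
      Real.exp (2 * Real.pi * κ * (|z₁.im| * (|z₂.im| + 1) / τ.im)) / δ *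
      (2 * Real.pi * κ / τ.im * |z₁.im| *
      Real.exp (-(Real.pi * κ / τ.im) * ‖z₁ + l * τ + n‖ ^ 2) + 2 * (2 * Real.pi * κ / τ.im) *
      (Real.exp (-(Real.pi * κ / τ.im) * ‖z₁ + l * τ + n‖ ^ 2) * ‖z₁ + l * τ + n‖)) := by
  have hpi := Real.pi_pos
  have hk := norm_latticeTerm κ hτ z₁ w l n
  refine (norm_kernelDerivLeft_le hκ hτ _ _ _).trans ?_
  rw [latticeTerm] at hk
  rw [hk]
  set X := z₁ + l * τ + n with hXdef
  set c := Real.pi * κ / τ.im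
  set B := 2 * Real.pi * κ / τ.im
  have hB : 0 < B := by positivity
  have hwim : |w.im| ≤ |z₂.im| + 1 := by
    rw [Metric.mem_ball, Complex.dist_eq] at hw
    have h4 := (Complex.abs_im_le_norm (w - z₂))
    rw [Complex.sub_im] at h4
    have h5 := abs_sub_abs_le_abs_sub w.im z₂.im
    linarith
  have hexp1 : Real.exp (2 * Real.pi * κ * (z₁.im * w.im / τ.im))
      ≤ Real.exp (2 * Real.pi * κ * (|z₁.im| * (|z₂.im| + 1) / τ.im)) := by
    apply Real.exp_le_exp.2
    refine mul_le_mul_of_nonneg_left (div_le_div_of_nonneg_right ?_ hτ.le) (by positivity)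
    refine (le_abs_self _).trans ?_
    rw [abs_mul]
    exact mul_le_mul_of_nonneg_left hwim (abs_nonneg _)
  -- The index is controlled by the lattice point through l Im τ = Im X - Im z₁.
  have hl : ‖(l : ℂ)‖ ≤ (‖X‖ + |z₁.im|) / τ.im := by
    rw [le_div_iff₀ hτ, Complex.norm_intCast]
    have h2 := Complex.abs_im_le_norm X
    have h3 : X.im = z₁.im + l * τ.im := by simp [hXdef]
    have h4 : |(l : ℝ)| * τ.im = |X.im - z₁.im| := by
      rw [h3, add_sub_cancel_left, abs_mul, abs_of_pos hτ]
    rw [h4]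
    exact (abs_sub _ _).trans (by linarith)
  have hop : 2 * Real.pi * κ * (‖(l : ℂ)‖ + ‖X‖ / τ.im) ≤ B * |z₁.im| + 2 * B * ‖X‖ := by
    have := mul_le_mul_of_nonneg_left hl (show 0 ≤ 2 * Real.pi * κ by positivity)
    rw [mul_add]
    refine (add_le_add_left this _).trans (le_of_eq ?_)
    simp only [B]
    ring
  calc _ ≤ Real.exp (2 * Real.pi * κ * (|z₁.im| * (|z₂.im| + 1) / τ.im))
        * Real.exp (-c * ‖X‖ ^ 2) / δ * (B * |z₁.im| + 2 * B * ‖X‖) := by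
        refine mul_le_mul ?_ hop (by positivity) (by positivity)
        exact div_le_div₀ (by positivity) (mul_le_mul_of_nonneg_right hexp1
          (Real.exp_pos _).le) hδ (by linarith)
    _ = _ := by ring

/-- Termwise differentiation with the uniform majorant. Real differentiability must be known because
`fderiv` is zero by default, and the sum, product and chain rules for `dWirtinger` rely on it. -/
theorem differentiableAt_latticeSum_left {κ : ℝ} (hκ : 0 < κ) {τ : ℂ} (hτ : 0 < τ.im) {z₁ : ℂ}
    (hz : OffLattice τ z₁) (z₂ : ℂ) :
    DifferentiableAt ℝ (fun w => latticeSum κ τ w z₂) z₁ := by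
  have hpi := Real.pi_pos
  obtain ⟨δ, hδ, hδ1, hδX⟩ := exists_lattice_dist_pos hτ hz
  have hc : 0 < Real.pi * κ / τ.im / 4 := by positivity
  have hu := ((((summable_gaussian_lattice hc hτ z₁).mul_left
    (2 * Real.pi * κ * (|z₂.im| / τ.im) + 1 / δ)).add
      ((summable_gaussian_mul_norm_lattice hc hτ z₁).mul_left
      (4 * (Real.pi * κ / τ.im)))).mul_left
      (Real.exp (2 * Real.pi * κ * ((|z₁.im| + 1) * |z₂.im| / τ.im)) / δ))
  have h := hasFDerivAt_tsum_of_isPreconnected (𝕜 := ℝ) hu Metric.isOpen_ball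
    (convex_ball z₁ δ).isPreconnected
    (f := fun (p : ℤ × ℤ) w => latticeTerm κ τ w z₂ p.1 p.2)
    (f' := fun p w => kernelDerivRight κ τ.im p.1 z₂ (w + p.1 * τ + p.2)) ?_ ?_
    (Metric.mem_ball_self hδ) (summable_latticeTerm hκ hτ hz z₂) (Metric.mem_ball_self hδ)
  · exact h.differentiableAt.const_mul _
  · intro p w hw
    have hne : w + p.1 * τ + p.2 ≠ 0 := fun h0 => by
      have := (mem_ball_lattice_bounds hδ1 (hδX p.1 p.2) hw).1
      rw [h0, norm_zero] at this
      linarith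
    have h := hasFDerivAt_kernel_right κ τ.im p.1 z₂ hne
    have hadd : HasFDerivAt (𝕜 := ℝ) (fun w : ℂ => w + p.1 * τ + p.2)
        (ContinuousLinearMap.id ℝ ℂ) w :=
      ((hasFDerivAt_id w).add_const _).add_const _
    exact (h.comp w hadd).congr_fderiv (ContinuousLinearMap.comp_id _)
  · intro p w hw
    exact norm_latticeTerm_deriv_left_le hκ hτ hδ hδ1 (hδX p.1 p.2) hw

theorem differentiableAt_latticeSum_right {κ : ℝ} (hκ : 0 < κ) {τ : ℂ} (hτ : 0 < τ.im) {z₁ : ℂ}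
    (hz : OffLattice τ z₁) (z₂ : ℂ) :
    DifferentiableAt ℝ (fun w => latticeSum κ τ z₁ w) z₂ := by
  have hpi := Real.pi_pos
  obtain ⟨δ, hδ, hδ1, hδX⟩ := exists_lattice_dist_pos hτ hz
  have hc : 0 < Real.pi * κ / τ.im := by positivity
  have hu := ((((summable_gaussian_lattice hc hτ z₁).mul_left
    (2 * Real.pi * κ / τ.im * |z₁.im|)).add
      ((summable_gaussian_mul_norm_lattice hc hτ z₁).mul_left
      (2 * (2 * Real.pi * κ / τ.im)))).mul_left
      (Real.exp (2 * Real.pi * κ * (|z₁.im| * (|z₂.im| + 1) / τ.im)) / δ))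
  have h := hasFDerivAt_tsum_of_isPreconnected (𝕜 := ℝ) hu Metric.isOpen_ball
    (convex_ball z₂ 1).isPreconnected
    (f := fun (p : ℤ × ℤ) w => latticeTerm κ τ z₁ w p.1 p.2)
    (f' := fun p w => kernelDerivLeft κ τ.im p.1 (z₁ + p.1 * τ + p.2) w) ?_ ?_
    (Metric.mem_ball_self one_pos) (summable_latticeTerm hκ hτ hz z₂)
    (Metric.mem_ball_self one_pos)
  · exact h.differentiableAt.const_mul _
  · intro p w _
    exact hasFDerivAt_kernel_left κ τ.im p.1 (z₁ + p.1 * τ + p.2) w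
  · intro p w hw
    exact norm_latticeTerm_deriv_right_le hκ hτ hδ (hδX p.1 p.2) hw

theorem latticeTerm_neg (κ : ℝ) (τ z₁ z₂ J N : ℂ) :
    latticeTerm κ τ (-z₁) (-z₂) (-J) (-N) = -latticeTerm κ τ z₁ z₂ J N := by
  rw [latticeTerm, latticeTerm, show -z₁ + -J * τ + -N = -(z₁ + J * τ + N) by ring, kernel, kernel,
    map_neg, Complex.neg_im, div_neg]
  push_cast
  congr 3
  · congr 2; ring
  · congr 2; ring

/-- The summand is odd under reversal of the lattice. This turns the minus sign between the two
series of Φ into the plus sign of `PhiTilde_eq`. -/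
theorem latticeSum_neg (κ : ℝ) (τ z₁ z₂ : ℂ) :
    latticeSum κ τ (-z₁) (-z₂) = -latticeSum κ τ z₁ z₂ := by
  rw [latticeSum, latticeSum, ← (Equiv.neg (ℤ × ℤ)).tsum_eq, ← mul_neg, ← tsum_neg]
  congr 1
  refine tsum_congr fun p => ?_
  rw [← latticeTerm_neg]
  simp

theorem OffLattice.neg {τ z : ℂ} (h : OffLattice τ z) : OffLattice τ (-z) := fun l n h0 =>
  h (-l) (-n) (by push_cast; linear_combination -h0)

/-! ### The completed Appell function as a lattice sum -/

/-- The Gaussian width attached to degree `s`. -/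
noncomputable def width (s : ℕ) (τ : ℂ) : ℝ := √(τ.im / s)

/-- The centre `2s Im v / Im τ` with `v = (z₁ - z₂)/2`. -/
noncomputable def centre (s : ℕ) (τ z₁ z₂ : ℂ) : ℝ := 2 * s * (((z₁ - z₂) / 2).im / τ.im)

theorem im_half (z : ℂ) : (z / 2).im = z.im / 2 := by
  rw [show z / 2 = z / ((2 : ℝ) : ℂ) by norm_num, Complex.div_ofReal_im]

theorem width_pos {s : ℕ} (hs : 0 < s) {τ : ℂ} (hτ : 0 < τ.im) : 0 < width s τ := by
  have : (0 : ℝ) < s := by exact_mod_cast hs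
  exact Real.sqrt_pos.2 (by positivity)

theorem width_sq {s : ℕ} {τ : ℂ} (hτ : 0 < τ.im) : width s τ ^ 2 = τ.im / s :=
  Real.sq_sqrt (by positivity)

/-- The double series representing the period part of the Appell function. -/
noncomputable def periodTerm (s : ℕ) (τ z₁ z₂ : ℂ) (p : ℤ × ℤ) : ℂ :=
  (signE (width s τ) (centre s τ z₁ z₂) p.2 : ℂ) * e (p.2 * (z₁ + p.1 * τ)) *
    (e (p.1 * s * (z₁ + z₂)) * e (τ * (p.1 ^ 2 * s)))

theorem summable_periodTerm {s : ℕ} (hs : 0 < s) {τ : ℂ} (hτ : 0 < τ.im) (z₁ z₂ : ℂ) :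
    Summable (periodTerm s τ z₁ z₂) := by
  have hpi := Real.pi_pos
  have hs' : (0 : ℝ) < s := by exact_mod_cast hs
  set β := centre s τ z₁ z₂
  set y := τ.im
  have h1 := summable_exp_quadratic (a := Real.pi * y * s / 3) (by positivity)
    (-(2 * Real.pi * s * (z₁ + z₂).im)) 0
  have h2 := summable_exp_quadratic (a := Real.pi * y / (3 * s)) (by positivity)
    (2 * Real.pi * y * β / s - 2 * Real.pi * z₁.im) (-(Real.pi * y * β ^ 2 / s))
  refine Summable.of_norm_bounded ((h1.mul_of_nonneg h2 (fun _ => (Real.exp_pos _).le)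
    (fun _ => (Real.exp_pos _).le)).mul_left (signEBound (width s τ) β)) fun p => ?_
  obtain ⟨J, n⟩ := p
  rw [periodTerm, norm_mul, norm_mul, norm_mul, norm_e, norm_e, norm_e, Complex.norm_real,
    Real.norm_eq_abs]
  refine (mul_le_mul_of_nonneg_right (mul_le_mul_of_nonneg_right
    (abs_signE_le (width_pos hs hτ) β n) (Real.exp_pos _).le) (by positivity)).trans ?_
  rw [mul_assoc, mul_assoc]
  refine mul_le_mul_of_nonneg_left ?_ (signEBound_pos _ _).le
  rw [← Real.exp_add, ← Real.exp_add, ← Real.exp_add, ← Real.exp_add]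
  apply Real.exp_le_exp.2
  rw [mul_pow, width_sq hτ]
  have i1 : (n * (z₁ + J * τ) : ℂ).im = n * (z₁.im + J * y) := by
    simp [Complex.mul_im, y]
  have i2 : (J * s * (z₁ + z₂) : ℂ).im = J * s * (z₁ + z₂).im := by
    simp [Complex.mul_im]
  have i3 : (τ * (J ^ 2 * s) : ℂ).im = y * (J ^ 2 * s) := by
    rw [show (τ * (J ^ 2 * s) : ℂ) = ((J ^ 2 * s : ℝ) : ℂ) * τ by push_cast; ring,
      Complex.im_ofReal_mul]
    ring
  simp only [i1, i2, i3]
  -- The q-powers alone give the indefinite form 2nJs + 2(Js)². The Gaussian weight adds n², making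
  -- it positive definite, and a third of n² and of (Js)² can be set aside as the majorant.
  have hq : 0 ≤ Real.pi * y / s * (2 / 3 * (n + 3 / 2 * (J * s)) ^ 2 + 1 / 6 * (J * s) ^ 2) := by
    positivity
  have hq2 : Real.pi * y / s * (2 / 3 * (n + 3 / 2 * (J * s)) ^ 2 + 1 / 6 * (J * s) ^ 2)
    = Real.pi * y / s * n ^ 2 + 2 * Real.pi * (n * (J * y)) + 2 * Real.pi * (y * (J ^ 2 * s))
      - Real.pi * y * s / 3 * J ^ 2 - Real.pi * y / (3 * s) * n ^ 2 := by
    field_simp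
    ring
  have hq3 : -Real.pi * ((n - β) ^ 2 * (y / s)) = -(Real.pi * y / s * n ^ 2)
    + 2 * Real.pi * y * β / s * n - Real.pi * y * β ^ 2 / s := by
    field_simp
    ring
  rw [hq3]
  rw [hq2] at hq
  linarith

/-- With c² = Im τ/s and β = s Im(z₁ - z₂)/Im τ, the relation conj X = X - 2i Im X turns
exp(-πX²/c²) into exp(-πs|X|²/Im τ) times exponentials linear in X. These combine with the theta
factors into the phase of `kernel`. -/
theorem latticeTerm_eq_fracTerm {s : ℕ} {τ : ℂ} (hτ : 0 < τ.im) (z₁ z₂ : ℂ)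
    (J m : ℤ) :
    e (J * s * (z₁ + z₂)) * e (τ * (J ^ 2 * s))
        * fracTerm (width s τ) (centre s τ z₁ z₂) (z₁ + J * τ) m
      = latticeTerm s τ z₁ z₂ J m := by
  rw [fracTerm, latticeTerm, kernel, ← mul_div_assoc]
  congr 1
  set X := z₁ + J * τ + m with hX
  have hy : (τ.im : ℂ) ≠ 0 := by exact_mod_cast hτ.ne'
  have hw2 : ((width s τ : ℂ)) ^ 2 = τ.im / s := by
    rw [← Complex.ofReal_pow, width_sq hτ]; push_cast; ring
  have hcen : (centre s τ z₁ z₂ : ℂ) = s * (z₁.im - z₂.im) / τ.im := by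
    rw [centre, im_half]; simp only [Complex.sub_im]; push_cast; field_simp
  have hconj : conj X = X - 2 * (z₁.im + J * τ.im) * I := by
    have h := Complex.sub_conj X
    have him : X.im = z₁.im + J * τ.im := by simp [hX]
    rw [him] at h
    push_cast at h
    linear_combination -h
  -- The two phases agree only modulo the integer sJm; here integrality of s matters.
  rw [hw2, hcen, hconj, ← e_add_int _ (s * J * m)]
  simp only [e, ← Complex.exp_add]
  congr 1
  have hz : z₁ = X - J * τ - m := by rw [hX]; ring
  rw [div_div_eq_mul_div]
  push_cast
  field_simp
  generalize (z₁.im : ℂ) = y₁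
  generalize X = Y at hz ⊢
  subst hz
  ring

/-- The theta coefficient of the period part. -/
noncomputable def periodCoeff (s : ℕ) (τ z₁ z₂ : ℂ) (n : ℤ) : ℂ :=
  (signE (width s τ) (centre s τ z₁ z₂) n : ℂ) *
    (e (-(τ * n ^ 2 / (4 * s))) * e (n * ((z₁ - z₂) / 2)))

/-- Completing the square, sJ² + nJ = s(J + n/2s)² - n²/4s, so summing over J for fixed n yields
Θ_{n,s}. -/
theorem periodTerm_eq {s : ℕ} (hs : 0 < s) (τ z₁ z₂ : ℂ) (J n : ℤ) :
    periodTerm s τ z₁ z₂ (J, n) = periodCoeff s τ z₁ z₂ n *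
      (e (τ * (s * ((J : ℂ) + n / (2 * s)) ^ 2)) * e (s * ((J : ℂ) + n / (2 * s)) * (z₁ + z₂))) := by
  have hs' : (s : ℂ) ≠ 0 := by exact_mod_cast hs.ne'
  simp only [periodTerm, periodCoeff, mul_assoc (signE _ _ _ : ℂ)]
  congr 1
  simp only [← e_add]
  congr 1
  field_simp
  ring

theorem hasSum_periodCoeff_mul_Theta {s : ℕ} (hs : 0 < s) {τ : ℂ} (hτ : 0 < τ.im) (z₁ z₂ : ℂ) :
    HasSum (fun n : ℤ => periodCoeff s τ z₁ z₂ n * Theta n s τ (z₁ + z₂))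
      (∑' p : ℤ × ℤ, periodTerm s τ z₁ z₂ p) := by
  have h := (summable_periodTerm hs hτ z₁ z₂).prod_symm
  have h2 := h.hasSum.prod_fiberwise fun n => (h.prod_factor n).hasSum
  have h3 : ∑' p : ℤ × ℤ, periodTerm s τ z₁ z₂ p
      = ∑' p : ℤ × ℤ, periodTerm s τ z₁ z₂ p.swap :=
    ((Equiv.prodComm ℤ ℤ).tsum_eq _).symm
  rw [h3]
  refine (congrArg (HasSum · _) (funext fun n => ?_)).mp h2
  rw [Theta, ← tsum_mul_left]
  exact tsum_congr fun J => periodTerm_eq hs τ z₁ z₂ J n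

/-- The completed level `s` Appell function equals the lattice sum. -/
theorem hasSum_appell {s : ℕ} (hs : 0 < s) {τ : ℂ} (hτ : 0 < τ.im) {z₁ : ℂ}
    (hz : OffLattice τ z₁) (z₂ : ℂ) :
    HasSum (fun J : ℤ => e (J * s * (z₁ + z₂)) * e (τ * (J ^ 2 * s)) / (1 - e z₁ * e (τ * J)))
      (latticeSum s τ z₁ z₂ + 1 / 2 * ∑' p : ℤ × ℤ, periodTerm s τ z₁ z₂ p) := by
  have hκ : (0 : ℝ) < s := by exact_mod_cast hs
  have hF := summable_latticeTerm hκ hτ hz z₂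
  have hP := summable_periodTerm hs hτ z₁ z₂
  have h1 := (hF.hasSum.prod_fiberwise fun n => (hF.prod_factor n).hasSum).mul_left
    (-1 / (2 * Real.pi * I))
  have h2 := (hP.hasSum.prod_fiberwise fun n => (hP.prod_factor n).hasSum).mul_left (1 / 2 : ℂ)
  refine (congrArg (HasSum · _) (funext fun J => ?_)).mp (h1.add h2)
  have hX : ∀ n : ℤ, z₁ + J * τ ≠ n := fun n h0 =>
    hz J (-n) (by push_cast; linear_combination h0)
  have h := tsum_fracTerm (width_pos hs hτ) (centre s τ z₁ z₂) hX
  have e1 : ∑' m : ℤ, latticeTerm s τ z₁ z₂ J m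
      = e (J * s * (z₁ + z₂)) * e (τ * (J ^ 2 * s))
        * ∑' m : ℤ, fracTerm (width s τ) (centre s τ z₁ z₂) (z₁ + J * τ) m := by
    rw [← tsum_mul_left]
    exact tsum_congr fun m => (latticeTerm_eq_fracTerm hτ z₁ z₂ J m).symm
  have e2 : ∑' n : ℤ, periodTerm s τ z₁ z₂ (J, n)
      = e (J * s * (z₁ + z₂)) * e (τ * (J ^ 2 * s))
        * ∑' n : ℤ, (signE (width s τ) (centre s τ z₁ z₂) n : ℂ) * e (n * (z₁ + J * τ)) := by
    rw [← tsum_mul_left]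
    refine tsum_congr fun n => ?_
    rw [periodTerm]
    ring
  have e3 : e z₁ * e (τ * J) = e (z₁ + J * τ) := by rw [← e_add]; ring_nf
  simp only at e2 ⊢
  rw [e1, e2, e3]
  linear_combination -(e (J * s * (z₁ + z₂)) * e (τ * (J ^ 2 * s))) * h

/-! ### Sums over residue classes -/

/-- Splitting of the integers into residue classes. -/
theorem hasSum_residues {N : ℕ} (hN : 0 < N) {f : ℤ → ℂ} (hf : Summable f) :
    ∑' n : ℤ, f n = ∑ j ∈ Finset.range N, ∑' l : ℤ, f (j + N * l) := by
  have : NeZero N := ⟨hN.ne'⟩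
  have h1 : ∑' n : ℤ, f n = ∑' p : Fin N × ℤ, f ((p.1 : ℕ) + N * p.2) := by
    rw [← ((Int.divModEquiv N).trans (Equiv.prodComm _ _)).symm.tsum_eq]
    refine tsum_congr fun p => ?_
    congr 1
    simp [Int.divModEquiv]
    ring
  have hs : Summable fun p : Fin N × ℤ => f ((p.1 : ℕ) + N * p.2) := by
    have := (((Int.divModEquiv N).trans (Equiv.prodComm _ _)).symm.summable_iff (f := f)).2 hf
    refine this.congr fun p => ?_
    simp only [Function.comp_apply]
    congr 1
    simp [Int.divModEquiv]
    ring
  rw [h1, hs.tsum_prod, tsum_fintype, Finset.sum_range]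

theorem Theta_add_period (j l : ℤ) {k : ℕ} (hk : 0 < k) (τ z : ℂ) :
    Theta (j + 2 * k * l) k τ z = Theta j k τ z := by
  have hk' : (k : ℂ) ≠ 0 := by exact_mod_cast hk.ne'
  rw [Theta, Theta, ← (Equiv.subRight l).tsum_eq]
  refine tsum_congr fun n => ?_
  have : (((Equiv.subRight l) n : ℤ) : ℂ) + ((j + 2 * k * l : ℤ) : ℂ) / (2 * k) = n + j / (2 * k) := by
    simp only [Equiv.subRight_apply]
    push_cast
    field_simp
    ring
  simp only [this]

theorem Theta_neg_right (j : ℤ) (k : ℕ) (τ z : ℂ) : Theta j k τ (-z) = Theta (-j) k τ z := by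
  rw [Theta, Theta, ← (Equiv.neg ℤ).tsum_eq]
  refine tsum_congr fun n => ?_
  simp only [Equiv.neg_apply]
  push_cast
  congr 2 <;> ring

/-- The coefficient of the function `zwegersR`. -/
noncomputable def zwegersCoeff (s : ℕ) (τ v : ℂ) (n : ℤ) : ℂ :=
  ((Real.sign (n + 1 / 2) - zwegersE ((n + 2 * s * (v.im / τ.im)) * √(τ.im / s)) : ℝ) : ℂ)
      * Complex.exp (-(Real.pi * Complex.I * n ^ 2 / (2 * s) * τ)
          - 2 * Real.pi * Complex.I * n * v)

/-- Zwegers' R carries v with the opposite sign, hence the reflection n ↦ -n. The exceptional 2 at n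
= 0 is harmless later, where it multiplies Θ₀ - Θ₀. -/
theorem zwegersCoeff_neg {s : ℕ} (hs : 0 < s) (τ z₁ z₂ : ℂ) (n : ℤ) :
    zwegersCoeff s τ ((z₁ - z₂) / 2) (-n)
      = -periodCoeff s τ z₁ z₂ n + if n = 0 then 2 else 0 := by
  have hs' : (s : ℂ) ≠ 0 := by exact_mod_cast hs.ne'
  have h1 : Real.sign (((-n : ℤ) : ℝ) + 1 / 2)
      - zwegersE ((((-n : ℤ) : ℝ) + 2 * s * (((z₁ - z₂) / 2).im / τ.im)) * √(τ.im / s))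
      = signE (width s τ) (-centre s τ z₁ z₂) (-n) := by
    rw [signE, sub_neg_eq_add]; rfl
  rw [zwegersCoeff, h1, signE_neg, neg_neg, periodCoeff]
  have h2 : cexp (-(Real.pi * I * ((-n : ℤ) : ℂ) ^ 2 / (2 * s) * τ)
          - 2 * Real.pi * I * ((-n : ℤ) : ℂ) * ((z₁ - z₂) / 2))
      = e (-(τ * n ^ 2 / (4 * s))) * e (n * ((z₁ - z₂) / 2)) := by
    rw [← e_add, e]
    congr 1
    push_cast
    field_simp
    ring
  rw [h2]
  push_cast
  split_ifs with h0
  · subst h0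
    simp [e_zero]
  · simp

/-- The coefficients depend only on z₁ - z₂, which is unchanged under (z₁, z₂) ↦ (-z₂, -z₁), while
Θ_n becomes Θ_{-n}. Periodicity of Θ in its index then groups the sum over n into residue classes
modulo 2s. -/
theorem sum_zwegersR_mul_Theta {s : ℕ} (hs : 0 < s) {τ : ℂ} (hτ : 0 < τ.im) (z₁ z₂ : ℂ) :
    ∑ j ∈ Finset.range (2 * s), zwegersR s j τ ((z₁ - z₂) / 2)
        * (Theta j s τ (z₁ + z₂) - Theta (-j) s τ (z₁ + z₂))
      = ∑' p : ℤ × ℤ, periodTerm s τ z₁ z₂ p - ∑' p : ℤ × ℤ, periodTerm s τ (-z₂) (-z₁) p := by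
  have h1 := hasSum_periodCoeff_mul_Theta hs hτ z₁ z₂
  have h2 := hasSum_periodCoeff_mul_Theta hs hτ (-z₂) (-z₁)
  have hcoeff : ∀ n, periodCoeff s τ (-z₂) (-z₁) n = periodCoeff s τ z₁ z₂ n := fun n => by
    rw [periodCoeff, periodCoeff, centre, centre, show -z₂ - -z₁ = z₁ - z₂ by ring]
  have h3 := h1.sub h2
  have h4 : HasSum (fun n : ℤ => zwegersCoeff s τ ((z₁ - z₂) / 2) n
      * (Theta n s τ (z₁ + z₂) - Theta (-n) s τ (z₁ + z₂)))
      (∑' p : ℤ × ℤ, periodTerm s τ z₁ z₂ p - ∑' p : ℤ × ℤ, periodTerm s τ (-z₂) (-z₁) p) := by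
    rw [← (Equiv.neg ℤ).hasSum_iff]
    refine (congrArg (HasSum · _) (funext fun n => ?_)).mp h3
    simp only [Function.comp_apply, Equiv.neg_apply]
    rw [zwegersCoeff_neg hs, hcoeff, show -z₂ + -z₁ = -(z₁ + z₂) by ring, Theta_neg_right]
    split_ifs with h0
    · subst h0
      simp
    · simp only [neg_neg]
      ring
  rw [← h4.tsum_eq, hasSum_residues (N := 2 * s) (by omega) h4.summable]
  refine Finset.sum_congr rfl fun j _ => ?_
  have ht : ∀ l : ℤ, Theta (-((j : ℤ) + (2 * s : ℕ) * l)) s τ (z₁ + z₂) = Theta (-j) s τ (z₁ + z₂) := by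
    intro l
    rw [show -((j : ℤ) + (2 * s : ℕ) * l) = -j + 2 * s * (-l) by push_cast; ring,
      Theta_add_period _ _ hs]
  have ht' : ∀ l : ℤ, Theta ((j : ℤ) + (2 * s : ℕ) * l) s τ (z₁ + z₂) = Theta j s τ (z₁ + z₂) := by
    intro l
    rw [show (j : ℤ) + (2 * s : ℕ) * l = j + 2 * s * l by push_cast; ring,
      Theta_add_period _ _ hs]
  simp only [ht, ht']
  rw [tsum_mul_right]
  congr 1

/-- The modified function `Φ̃` as a sum of two lattice sums. -/
theorem PhiTilde_eq (m : ℕ) {τ : ℂ} (hτ : 0 < τ.im) {z₁ z₂ : ℂ} (h₁ : OffLattice τ z₁)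
    (h₂ : OffLattice τ z₂) (t : ℂ) :
    PhiTilde m τ z₁ z₂ t = e ((m + 1) * t) *
      (latticeSum ((m + 1 : ℕ) : ℝ) τ z₁ z₂ + latticeSum ((m + 1 : ℕ) : ℝ) τ z₂ z₁) := by
  have hs : 0 < m + 1 := m.succ_pos
  have a1 := hasSum_appell hs hτ h₁ z₂
  have a2 := hasSum_appell hs hτ h₂.neg (-z₁)
  have a3 := (a1.sub a2).tsum_eq
  have hPhi : Phi m τ z₁ z₂ t = e ((m + 1) * t) *
      (latticeSum ((m + 1 : ℕ) : ℝ) τ z₁ z₂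
          + 1 / 2 * ∑' p : ℤ × ℤ, periodTerm (m + 1) τ z₁ z₂ p -
        (latticeSum ((m + 1 : ℕ) : ℝ) τ (-z₂) (-z₁)
          + 1 / 2 * ∑' p : ℤ × ℤ, periodTerm (m + 1) τ (-z₂) (-z₁) p)) := by
    rw [Phi, ← a3]
    congr 1
    refine tsum_congr fun j => ?_
    push_cast
    rw [show -((j : ℂ) * (m + 1) * (z₁ + z₂)) = j * (m + 1) * (-z₂ + -z₁) by ring]
  have hadd := sum_zwegersR_mul_Theta hs hτ z₁ z₂
  rw [PhiTilde, hPhi, PhiAdd, show 2 * m + 2 = 2 * (m + 1) by ring, hadd, latticeSum_neg]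
  ring

/-! ### Transformation of the lattice terms -/

theorem norm_e_ratCast (q : ℚ) : ‖e q‖ = 1 := by
  rw [norm_e, show (q : ℂ) = ((q : ℝ) : ℂ) by push_cast; rfl, Complex.ofReal_im]
  simp

theorem im_neg_one_div (τ : ℂ) : (-1 / τ).im = τ.im / Complex.normSq τ := by
  rw [neg_div, Complex.neg_im, one_div, Complex.inv_im]
  ring

/-- The lattice point for -1/τ is X/τ with X = z₁ + Nτ - J. The quantity |X|²/Im τ is invariant, 1/X
contributes the factor τ, and the linear phases differ by κ z₁ z₂/τ. -/
theorem latticeTerm_S (κ : ℝ) {τ : ℂ} (hτ : 0 < τ.im) (z₁ z₂ J N : ℂ) :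
    latticeTerm κ (-1 / τ) (z₁ / τ) (z₂ / τ) J N
      = τ * e (κ * z₁ * z₂ / τ) * latticeTerm κ τ z₁ z₂ N (-J) := by
  have hτ0 : τ ≠ 0 := fun h => by rw [h] at hτ; simp at hτ
  set X := z₁ + N * τ + -J with hX
  have hX' : z₁ / τ + J * (-1 / τ) + N = X / τ := by rw [hX]; field_simp; ring
  have hy : (τ.im : ℂ) ≠ 0 := by exact_mod_cast hτ.ne'
  have hn : (Complex.normSq τ : ℂ) = τ * conj τ := (Complex.mul_conj τ).symm
  have hcτ : conj τ ≠ 0 := by simpa using hτ0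
  rw [latticeTerm, latticeTerm, hX', ← hX, kernel, kernel, im_neg_one_div]
  have him : ((z₂ / τ).im : ℂ) / ((τ.im / Complex.normSq τ : ℝ) : ℂ)
      = (z₂.im * τ.re - z₂.re * τ.im) / τ.im := by
    rw [Complex.div_im, ← Complex.ofReal_div]
    have : Complex.normSq τ ≠ 0 := by simpa using hτ0
    rw [show (z₂.im * τ.re / Complex.normSq τ - z₂.re * τ.im / Complex.normSq τ)
      / (τ.im / Complex.normSq τ) = (z₂.im * τ.re - z₂.re * τ.im) / τ.im by field_simp]
    push_cast
    ring
  rw [him]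
  have h1 : -(Real.pi * κ / ((τ.im / Complex.normSq τ : ℝ) : ℂ)) * (X / τ * conj (X / τ))
      = -(Real.pi * κ / τ.im) * (X * conj X) := by
    rw [map_div₀]
    push_cast
    rw [hn]
    field_simp
  rw [h1]
  have h2 : e (κ * (J * (z₂ / τ) - X / τ * ((z₂.im * τ.re - z₂.re * τ.im) / τ.im)))
      = e (κ * z₁ * z₂ / τ) * e (κ * (N * z₂ - X * (z₂.im / τ.im))) := by
    rw [← e_add]
    congr 1
    have hz2 : z₂ = z₂.re + z₂.im * I := (Complex.re_add_im z₂).symm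
    have ht : τ = τ.re + τ.im * I := (Complex.re_add_im τ).symm
    have hz1 : z₁ = X - N * τ + J := by rw [hX]; ring
    rw [hz1]
    field_simp
    linear_combination (κ * X * z₂.im) * ht - (κ * X * τ.im) * hz2
  rw [h2]
  field_simp

theorem latticeTerm_T (κ : ℝ) (τ z₁ z₂ J N : ℂ) :
    latticeTerm κ (τ + 1) z₁ z₂ J N = latticeTerm κ τ z₁ z₂ J (N + J) := by
  rw [latticeTerm, latticeTerm, show z₁ + J * (τ + 1) + N = z₁ + J * τ + (N + J) by ring]
  simp

theorem im_add_mul_add_ratCast (z τ : ℂ) (k ε : ℚ) :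
    (z + k * τ + ε).im = z.im + k * τ.im := by
  rw [show (k : ℂ) = ((k : ℝ) : ℂ) by push_cast; rfl, show (ε : ℂ) = ((ε : ℝ) : ℂ) by push_cast; rfl]
  simp [Complex.mul_im]

theorem im_natCast_mul (M : ℕ) (τ : ℂ) : (M * τ).im = M * τ.im := by simp [Complex.mul_im]

/-- Passing from τ to Mτ and from κ to κM preserves κ/Im τ, hence the Gaussian. The shifts by jτ + ε
and kτ + ε become an index coset and a phase of modulus one. -/
theorem latticeTerm_shift (κ : ℝ) {M : ℕ} (hM : 0 < M) {τ : ℂ} (hτ : 0 < τ.im) (z₁ z₂ : ℂ)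
    (j k ε : ℚ) (l n : ℤ) :
    e (κ * τ * j * k) * e (κ * (k * z₁ + j * z₂)) *
        latticeTerm (κ * M) (M * τ) (z₁ + j * τ + ε) (z₂ + k * τ + ε) l n
      = e (κ * (M * l * ε - k * (ε + n))) * latticeTerm κ τ z₁ z₂ (j + M * l) (ε + n) := by
  have hM' : (M : ℂ) ≠ 0 := by exact_mod_cast hM.ne'
  have hy : (τ.im : ℂ) ≠ 0 := by exact_mod_cast hτ.ne'
  rw [latticeTerm, latticeTerm, kernel, kernel, im_add_mul_add_ratCast, im_natCast_mul]
  set X := z₁ + (j + M * l) * τ + (ε + n) with hX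
  have hX' : z₁ + j * τ + ε + l * (M * τ) + n = X := by rw [hX]; ring
  have hg : -(Real.pi * ((κ * M : ℝ) : ℂ) / ((M * τ.im : ℝ) : ℂ)) * (X * conj X)
      = -(Real.pi * κ / τ.im) * (X * conj X) := by
    push_cast
    field_simp
  rw [hX', hg]
  have key : e (κ * τ * j * k) * e (κ * (k * z₁ + j * z₂)) *
      e (((κ * M : ℝ) : ℂ) * (l * (z₂ + k * τ + ε)
        - X * (((z₂.im + k * τ.im : ℝ) : ℂ) / ((M * τ.im : ℝ) : ℂ))))
      = e (κ * (M * l * ε - k * (ε + n))) * e (κ * ((j + M * l) * z₂ - X * (z₂.im / τ.im))) := by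
    simp only [← e_add]
    congr 1
    have hz1 : z₁ = X - ((j + M * l) * τ + (ε + n)) := by rw [hX]; ring
    rw [hz1]
    push_cast
    field_simp
    ring
  linear_combination (cexp (-(Real.pi * κ / τ.im) * (X * conj X)) / X) * key

/-! ### Half-integral shifts and finite Fourier sums -/

/-- `2x` is an integer. -/
def IsHalfInt (x : ℚ) : Prop := ∃ a : ℤ, 2 * x = a

/-- `2z` is not in the lattice `ℤτ + ℤ`. -/
def Generic (τ z : ℂ) : Prop := ∀ a b : ℤ, 2 * z ≠ a + b * τ

/-- Doubling makes both half-integral shifts lattice vectors, so a condition on 2z excludes every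
pole at once. -/
theorem Generic.offLattice {τ z : ℂ} (h : Generic τ z) {j ε : ℚ} (hj : IsHalfInt j)
    (hε : IsHalfInt ε) (M : ℕ) : OffLattice (M * τ) (z + j * τ + ε) := by
  intro l n h0
  obtain ⟨a, ha⟩ := hj
  obtain ⟨b, hb⟩ := hε
  have ha' : (2 * j : ℂ) = a := by exact_mod_cast ha
  have hb' : (2 * ε : ℂ) = b := by exact_mod_cast hb
  apply h (-(b + 2 * n)) (-(a + 2 * M * l))
  push_cast
  rw [← ha', ← hb']
  linear_combination 2 * h0

theorem Generic.offLattice_one {τ z : ℂ} (h : Generic τ z) {j ε : ℚ} (hj : IsHalfInt j)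
    (hε : IsHalfInt ε) : OffLattice τ (z + j * τ + ε) := by
  have := h.offLattice hj hε 1
  rwa [Nat.cast_one, one_mul] at this

theorem summable_latticeTerm_shift {κ : ℚ} (hκ : 0 < κ) {τ : ℂ} (hτ : 0 < τ.im) {z₁ : ℂ}
    (hz : Generic τ z₁) (z₂ : ℂ) {j ε : ℚ} (hj : IsHalfInt j) (hε : IsHalfInt ε) :
    Summable fun p : ℤ × ℤ => ‖latticeTerm κ τ z₁ z₂ (j + p.1) (ε + p.2)‖ := by
  have hκ' : (0 : ℝ) < κ := by exact_mod_cast hκ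
  have h := ((summable_latticeTerm hκ' hτ (hz.offLattice_one hj hε) (z₂ + ε)).norm).mul_left
    ‖e (κ * (j * z₂))‖
  refine h.congr fun p => ?_
  -- With M = 1 and k = 0 the shift formula reduces to the unshifted lattice sum at z₁ + jτ + ε; the
  -- remaining phase has norm one.
  have h1 := congrArg norm (latticeTerm_shift (κ : ℝ) one_pos hτ z₁ z₂ j 0 ε p.1 p.2)
  have h2 : ‖e (((κ : ℝ) : ℂ) * (((1 : ℕ) : ℂ) * p.1 * ε - ((0 : ℚ) : ℂ) * (ε + p.2)))‖ = 1 := by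
    rw [← norm_e_ratCast (κ * (p.1 * ε))]
    congr 2
    push_cast
    ring
  rw [norm_mul, norm_mul (e (((κ : ℝ) : ℂ) * (((1 : ℕ) : ℂ) * p.1 * ε - ((0 : ℚ) : ℂ) * (ε + p.2)))),
    h2, one_mul] at h1
  simpa [e_zero] using h1

theorem tsum_residues_prod {N : ℕ} (hN : 0 < N) {f : ℤ → ℤ → ℂ}
    (hf : Summable fun p : ℤ × ℤ => f p.1 p.2) :
    ∑' p : ℤ × ℤ, f p.1 p.2
      = ∑ r ∈ Finset.range N, ∑' p : ℤ × ℤ, f (r + N * p.1) p.2 := by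
  rw [hf.tsum_prod, hasSum_residues hN hf.prod]
  refine Finset.sum_congr rfl fun r _ => ?_
  have hinj : Function.Injective fun p : ℤ × ℤ => ((r + N * p.1 : ℤ), p.2) := by
    rintro ⟨a, b⟩ ⟨c, d⟩ h
    simp only [Prod.mk.injEq, add_right_inj] at h
    have hN' : (N : ℤ) ≠ 0 := by exact_mod_cast hN.ne'
    rw [Prod.mk.injEq]
    exact ⟨mul_left_cancel₀ hN' h.1, h.2⟩
  exact ((hf.comp_injective hinj).tsum_prod).symm

/-- Orthogonality of characters: e(-mν/M) is an M-th root of unity, and coprimality makes it trivial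
exactly when M divides ν. -/
theorem sum_e_residues {M m : ℕ} (hM : 0 < M) (hcop : Nat.Coprime m M) (b₀ : ℚ) (ν : ℤ) :
    ∑ r ∈ Finset.range M, e (-(m / M * (b₀ + r) * ν))
      = if (M : ℤ) ∣ ν then M * e (-(m / M * b₀ * ν)) else 0 := by
  have hM' : (M : ℂ) ≠ 0 := by exact_mod_cast hM.ne'
  set ζ := e (-(m / M * ν))
  have hterm : ∀ r : ℕ, e (-(m / M * (b₀ + r) * ν)) = e (-(m / M * b₀ * ν)) * ζ ^ r := by
    intro r
    have : ζ ^ r = e ((r : ℤ) * (-(m / M * ν))) := by rw [e_int_mul, zpow_natCast]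
    rw [this, ← e_add]
    congr 1
    push_cast
    ring
  simp only [hterm, ← Finset.mul_sum]
  split_ifs with h
  · obtain ⟨l, rfl⟩ := h
    have : ζ = 1 := by
      rw [← e_int (-(m * l))]
      simp only [ζ]
      congr 1
      push_cast
      field_simp
    rw [this]
    simp [mul_comm]
  · have hζ : ζ ≠ 1 := by
      intro h1
      obtain ⟨n, hn⟩ := (e_eq_one_iff _).1 h1
      have h2 : ((m * ν : ℤ) : ℂ) = ((M * (-n) : ℤ) : ℂ) := by
        push_cast
        rw [← hn]
        field_simp
      have h3 : (m : ℤ) * ν = M * (-n) := by exact_mod_cast h2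
      exact h ((Int.isCoprime_iff_gcd_eq_one.2 (by simpa using hcop)).symm.dvd_of_dvd_mul_left
        ⟨-n, h3⟩)
    have hζM : ζ ^ M = 1 := by
      have : ζ ^ M = e ((M : ℤ) * (-(m / M * ν))) := by rw [e_int_mul, zpow_natCast]
      rw [this, ← e_int (-(m * ν))]
      congr 1
      push_cast
      field_simp
    have h4 := geom_sum_mul ζ M
    rw [hζM, sub_self] at h4
    rw [(mul_eq_zero.1 h4).resolve_right (sub_ne_zero.2 hζ), mul_zero]

/-! ### Modular and elliptic transformations of Ψ̃ -/

/-- One of the two lattice sums making up `Ψ̃`, with `t = 0`. -/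
noncomputable def halfPsi (M m : ℕ) (ε j k : ℚ) (τ z₁ z₂ : ℂ) : ℂ :=
  e (τ * (m * j * k / M)) * e (m / M * (k * z₁ + j * z₂)) *
    latticeSum m (M * τ) (z₁ + j * τ + ε) (z₂ + k * τ + ε)

/-- The summand of `halfPsi`. -/
noncomputable def psiTerm (M m : ℕ) (ε j k : ℚ) (τ z₁ z₂ : ℂ) (p : ℤ × ℤ) : ℂ :=
  e (m / M * (M * p.1 * ε - k * (ε + p.2))) *
    latticeTerm ((m / M : ℚ) : ℝ) τ z₁ z₂ (j + M * p.1) (ε + p.2)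

theorem halfPsi_eq {M m : ℕ} (hM : 0 < M) {τ : ℂ} (hτ : 0 < τ.im) (ε j k : ℚ) (z₁ z₂ : ℂ) :
    halfPsi M m ε j k τ z₁ z₂
      = -1 / (2 * Real.pi * I) * ∑' p : ℤ × ℤ, psiTerm M m ε j k τ z₁ z₂ p := by
  have hM' : (M : ℝ) ≠ 0 := by exact_mod_cast hM.ne'
  rw [halfPsi, latticeSum, mul_left_comm, ← tsum_mul_left]
  congr 1
  refine tsum_congr fun p => ?_
  have h := latticeTerm_shift ((m / M : ℚ) : ℝ) hM hτ z₁ z₂ j k ε p.1 p.2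
  have h1 : ((m / M : ℚ) : ℝ) * M = m := by push_cast; field_simp
  have h2 : (((m / M : ℚ) : ℝ) : ℂ) = m / M := by push_cast; rfl
  rw [h1, h2] at h
  rw [psiTerm, ← h]
  congr 3
  ring

theorem norm_psiTerm (M m : ℕ) (ε j k : ℚ) (τ z₁ z₂ : ℂ) (p : ℤ × ℤ) :
    ‖psiTerm M m ε j k τ z₁ z₂ p‖
      = ‖latticeTerm ((m / M : ℚ) : ℝ) τ z₁ z₂ (j + M * p.1) (ε + p.2)‖ := by
  rw [psiTerm, norm_mul]
  have : ‖e ((m : ℂ) / M * (M * p.1 * ε - k * (ε + p.2)))‖ = 1 := by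
    rw [← norm_e_ratCast (m / M * (M * p.1 * ε - k * (ε + p.2)))]
    congr 2
    push_cast
    rfl
  rw [this, one_mul]

theorem ratCast_div_pos {M m : ℕ} (hm : 0 < m) (hM : 0 < M) : (0 : ℚ) < (m / M : ℚ) := by
  have h1 : (0 : ℚ) < m := by exact_mod_cast hm
  have h2 : (0 : ℚ) < M := by exact_mod_cast hM
  positivity

theorem summable_psiTerm {M m : ℕ} (hm : 0 < m) (hM : 0 < M) {τ : ℂ} (hτ : 0 < τ.im) {z₁ : ℂ}
    (hz : Generic τ z₁) (z₂ : ℂ) {ε j : ℚ} (hε : IsHalfInt ε) (hj : IsHalfInt j) (k : ℚ) :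
    Summable (psiTerm M m ε j k τ z₁ z₂) := by
  have h := summable_latticeTerm_shift (ratCast_div_pos hm hM) hτ hz z₂ hj hε
  have hinj : Function.Injective fun p : ℤ × ℤ => ((M * p.1 : ℤ), p.2) := by
    rintro ⟨a, b⟩ ⟨c, d⟩ h
    simp only [Prod.mk.injEq] at h
    have hN' : (M : ℤ) ≠ 0 := by exact_mod_cast hM.ne'
    rw [Prod.mk.injEq]
    exact ⟨mul_left_cancel₀ hN' h.1, h.2⟩
  refine Summable.of_norm ((h.comp_injective hinj).congr fun p => ?_)
  rw [norm_psiTerm]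
  simp only [Function.comp_apply]
  push_cast
  rfl

/-- Behaviour of the lattice sums under `τ ↦ -1/τ`. -/
theorem halfPsi_S {M m : ℕ} (hm : 0 < m) (hM : 0 < M) (hcop : Nat.Coprime m M)
    {ε ε' j k a₀ b₀ : ℚ} (hε : IsHalfInt ε) (hε' : IsHalfInt ε') (hj : ∃ n : ℤ, j + ε' = n)
    (hk : ∃ n : ℤ, k + ε' = n) (ha : ∃ n : ℤ, a₀ = ε + n) (hb : ∃ n : ℤ, b₀ = ε + n)
    {τ : ℂ} (hτ : 0 < τ.im) {z₁ : ℂ} (hz : Generic τ z₁) (z₂ : ℂ) :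
    halfPsi M m ε j k (-1 / τ) (z₁ / τ) (z₂ / τ)
      = τ / M * e (m / M * z₁ * z₂ / τ) * ∑ r ∈ Finset.range M, ∑ r' ∈ Finset.range M,
          e (-(m / M * ((b₀ + r' : ℚ) * j + (a₀ + r : ℚ) * k)))
            * halfPsi M m ε' (a₀ + r) (b₀ + r') τ z₁ z₂ := by
  obtain ⟨j₁, hj₁⟩ := hj
  obtain ⟨k₁, hk₁⟩ := hk
  obtain ⟨a₁, ha₁⟩ := ha
  obtain ⟨b₁, hb₁⟩ := hb
  have hj₁' : (j : ℂ) = j₁ - ε' := by rw [eq_sub_iff_add_eq]; exact_mod_cast hj₁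
  have hk₁' : (k : ℂ) = k₁ - ε' := by rw [eq_sub_iff_add_eq]; exact_mod_cast hk₁
  have ha₁' : (a₀ : ℂ) = ε + a₁ := by exact_mod_cast ha₁
  have hb₁' : (b₀ : ℂ) = ε + b₁ := by exact_mod_cast hb₁
  have hM' : (M : ℂ) ≠ 0 := by exact_mod_cast hM.ne'
  have hMZ : (M : ℤ) ≠ 0 := by exact_mod_cast hM.ne'
  have ha₀ : IsHalfInt a₀ := by
    obtain ⟨x, hx⟩ := hε
    exact ⟨x + 2 * a₁, by rw [ha₁]; push_cast; linarith⟩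
  have hshift : ∀ r : ℕ, IsHalfInt (a₀ + r) := fun r => by
    obtain ⟨x, hx⟩ := ha₀
    exact ⟨x + 2 * r, by push_cast; linarith⟩
  have hτS : 0 < (-1 / τ).im := by
    rw [im_neg_one_div]
    have : τ ≠ 0 := fun h => by rw [h] at hτ; simp at hτ
    have := Complex.normSq_pos.2 this
    positivity
  set κ : ℝ := ((m / M : ℚ) : ℝ) with hκdef
  have hκ : (κ : ℂ) = m / M := by rw [hκdef]; push_cast; rfl
  -- Common form of both sides: a sum over the full index coset with a divisibility condition on n.
  -- On the right that condition is M⁻¹ times the character sum over r', and the sum over r joins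
  -- the classes of q modulo M.
  let U : ℤ → ℤ → ℂ := fun q n => e (-(m / M * (a₀ + q) * k)) *
    ((if (M : ℤ) ∣ j₁ + n then e (-(m / M * b₀ * (j₁ + n : ℤ))) else 0) *
      latticeTerm κ τ z₁ z₂ (a₀ + q) (ε' + n))
  have hUsum : Summable fun p : ℤ × ℤ => U p.1 p.2 := by
    refine Summable.of_norm_bounded
      (summable_latticeTerm_shift (ratCast_div_pos hm hM) hτ hz z₂ ha₀ hε') fun p => ?_
    simp only [U, norm_mul]
    have n1 : ‖e (-((m : ℂ) / M * (a₀ + p.1) * k))‖ = 1 := by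
      rw [← norm_e_ratCast (-(m / M * (a₀ + p.1) * k))]
      congr 2
      push_cast
      rfl
    have n2 : ‖(if (M : ℤ) ∣ j₁ + p.2 then e (-((m : ℂ) / M * b₀ * (j₁ + p.2 : ℤ))) else 0)‖ ≤ 1 := by
      split_ifs
      · refine le_of_eq ?_
        rw [← norm_e_ratCast (-(m / M * b₀ * (j₁ + p.2 : ℤ)))]
        congr 2
        push_cast
        rfl
      · simp
    rw [n1, one_mul]
    exact mul_le_of_le_one_left (norm_nonneg _) n2
  have hinner : ∀ r : ℕ, ∑ r' ∈ Finset.range M,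
      e (-(m / M * ((b₀ + r' : ℚ) * j + (a₀ + r : ℚ) * k)))
            * halfPsi M m ε' (a₀ + r) (b₀ + r') τ z₁ z₂
      = -1 / (2 * Real.pi * I) * (M * ∑' p : ℤ × ℤ, U (r + M * p.1) p.2) := by
    intro r
    have h1 : ∀ r' : ℕ, e (-((m : ℂ) / M * ((b₀ + r' : ℚ) * j + (a₀ + r : ℚ) * k)))
            * halfPsi M m ε' (a₀ + r) (b₀ + r') τ z₁ z₂
        = -1 / (2 * Real.pi * I) * ∑' p : ℤ × ℤ,
          e (-((m : ℂ) / M * ((b₀ + r' : ℚ) * j + (a₀ + r : ℚ) * k)))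
            * psiTerm M m ε' (a₀ + r) (b₀ + r') τ z₁ z₂ p := by
      intro r'
      rw [halfPsi_eq hM hτ, tsum_mul_left]
      ring
    simp only [h1]
    have hs : ∀ r' ∈ Finset.range M, Summable fun p : ℤ × ℤ =>
        e (-((m : ℂ) / M * ((b₀ + r' : ℚ) * j + (a₀ + r : ℚ) * k)))
            * psiTerm M m ε' (a₀ + r) (b₀ + r') τ z₁ z₂ p := fun r' _ =>
      (summable_psiTerm hm hM hτ hz z₂ hε' (hshift r) _).mul_left _
    rw [← Finset.mul_sum, ← Summable.tsum_finsetSum hs]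
    congr 1
    rw [← tsum_mul_left]
    refine tsum_congr fun p => ?_
    have h2 : ∀ r' : ℕ, e (-((m : ℂ) / M * ((b₀ + r' : ℚ) * j + (a₀ + r : ℚ) * k)))
            * psiTerm M m ε' (a₀ + r) (b₀ + r') τ z₁ z₂ p
        = e (-(m / M * (b₀ + r') * (j₁ + p.2 : ℤ))) * (e (-(m / M * (a₀ + (r + M * p.1 : ℤ)) * k)) *
          latticeTerm κ τ z₁ z₂ (a₀ + (r + M * p.1 : ℤ)) (ε' + p.2)) := by
      intro r'
      rw [psiTerm, ← mul_assoc, ← mul_assoc, ← e_add, ← e_add]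
      have hlat : latticeTerm κ τ z₁ z₂ (((a₀ + r : ℚ) : ℂ) + M * p.1) (ε' + p.2)
          = latticeTerm κ τ z₁ z₂ (a₀ + (r + M * p.1 : ℤ)) (ε' + p.2) := by
        congr 1; push_cast; ring
      rw [hlat, ← e_add_int (_ + _) (-(m * p.1 * k₁))]
      congr 2
      push_cast
      rw [hj₁', hk₁']
      field_simp
      ring
    simp only [h2]
    rw [← Finset.sum_mul, sum_e_residues hM hcop]
    simp only [U]
    split_ifs
    · ring
    · ring
  rw [Finset.sum_congr rfl fun r _ => hinner r, ← Finset.mul_sum, ← Finset.mul_sum,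
    ← tsum_residues_prod hM hUsum, halfPsi_eq hM hτS]
  -- The inverted indices ε + p.2 and -(j + M p.1), written as a₀ + q and ε' + n. The support of U
  -- lies in the image of this map.
  have hinj : Function.Injective fun p : ℤ × ℤ => ((p.2 - a₁ : ℤ), (-j₁ - M * p.1 : ℤ)) := by
    rintro ⟨a, b⟩ ⟨c, d⟩ h
    simp only [Prod.mk.injEq, sub_left_inj, sub_right_inj] at h
    rw [Prod.mk.injEq]
    exact ⟨mul_left_cancel₀ hMZ h.2, h.1⟩
  have hsupp : Function.support (fun p : ℤ × ℤ => U p.1 p.2) ⊆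
      Set.range fun p : ℤ × ℤ => ((p.2 - a₁ : ℤ), (-j₁ - M * p.1 : ℤ)) := by
    rintro ⟨q, n⟩ hqn
    have hd : (M : ℤ) ∣ j₁ + n := by
      by_contra hd
      exact hqn (by simp [U, hd])
    obtain ⟨l, hl⟩ := hd
    exact ⟨(-l, q + a₁), by simp only [Prod.mk.injEq]; constructor <;> linarith⟩
  rw [← hinj.tsum_eq hsupp]
  have hterm : ∀ p : ℤ × ℤ, psiTerm M m ε j k (-1 / τ) (z₁ / τ) (z₂ / τ) p
      = τ * e (m / M * z₁ * z₂ / τ) * U (p.2 - a₁) (-j₁ - M * p.1) := by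
    intro p
    rw [psiTerm, latticeTerm_S _ hτ, ← hκdef, hκ]
    have hd : (M : ℤ) ∣ j₁ + (-j₁ - M * p.1) := ⟨-p.1, by ring⟩
    simp only [U, if_pos hd]
    have hlat : latticeTerm κ τ z₁ z₂ (ε + p.2) (-(j + M * p.1))
        = latticeTerm κ τ z₁ z₂ (a₀ + (p.2 - a₁ : ℤ)) (ε' + (-j₁ - M * p.1 : ℤ)) := by
      rw [ha₁', hj₁']
      congr 1 <;> (push_cast; ring)
    rw [hlat]
    have hexp : e ((m : ℂ) / M * (M * p.1 * ε - k * (ε + p.2)))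
        = e (-(m / M * (a₀ + (p.2 - a₁ : ℤ)) * k)) *
          e (-(m / M * b₀ * (j₁ + (-j₁ - M * p.1) : ℤ))) := by
      rw [← e_add, ← e_add_int _ (m * b₁ * p.1)]
      congr 1
      rw [ha₁', hb₁']
      push_cast
      field_simp
      ring
    rw [hexp]
    ring
  simp only [hterm, tsum_mul_left]
  field_simp

/-- The function `Ψ̃` at `t = 0`. -/
noncomputable def psiZero (M m : ℕ) (ε j k : ℚ) (τ z₁ z₂ : ℂ) : ℂ :=
  halfPsi M m ε j k τ z₁ z₂ + halfPsi M m ε k j τ z₂ z₁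

theorem psiZero_swap (M m : ℕ) (ε j k : ℚ) (τ z₁ z₂ : ℂ) :
    psiZero M m ε k j τ z₁ z₂ = psiZero M m ε j k τ z₂ z₁ := by
  rw [psiZero, psiZero, add_comm]

theorem PsiTilde_eq {M m : ℕ} (hm : 0 < m) (hM : 0 < M) {ε j k : ℚ} (hε : IsHalfInt ε)
    (hj : IsHalfInt j) (hk : IsHalfInt k) {τ : ℂ} (hτ : 0 < τ.im) {z₁ z₂ : ℂ}
    (h₁ : Generic τ z₁) (h₂ : Generic τ z₂) (t : ℂ) :
    PsiTilde M (m - 1) ε j k τ z₁ z₂ t = e (m * t / M) * psiZero M m ε j k τ z₁ z₂ := by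
  have hMτ : 0 < (M * τ : ℂ).im := by
    rw [im_natCast_mul]
    have : (0 : ℝ) < M := by exact_mod_cast hM
    positivity
  have hm1 : (((m - 1 : ℕ) : ℂ) + 1) = m := by
    rw [Nat.cast_sub hm]; simp
  rw [PsiTilde, PhiTilde_eq (m - 1) hMτ (h₁.offLattice hj hε M) (h₂.offLattice hk hε M),
    Nat.sub_add_cancel hm, hm1, psiZero, halfPsi, halfPsi]
  rw [show (m / M * (j * z₂ + k * z₁) : ℂ) = m / M * (k * z₁ + j * z₂) by ring,
    show (τ * (m * k * j / M) : ℂ) = τ * (m * j * k / M) by ring, mul_div_assoc]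
  ring_nf

/-- Reversing the range presents the negatives of b₀, …, b₀ + M - 1 as consecutive numbers starting
at -b₀ - (M - 1), the form in which `halfPsi_S` accepts a residue system. -/
theorem sum_range_neg (M : ℕ) (f : ℚ → ℂ) (b₀ : ℚ) :
    ∑ r ∈ Finset.range M, f (-(b₀ + r)) = ∑ r ∈ Finset.range M, f ((-b₀ - (M - 1)) + r) := by
  rw [← Finset.sum_range_reflect]
  refine Finset.sum_congr rfl fun r hr => ?_
  have : r + 1 ≤ M := Finset.mem_range.1 hr
  congr 1
  rw [Nat.sub_sub, Nat.cast_sub (by omega)]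
  push_cast
  ring

/-- Behaviour of `Ψ̃` under `τ ↦ -1/τ`. -/
theorem psiZero_S {M m : ℕ} (hm : 0 < m) (hM : 0 < M) (hcop : Nat.Coprime m M)
    {ε ε' j k a₀ b₀ : ℚ} (hε : IsHalfInt ε) (hε' : IsHalfInt ε') (hj : ∃ n : ℤ, j = ε' + n)
    (hk : ∃ n : ℤ, k = ε' + n) (ha : ∃ n : ℤ, a₀ = ε + n) (hb : ∃ n : ℤ, b₀ = ε + n)
    {τ : ℂ} (hτ : 0 < τ.im) {z₁ z₂ : ℂ} (h₁ : Generic τ z₁) (h₂ : Generic τ z₂) :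
    psiZero M m ε j (-k) (-1 / τ) (z₁ / τ) (z₂ / τ)
      = τ / M * e (m / M * z₁ * z₂ / τ) * ∑ r ∈ Finset.range M, ∑ r' ∈ Finset.range M,
          e (m / M * ((b₀ + r' : ℚ) * j + (a₀ + r : ℚ) * k))
            * psiZero M m ε' (a₀ + r) (-(b₀ + r')) τ z₁ z₂ := by
  obtain ⟨c, hc⟩ := hε'
  obtain ⟨d, hd⟩ := hε
  obtain ⟨j₁, rfl⟩ := hj
  obtain ⟨k₁, rfl⟩ := hk
  obtain ⟨b₁, rfl⟩ := hb
  have hj' : ∃ n : ℤ, (ε' + j₁) + ε' = n := ⟨c + j₁, by push_cast; linarith⟩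
  have hk' : ∃ n : ℤ, -(ε' + k₁) + ε' = n := ⟨-k₁, by push_cast; linarith⟩
  have hb' : ∃ n : ℤ, -(ε + b₁) - (M - 1) = ε + n :=
    ⟨-d - b₁ - (M - 1), by push_cast; linarith⟩
  have s1 := halfPsi_S hm hM hcop ⟨d, hd⟩ ⟨c, hc⟩ hj' hk' ha hb' hτ h₁ z₂
  have s2 := halfPsi_S hm hM hcop ⟨d, hd⟩ ⟨c, hc⟩ hk' hj' hb' ha hτ h₂ z₁
  rw [Finset.sum_comm] at s2
  have t1 : ∀ r : ℕ, _ := fun r => sum_range_neg M (fun b => e (-(m / M * (b * (ε' + j₁ : ℚ)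
    + (a₀ + r : ℚ) * (-(ε' + k₁) : ℚ)))) * halfPsi M m ε' (a₀ + r) b τ z₁ z₂) (ε + b₁)
  have t2 : ∀ r : ℕ, _ := fun r => sum_range_neg M (fun b => e (-(m / M * ((a₀ + r : ℚ) *
    (-(ε' + k₁) : ℚ) + b * (ε' + j₁ : ℚ)))) * halfPsi M m ε' b (a₀ + r) τ z₂ z₁) (ε + b₁)
  rw [psiZero, s1, s2, show (m / M * z₂ * z₁ / τ : ℂ) = m / M * z₁ * z₂ / τ by ring, ← mul_add,
    ← Finset.sum_add_distrib]
  congr 1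
  refine Finset.sum_congr rfl fun r _ => ?_
  rw [← t1, ← t2, ← Finset.sum_add_distrib]
  refine Finset.sum_congr rfl fun r' _ => ?_
  rw [psiZero]
  have q1 : -((m : ℂ) / M * (((-(ε + b₁ + r') : ℚ) : ℂ) * (ε' + j₁ : ℚ)
      + (a₀ + r : ℚ) * (-(ε' + k₁) : ℚ)))
      = m / M * ((ε + b₁ + r' : ℚ) * (ε' + j₁ : ℚ) + (a₀ + r : ℚ) * (ε' + k₁ : ℚ)) := by
    push_cast; ring
  have q2 : -((m : ℂ) / M * ((a₀ + r : ℚ) * (-(ε' + k₁) : ℚ)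
      + ((-(ε + b₁ + r') : ℚ) : ℂ) * (ε' + j₁ : ℚ)))
      = m / M * ((ε + b₁ + r' : ℚ) * (ε' + j₁ : ℚ) + (a₀ + r : ℚ) * (ε' + k₁ : ℚ)) := by
    push_cast; ring
  rw [q1, q2]
  exact (mul_add _ _ _).symm

/-- Behaviour of `Ψ̃` under `τ ↦ τ + 1`. -/
theorem halfPsi_T {M m : ℕ} (hM : 0 < M) {ε ε₁ j k : ℚ} (hj : ∃ n : ℤ, ε + j - ε₁ = n)
    (hk : ∃ n : ℤ, ε + k - ε₁ = n) {τ : ℂ} (hτ : 0 < τ.im) (z₁ z₂ : ℂ) :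
    halfPsi M m ε j k (τ + 1) z₁ z₂ = e (m * j * k / M) * halfPsi M m ε₁ j k τ z₁ z₂ := by
  obtain ⟨d, hd⟩ := hj
  obtain ⟨d', hd'⟩ := hk
  have hM' : (M : ℂ) ≠ 0 := by exact_mod_cast hM.ne'
  have hdC : (j : ℂ) = d + ε₁ - ε := by
    have : j = d + ε₁ - ε := by linarith
    rw [this]; push_cast; ring
  have hdC' : (k : ℂ) = d' + ε₁ - ε := by
    have : k = d' + ε₁ - ε := by linarith
    rw [this]; push_cast; ring
  rw [halfPsi_eq hM (by simpa using hτ), halfPsi_eq hM hτ, mul_left_comm]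
  congr 1
  rw [← tsum_mul_left]
  -- The map N ↦ N + J in coordinates: ε + n + j + Ml = ε₁ + (n + Ml + d), where d = ε + j - ε₁.
  let E : ℤ × ℤ ≃ ℤ × ℤ :=
    { toFun := fun p => (p.1, p.2 + M * p.1 + d)
      invFun := fun p => (p.1, p.2 - M * p.1 - d)
      left_inv := fun p => Prod.ext rfl (by
        show p.2 + M * p.1 + d - M * p.1 - d = p.2
        ring)
      right_inv := fun p => Prod.ext rfl (by
        show p.2 - M * p.1 - d + M * p.1 + d = p.2
        ring) }
  rw [← E.tsum_eq fun p => e (m * j * k / M) * psiTerm M m ε₁ j k τ z₁ z₂ p]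
  refine tsum_congr fun p => ?_
  show _ = e (m * j * k / M) * psiTerm M m ε₁ j k τ z₁ z₂ (p.1, p.2 + M * p.1 + d)
  rw [psiTerm, psiTerm, latticeTerm_T, ← mul_assoc, ← e_add, ← e_add_int _ (-(m * p.1 * d'))]
  congr 1
  · congr 1
    push_cast
    rw [hdC, hdC']
    field_simp
    ring
  · congr 1
    push_cast
    rw [hdC]
    ring

theorem psiZero_T {M m : ℕ} (hM : 0 < M) {ε ε₁ j k : ℚ} (hj : ∃ n : ℤ, ε + j - ε₁ = n)
    (hk : ∃ n : ℤ, ε + k - ε₁ = n) {τ : ℂ} (hτ : 0 < τ.im) (z₁ z₂ : ℂ) :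
    psiZero M m ε j k (τ + 1) z₁ z₂ = e (m * j * k / M) * psiZero M m ε₁ j k τ z₁ z₂ := by
  rw [psiZero, psiZero, halfPsi_T hM hj hk hτ, halfPsi_T hM hk hj hτ, mul_add]
  congr 3
  ring

/-- Replacing j by j + M keeps the coset j + Mℤ, so it is a reindexing; only the phase notices the
step. -/
theorem halfPsi_add_left {M m : ℕ} (hM : 0 < M) (ε j k : ℚ) {τ : ℂ} (hτ : 0 < τ.im) (z₁ z₂ : ℂ) :
    halfPsi M m ε (j + M) k τ z₁ z₂ = e (-(m * ε)) * halfPsi M m ε j k τ z₁ z₂ := by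
  have hM' : (M : ℂ) ≠ 0 := by exact_mod_cast hM.ne'
  rw [halfPsi_eq hM hτ, halfPsi_eq hM hτ, mul_left_comm]
  congr 1
  rw [← tsum_mul_left]
  rw [← ((Equiv.addRight (1 : ℤ)).prodCongr (Equiv.refl ℤ)).tsum_eq (fun p =>
    e (-(m * ε)) * psiTerm M m ε j k τ z₁ z₂ p)]
  refine tsum_congr fun p => ?_
  show _ = e (-(m * ε)) * psiTerm M m ε j k τ z₁ z₂ (p.1 + 1, p.2)
  rw [psiTerm, psiTerm, ← mul_assoc, ← e_add]
  congr 1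
  · congr 1
    push_cast
    field_simp
    ring
  · congr 1
    push_cast
    ring

/-- The index k enters only through the phase, which changes by e(-m(ε + n)) = e(-mε). -/
theorem halfPsi_add_right {M m : ℕ} (hM : 0 < M) (ε j k : ℚ) {τ : ℂ} (hτ : 0 < τ.im)
    (z₁ z₂ : ℂ) :
    halfPsi M m ε j (k + M) τ z₁ z₂ = e (-(m * ε)) * halfPsi M m ε j k τ z₁ z₂ := by
  have hM' : (M : ℂ) ≠ 0 := by exact_mod_cast hM.ne'
  rw [halfPsi_eq hM hτ, halfPsi_eq hM hτ, mul_left_comm]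
  congr 1
  rw [← tsum_mul_left]
  refine tsum_congr fun p => ?_
  rw [psiTerm, psiTerm, ← mul_assoc, ← e_add, ← e_add_int (_ + _) (-(m * p.2))]
  congr 2
  push_cast
  field_simp
  ring

theorem psiZero_add_left {M m : ℕ} (hM : 0 < M) (ε j k : ℚ) {τ : ℂ} (hτ : 0 < τ.im) (z₁ z₂ : ℂ) :
    psiZero M m ε (j + M) k τ z₁ z₂ = e (-(m * ε)) * psiZero M m ε j k τ z₁ z₂ := by
  rw [psiZero, psiZero, halfPsi_add_left hM _ _ _ hτ, halfPsi_add_right hM _ _ _ hτ, mul_add]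

/-! ### Wirtinger derivatives -/

theorem dWirtinger_congr {f g : ℂ → ℂ} {z : ℂ} (h : f =ᶠ[𝓝 z] g) :
    dWirtinger f z = dWirtinger g z := by
  rw [dWirtinger, dWirtinger, h.fderiv_eq]

theorem dWirtinger_mul {f g : ℂ → ℂ} {z : ℂ} (hf : DifferentiableAt ℝ f z)
    (hg : DifferentiableAt ℝ g z) :
    dWirtinger (fun w => f w * g w) z = dWirtinger f z * g z + f z * dWirtinger g z := by
  have h := fderiv_fun_mul hf hg
  rw [dWirtinger, dWirtinger, dWirtinger, h]
  simp only [add_apply, smul_apply, smul_eq_mul]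
  ring

theorem dWirtinger_const_mul (c : ℂ) {f : ℂ → ℂ} {z : ℂ} (hf : DifferentiableAt ℝ f z) :
    dWirtinger (fun w => c * f w) z = c * dWirtinger f z := by
  rw [dWirtinger_mul (differentiableAt_const c) hf]
  simp [dWirtinger]

theorem dWirtinger_sum {ι : Type*} (s : Finset ι) {f : ι → ℂ → ℂ} {z : ℂ}
    (hf : ∀ i ∈ s, DifferentiableAt ℝ (f i) z) :
    dWirtinger (fun w => ∑ i ∈ s, f i w) z = ∑ i ∈ s, dWirtinger (f i) z := by
  simp only [dWirtinger]
  rw [fderiv_fun_sum hf, sum_apply, sum_apply,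
    Finset.mul_sum, ← Finset.sum_sub_distrib, Finset.sum_div]

/-- The inner map is complex linear, so no antiholomorphic derivative is mixed in. -/
theorem dWirtinger_comp_div {f : ℂ → ℂ} {z : ℂ} (τ : ℂ) (hf : DifferentiableAt ℝ f (z / τ)) :
    dWirtinger (fun w => f (w / τ)) z = dWirtinger f (z / τ) / τ := by
  have hg : HasFDerivAt (fun w : ℂ => w / τ) ((τ⁻¹ : ℂ) • ContinuousLinearMap.id ℝ ℂ) z := by
    simpa [div_eq_inv_mul] using (hasFDerivAt_id (𝕜 := ℝ) z).const_mul τ⁻¹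
  have h : fderiv ℝ (fun w => f (w / τ)) z
      = (fderiv ℝ f (z / τ)).comp ((τ⁻¹ : ℂ) • ContinuousLinearMap.id ℝ ℂ) :=
    (hf.hasFDerivAt.comp z hg).fderiv
  rw [dWirtinger, dWirtinger, h]
  generalize fderiv ℝ f (z / τ) = L
  have hL : ∀ v : ℂ, L v = v.re * L 1 + v.im * L I := by
    intro v
    conv_lhs => rw [show v = v.re • (1 : ℂ) + v.im • I by simp [Complex.re_add_im]]
    rw [map_add, map_smul, map_smul]
    simp
  simp only [ContinuousLinearMap.comp_apply, smul_apply, ContinuousLinearMap.id_apply, smul_eq_mul,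
    mul_one]
  rw [hL τ⁻¹, hL (τ⁻¹ * I), div_eq_mul_inv _ τ]
  have h1 : (τ⁻¹ * I).re = -(τ⁻¹).im := by simp
  have h2 : (τ⁻¹ * I).im = (τ⁻¹).re := by simp
  rw [h1, h2]
  generalize L 1 = B
  generalize L I = A
  conv_rhs => rw [← Complex.re_add_im τ⁻¹]
  push_cast
  linear_combination ((τ⁻¹.im : ℂ) * A / 2) * Complex.I_sq

/-- The difference of the two partial Wirtinger derivatives on the diagonal. -/
noncomputable def antiDeriv (W : ℂ → ℂ → ℂ) (z : ℂ) : ℂ :=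
  dWirtinger (fun w => W w z) z - dWirtinger (fun w => W z w) z

/-- Differentiability of both slices through `(z, z)`. -/
def DiffSlices (W : ℂ → ℂ → ℂ) (z : ℂ) : Prop :=
  DifferentiableAt ℝ (fun w => W w z) z ∧ DifferentiableAt ℝ (fun w => W z w) z

theorem DiffSlices.const_mul {W : ℂ → ℂ → ℂ} {z : ℂ} (h : DiffSlices W z) (c : ℂ) :
    DiffSlices (fun a b => c * W a b) z :=
  ⟨h.1.const_mul c, h.2.const_mul c⟩

theorem DiffSlices.sum {ι : Type*} (s : Finset ι) {W : ι → ℂ → ℂ → ℂ} {z : ℂ}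
    (h : ∀ i ∈ s, DiffSlices (W i) z) : DiffSlices (fun a b => ∑ i ∈ s, W i a b) z :=
  ⟨DifferentiableAt.fun_sum fun i hi => (h i hi).1, DifferentiableAt.fun_sum fun i hi => (h i hi).2⟩

theorem antiDeriv_const_mul (c : ℂ) {W : ℂ → ℂ → ℂ} {z : ℂ} (h : DiffSlices W z) :
    antiDeriv (fun a b => c * W a b) z = c * antiDeriv W z := by
  rw [antiDeriv, antiDeriv, dWirtinger_const_mul c h.1, dWirtinger_const_mul c h.2, mul_sub]

theorem antiDeriv_sum {ι : Type*} (s : Finset ι) {W : ι → ℂ → ℂ → ℂ} {z : ℂ}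
    (h : ∀ i ∈ s, DiffSlices (W i) z) :
    antiDeriv (fun a b => ∑ i ∈ s, W i a b) z = ∑ i ∈ s, antiDeriv (W i) z := by
  rw [antiDeriv, dWirtinger_sum s fun i hi => (h i hi).1, dWirtinger_sum s fun i hi => (h i hi).2,
    ← Finset.sum_sub_distrib]
  rfl

/-- A symmetric factor has equal partial derivatives on the diagonal, so its contributions to the
product rule cancel. The quadratic exponential created by inversion is of this kind. -/
theorem antiDeriv_symm_mul {H W : ℂ → ℂ → ℂ} {z : ℂ} (hH : DifferentiableAt ℝ (fun w => H w z) z)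
    (hs : ∀ a b, H a b = H b a) (h : DiffSlices W z) :
    antiDeriv (fun a b => H a b * W a b) z = H z z * antiDeriv W z := by
  have hs' : (fun w => H z w) = fun w => H w z := funext fun w => hs z w
  rw [antiDeriv, antiDeriv, dWirtinger_mul hH h.1,
    dWirtinger_mul (f := fun w => H z w) (by rw [hs']; exact hH) h.2, hs']
  ring

theorem antiDeriv_comp_div {W : ℂ → ℂ → ℂ} {z : ℂ} (τ : ℂ) (h : DiffSlices W (z / τ)) :
    antiDeriv (fun a b => W (a / τ) (b / τ)) z = antiDeriv W (z / τ) / τ := by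
  rw [antiDeriv, antiDeriv, dWirtinger_comp_div (f := fun w => W w (z / τ)) τ h.1,
    dWirtinger_comp_div (f := fun w => W (z / τ) w) τ h.2, sub_div]

theorem antiDeriv_swap (W : ℂ → ℂ → ℂ) (z : ℂ) :
    antiDeriv (fun a b => W b a) z = -antiDeriv W z := by
  rw [antiDeriv, antiDeriv, neg_sub]

theorem antiDeriv_congr {V W : ℂ → ℂ → ℂ} {z : ℂ} {P : ℂ → Prop} (hP : ∀ᶠ w in 𝓝 z, P w)
    (h : ∀ a b, P a → P b → V a b = W a b) : antiDeriv V z = antiDeriv W z := by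
  have hz := hP.self_of_nhds
  rw [antiDeriv, antiDeriv, dWirtinger_congr (hP.mono fun w hw => h w z hw hz),
    dWirtinger_congr (hP.mono fun w hw => h z w hz hw)]

/-! ### The functions `G` -/

theorem Generic.eventually {τ : ℂ} (hτ : 0 < τ.im) {z : ℂ} (h : Generic τ z) :
    ∀ᶠ w in 𝓝 z, Generic τ w := by
  obtain ⟨δ, hδ, -, hd⟩ := exists_lattice_dist_pos hτ (z := 2 * z) fun l n h0 =>
    h (-n) (-l) (by push_cast; linear_combination h0)
  filter_upwards [Metric.ball_mem_nhds z (half_pos hδ)] with w hw a b hab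
  have h1 := hd (-b) (-a)
  have h2 : 2 * z + ((-b : ℤ) : ℂ) * τ + ((-a : ℤ) : ℂ) = 2 * (z - w) := by
    push_cast; linear_combination hab
  rw [h2, norm_mul, ← dist_eq_norm, dist_comm] at h1
  have h3 : dist w z < δ / 2 := hw
  have h4 : ‖(2 : ℂ)‖ = 2 := by simp
  rw [h4] at h1
  linarith

theorem differentiable_e : Differentiable ℂ e := by
  unfold e; fun_prop

theorem differentiableAt_e_affine (a b z : ℂ) : DifferentiableAt ℝ (fun w => e (a * w + b)) z :=
  ((differentiable_e.comp ((differentiable_id.const_mul a).add_const b)) z).restrictScalars ℝ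

theorem differentiableAt_halfPsi_left {M m : ℕ} (hm : 0 < m) (hM : 0 < M) {ε j : ℚ} (k : ℚ)
    (hε : IsHalfInt ε) (hj : IsHalfInt j) {τ : ℂ} (hτ : 0 < τ.im) {z₁ : ℂ} (h : Generic τ z₁)
    (z₂ : ℂ) : DifferentiableAt ℝ (fun w => halfPsi M m ε j k τ w z₂) z₁ := by
  have hMτ : 0 < (M * τ : ℂ).im := by
    rw [im_natCast_mul]
    have : (0 : ℝ) < M := by exact_mod_cast hM
    positivity
  have hm' : (0 : ℝ) < m := by exact_mod_cast hm
  have h1 := differentiableAt_latticeSum_left hm' hMτ (h.offLattice hj hε M) (z₂ + k * τ + ε)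
  have h2 : DifferentiableAt ℝ
      (fun w => latticeSum m (M * τ) (w + j * τ + ε) (z₂ + k * τ + ε)) z₁ :=
    h1.comp z₁ (f := fun w => w + j * τ + ε) (by fun_prop)
  have h3 := differentiableAt_e_affine (m / M * k) (m / M * (j * z₂)) z₁
  have h4 : (fun w => e (m / M * k * w + m / M * (j * z₂)))
      = fun w => e (m / M * (k * w + j * z₂)) := by
    funext w; congr 1; ring
  rw [h4] at h3
  exact (h3.const_mul _).mul h2

theorem differentiableAt_halfPsi_right {M m : ℕ} (hm : 0 < m) (hM : 0 < M) {ε j : ℚ} (k : ℚ)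
    (hε : IsHalfInt ε) (hj : IsHalfInt j) {τ : ℂ} (hτ : 0 < τ.im) {z₁ : ℂ} (h : Generic τ z₁)
    (z₂ : ℂ) : DifferentiableAt ℝ (fun w => halfPsi M m ε j k τ z₁ w) z₂ := by
  have hMτ : 0 < (M * τ : ℂ).im := by
    rw [im_natCast_mul]
    have : (0 : ℝ) < M := by exact_mod_cast hM
    positivity
  have hm' : (0 : ℝ) < m := by exact_mod_cast hm
  have h1 := differentiableAt_latticeSum_right hm' hMτ (h.offLattice hj hε M) (z₂ + k * τ + ε)
  have h2 : DifferentiableAt ℝ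
      (fun w => latticeSum m (M * τ) (z₁ + j * τ + ε) (w + k * τ + ε)) z₂ :=
    h1.comp z₂ (f := fun w => w + k * τ + ε) (by fun_prop)
  have h3 := differentiableAt_e_affine (m / M * j) (m / M * (k * z₁)) z₂
  have h4 : (fun w => e (m / M * j * w + m / M * (k * z₁)))
      = fun w => e (m / M * (k * z₁ + j * w)) := by
    funext w; congr 1; ring
  rw [h4] at h3
  exact (h3.const_mul _).mul h2

theorem diffSlices_psiZero {M m : ℕ} (hm : 0 < m) (hM : 0 < M) {ε j k : ℚ} (hε : IsHalfInt ε)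
    (hj : IsHalfInt j) (hk : IsHalfInt k) {τ : ℂ} (hτ : 0 < τ.im) {z : ℂ} (h : Generic τ z) :
    DiffSlices (psiZero M m ε j k τ) z :=
  ⟨(differentiableAt_halfPsi_left hm hM k hε hj hτ h z).add
      (differentiableAt_halfPsi_right hm hM j hε hk hτ h z),
    (differentiableAt_halfPsi_right hm hM k hε hj hτ h z).add
      (differentiableAt_halfPsi_left hm hM j hε hk hτ h z)⟩

/-- On z₁ = z₂ the coefficient of ∂/∂t vanishes, leaving the antisymmetrized derivative at t = 0
times an exponential in t. -/
theorem G_eq {M m : ℕ} (hm : 0 < m) (hM : 0 < M) {ε j k : ℚ} (hε : IsHalfInt ε)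
    (hj : IsHalfInt j) (hk : IsHalfInt k) {τ : ℂ} (hτ : 0 < τ.im) {z : ℂ} (h : Generic τ z)
    (t : ℂ) :
    G M m ε j k τ z t
      = 1 / (2 * Real.pi * I) * (e (-(m * t / M)) * antiDeriv (psiZero M m ε j k τ) z) := by
  rw [G, D1, sub_self, zero_div, zero_mul, sub_zero]
  congr 1
  rw [← antiDeriv_const_mul _ (diffSlices_psiZero hm hM hε hj hk hτ h)]
  refine antiDeriv_congr (V := fun a b => PsiTilde M (m - 1) ε j k τ a b (-t))
    (h.eventually hτ) fun a b ha hb => ?_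
  rw [PsiTilde_eq hm hM hε hj hk hτ ha hb]
  congr 2
  ring

theorem IsHalfInt.neg {x : ℚ} (h : IsHalfInt x) : IsHalfInt (-x) := by
  obtain ⟨a, ha⟩ := h
  exact ⟨-a, by push_cast; linarith⟩

theorem IsHalfInt.add_int {x : ℚ} (h : IsHalfInt x) (n : ℤ) : IsHalfInt (x + n) := by
  obtain ⟨a, ha⟩ := h
  exact ⟨a + 2 * n, by push_cast; linarith⟩

theorem Generic.neg_one_div {τ z : ℂ} (hτ : 0 < τ.im) (h : Generic τ z) :
    Generic (-1 / τ) (z / τ) := by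
  have hτ0 : τ ≠ 0 := fun h => by rw [h] at hτ; simp at hτ
  intro a b hab
  apply h (-b) a
  field_simp at hab
  push_cast
  linear_combination hab

theorem Generic.add_one {τ z : ℂ} (h : Generic τ z) : Generic (τ + 1) z := by
  intro a b hab
  apply h (a + b) b
  push_cast
  linear_combination hab

theorem im_neg_one_div_pos {τ : ℂ} (hτ : 0 < τ.im) : 0 < (-1 / τ).im := by
  rw [im_neg_one_div]
  have hτ0 : τ ≠ 0 := fun h => by rw [h] at hτ; simp at hτ
  have := Complex.normSq_pos.2 hτ0
  positivity

/-- One τ comes from inverting Ψ̃ and another from the chain rule for z/τ. The shift of t by z²/τ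
cancels the factor e(mz²/(Mτ)). -/
theorem G_S {M m : ℕ} (hm : 0 < m) (hM : 0 < M) (hcop : Nat.Coprime m M)
    {ε ε' j k a₀ b₀ : ℚ} (hε : IsHalfInt ε) (hε' : IsHalfInt ε') (hj : ∃ n : ℤ, j = ε' + n)
    (hk : ∃ n : ℤ, k = ε' + n) (ha : ∃ n : ℤ, a₀ = ε + n) (hb : ∃ n : ℤ, b₀ = ε + n)
    {τ : ℂ} (hτ : 0 < τ.im) {z : ℂ} (h : Generic τ z) (t : ℂ) :
    G M m ε j (-k) (-1 / τ) (z / τ) (t + z ^ 2 / τ)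
      = τ ^ 2 / M * ∑ r ∈ Finset.range M, ∑ r' ∈ Finset.range M,
          e (m / M * ((b₀ + r' : ℚ) * j + (a₀ + r : ℚ) * k))
            * G M m ε' (a₀ + r) (-(b₀ + r')) τ z t := by
  have hτ0 : τ ≠ 0 := fun h => by rw [h] at hτ; simp at hτ
  have hS := @psiZero_S M m hm hM hcop ε ε' j k a₀ b₀ hε hε' hj hk ha hb τ hτ
  have hjI : IsHalfInt j := by obtain ⟨n, rfl⟩ := hj; exact hε'.add_int n
  have hkI : IsHalfInt (-k) := by obtain ⟨n, rfl⟩ := hk; exact (hε'.add_int n).neg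
  have haI : ∀ r : ℕ, IsHalfInt (a₀ + r) := fun r => by
    obtain ⟨n, rfl⟩ := ha; exact_mod_cast (hε.add_int n).add_int r
  have hbI : ∀ r : ℕ, IsHalfInt (-(b₀ + r)) := fun r => by
    obtain ⟨n, rfl⟩ := hb; exact_mod_cast ((hε.add_int n).add_int r).neg
  have hD : ∀ r r' : ℕ, DiffSlices (fun a b => e (m / M * ((b₀ + r' : ℚ) * j + (a₀ + r : ℚ) * k))
      * psiZero M m ε' (a₀ + r) (-(b₀ + r')) τ a b) z := fun r r' =>
    (diffSlices_psiZero hm hM hε' (haI r) (hbI r') hτ h).const_mul _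
  have hτS := im_neg_one_div_pos hτ
  have hgS := h.neg_one_div hτ
  have key : antiDeriv (psiZero M m ε j (-k) (-1 / τ)) (z / τ) / τ
      = τ / M * e (m / M * z * z / τ) * ∑ r ∈ Finset.range M, ∑ r' ∈ Finset.range M,
          e (m / M * ((b₀ + r' : ℚ) * j + (a₀ + r : ℚ) * k))
            * antiDeriv (psiZero M m ε' (a₀ + r) (-(b₀ + r')) τ) z := by
    rw [← antiDeriv_comp_div τ (diffSlices_psiZero hm hM hε hjI hkI hτS hgS),
      antiDeriv_congr (h.eventually hτ) fun a b ha hb => hS ha hb,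
      antiDeriv_symm_mul (H := fun a b => τ / M * e (m / M * a * b / τ))]
    · congr 1
      rw [antiDeriv_sum _ fun r _ => DiffSlices.sum _ fun r' _ => hD r r']
      refine Finset.sum_congr rfl fun r _ => ?_
      rw [antiDeriv_sum _ fun r' _ => hD r r']
      refine Finset.sum_congr rfl fun r' _ => ?_
      rw [antiDeriv_const_mul _ (diffSlices_psiZero hm hM hε' (haI r) (hbI r') hτ h)]
    · have := (differentiableAt_e_affine (m / M * z / τ) 0 z).const_mul (τ / M)
      refine this.congr_of_eventuallyEq (Eventually.of_forall fun w => ?_)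
      show τ / M * e (m / M * w * z / τ) = τ / M * e (m / M * z / τ * w + 0)
      congr 2
      ring
    · intro a b
      rw [mul_right_comm]
    · exact DiffSlices.sum _ fun r _ => DiffSlices.sum _ fun r' _ => hD r r'
  rw [div_eq_iff hτ0] at key
  rw [G_eq hm hM hε hjI hkI hτS hgS, key]
  have he : e (-(m * (t + z ^ 2 / τ) / M)) * e (m / M * z * z / τ) = e (-(m * t / M)) := by
    rw [← e_add]; congr 1; ring
  have hG : ∀ r r' : ℕ, G M m ε' (a₀ + r) (-(b₀ + r')) τ z t = 1 / (2 * Real.pi * I) *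
      (e (-(m * t / M)) * antiDeriv (psiZero M m ε' (a₀ + r) (-(b₀ + r')) τ) z) :=
    fun r r' => G_eq hm hM hε' (haI r) (hbI r') hτ h t
  simp only [hG]
  have hsum : ∑ r ∈ Finset.range M, ∑ r' ∈ Finset.range M,
      e (m / M * ((b₀ + r' : ℚ) * j + (a₀ + r : ℚ) * k)) * (1 / (2 * Real.pi * I) *
        (e (-(m * t / M)) * antiDeriv (psiZero M m ε' (a₀ + r) (-(b₀ + r')) τ) z))
      = 1 / (2 * Real.pi * I) * e (-(m * t / M)) * ∑ r ∈ Finset.range M, ∑ r' ∈ Finset.range M,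
          e (m / M * ((b₀ + r' : ℚ) * j + (a₀ + r : ℚ) * k))
            * antiDeriv (psiZero M m ε' (a₀ + r) (-(b₀ + r')) τ) z := by
    simp only [Finset.mul_sum]
    refine Finset.sum_congr rfl fun r _ => Finset.sum_congr rfl fun r' _ => ?_
    ring
  rw [hsum, ← he]
  ring

/-- Ψ̃ is unchanged when indices and variables are exchanged together, whereas the antisymmetrized
derivative changes sign. -/
theorem G_swap {M m : ℕ} (hm : 0 < m) (hM : 0 < M) {ε j k : ℚ} (hε : IsHalfInt ε)
    (hj : IsHalfInt j) (hk : IsHalfInt k) {τ : ℂ} (hτ : 0 < τ.im) {z : ℂ} (h : Generic τ z)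
    (t : ℂ) : G M m ε k j τ z t = -G M m ε j k τ z t := by
  rw [G_eq hm hM hε hk hj hτ h, G_eq hm hM hε hj hk hτ h]
  have : psiZero M m ε k j τ = fun a b => psiZero M m ε j k τ b a := by
    funext a b; exact psiZero_swap ..
  rw [this, antiDeriv_swap]
  ring

theorem G_add_left {M m : ℕ} (hm : 0 < m) (hM : 0 < M) {ε j k : ℚ} (hε : IsHalfInt ε)
    (hj : IsHalfInt j) (hk : IsHalfInt k) {τ : ℂ} (hτ : 0 < τ.im) {z : ℂ} (h : Generic τ z)
    (t : ℂ) : G M m ε (j + M) k τ z t = e (-(m * ε)) * G M m ε j k τ z t := by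
  have hj' : IsHalfInt (j + M) := by exact_mod_cast hj.add_int M
  rw [G_eq hm hM hε hj' hk hτ h, G_eq hm hM hε hj hk hτ h]
  have : psiZero M m ε (j + M) k τ = fun a b => e (-(m * ε)) * psiZero M m ε j k τ a b := by
    funext a b; exact psiZero_add_left hM _ _ _ hτ _ _
  rw [this, antiDeriv_const_mul _ (diffSlices_psiZero hm hM hε hj hk hτ h)]
  ring

theorem G_add_right {M m : ℕ} (hm : 0 < m) (hM : 0 < M) {ε j k : ℚ} (hε : IsHalfInt ε)
    (hj : IsHalfInt j) (hk : IsHalfInt k) {τ : ℂ} (hτ : 0 < τ.im) {z : ℂ} (h : Generic τ z)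
    (t : ℂ) : G M m ε j (k + M) τ z t = e (-(m * ε)) * G M m ε j k τ z t := by
  have hk' : IsHalfInt (k + M) := by exact_mod_cast hk.add_int M
  rw [G_swap hm hM hε hk' hj hτ h, G_add_left hm hM hε hk hj hτ h, G_swap hm hM hε hj hk hτ h]
  ring

theorem G_T {M m : ℕ} (hm : 0 < m) (hM : 0 < M) {ε ε₁ j k : ℚ} (hε : IsHalfInt ε)
    (hε₁ : IsHalfInt ε₁) (hj : IsHalfInt j) (hk : IsHalfInt k) (hj₁ : ∃ n : ℤ, ε + j - ε₁ = n)
    (hk₁ : ∃ n : ℤ, ε + k - ε₁ = n) {τ : ℂ} (hτ : 0 < τ.im) {z : ℂ} (h : Generic τ z) (t : ℂ) :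
    G M m ε j k (τ + 1) z t = e (m * j * k / M) * G M m ε₁ j k τ z t := by
  rw [G_eq hm hM hε hj hk (by simpa using hτ) h.add_one, G_eq hm hM hε₁ hj hk hτ h]
  have : psiZero M m ε j k (τ + 1) = fun a b => e (m * j * k / M) * psiZero M m ε₁ j k τ a b := by
    funext a b; exact psiZero_T hM hj₁ hk₁ hτ _ _
  rw [this, antiDeriv_const_mul _ (diffSlices_psiZero hm hM hε₁ hj hk hτ h)]
  ring

/-! ### Folding the sum over a square onto the triangle `Ω` -/

theorem isHalfInt_of_eq {ε : ℚ} (hε : ε = 0 ∨ ε = 1 / 2) : IsHalfInt ε := by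
  rcases hε with rfl | rfl
  · exact ⟨0, by simp⟩
  · exact ⟨1, by norm_num⟩

/-- The points of `(ε + ℤ)²` in the half-open square `(0, M] × [0, M)`. -/
def square (M : ℕ) (ε : ℚ) : Finset (ℚ × ℚ) :=
  (Finset.range M ×ˢ Finset.range M).image fun p => (1 - ε + p.1, ε + p.2)

theorem sum_square (M : ℕ) (ε : ℚ) (A : ℚ × ℚ → ℂ) :
    ∑ p ∈ square M ε, A p
      = ∑ r ∈ Finset.range M, ∑ r' ∈ Finset.range M, A (1 - ε + r, ε + r') := by
  rw [square, Finset.sum_image, Finset.sum_product]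
  rintro ⟨a, b⟩ - ⟨c, d⟩ - h
  simpa using h

theorem mem_square {M : ℕ} {ε : ℚ} (hε : ε = 0 ∨ ε = 1 / 2) (p : ℚ × ℚ) :
    p ∈ square M ε ↔ (∃ a : ℤ, p.1 = ε + a) ∧ (∃ b : ℤ, p.2 = ε + b) ∧
      0 < p.1 ∧ p.1 ≤ M ∧ 0 ≤ p.2 ∧ p.2 < M := by
  obtain ⟨x, y⟩ := p
  simp only [square, Finset.mem_image, Finset.mem_product, Finset.mem_range, Prod.mk.injEq,
    Prod.exists]
  have hε0 : 0 ≤ ε ∧ ε < 1 := by rcases hε with rfl | rfl <;> norm_num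
  constructor
  · rintro ⟨r, r', ⟨hr, hr'⟩, rfl, rfl⟩
    obtain ⟨c, hc⟩ := isHalfInt_of_eq hε
    have h1 : (r : ℚ) + 1 ≤ M := by exact_mod_cast hr
    have h2 : (r' : ℚ) + 1 ≤ M := by exact_mod_cast hr'
    have h3 : (0 : ℚ) ≤ r := Nat.cast_nonneg r
    have h4 : (0 : ℚ) ≤ r' := Nat.cast_nonneg r'
    exact ⟨⟨1 - c + r, by push_cast; linarith⟩, ⟨r', by simp⟩, by linarith, by linarith,
      by linarith, by linarith⟩
  · rintro ⟨⟨a, rfl⟩, ⟨b, rfl⟩, h1, h2, h3, h4⟩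
    have hb0 : 0 ≤ b := by
      by_contra hb
      have : (b : ℚ) ≤ -1 := by exact_mod_cast (by omega : b ≤ -1)
      linarith
    have hbM : b < M := by
      have : (b : ℚ) < M := by linarith
      exact_mod_cast this
    lift b to ℕ using hb0
    rcases hε with rfl | rfl
    · have ha0 : 0 < a := by
        have : (0 : ℚ) < a := by linarith
        exact_mod_cast this
      have haM : a ≤ M := by
        have : (a : ℚ) ≤ M := by linarith
        exact_mod_cast this
      refine ⟨(a - 1).toNat, b, ⟨by omega, by exact_mod_cast hbM⟩, ?_, by simp⟩
      have h5 : (((a - 1).toNat : ℤ) : ℚ) = ((a - 1 : ℤ) : ℚ) := by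
        rw [Int.toNat_of_nonneg (by omega)]
      rw [Int.cast_natCast] at h5
      rw [h5]; push_cast; ring
    · have ha0 : 0 ≤ a := by
        by_contra ha
        have : (a : ℚ) ≤ -1 := by exact_mod_cast (by omega : a ≤ -1)
        linarith
      have haM : a < M := by
        have : (a : ℚ) < M := by linarith
        exact_mod_cast this
      lift a to ℕ using ha0
      exact ⟨a, b, ⟨by exact_mod_cast haM, by exact_mod_cast hbM⟩, by push_cast; ring, by simp⟩

theorem mem_OmegaFinset {M : ℕ} {ε : ℚ} (p : ℚ × ℚ) :
    p ∈ OmegaFinset M ε ↔ (∃ a : ℤ, p.1 = ε + a) ∧ (∃ b : ℤ, p.2 = ε + b) ∧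
      0 < p.1 ∧ p.1 + p.2 < M ∧ 0 ≤ p.2 ∧ p.2 < M :=
  Set.Finite.mem_toFinset _

/-- The reflection (a, b) ↦ (M - b, M - a) exchanges the triangles a + b < M and a + b > M. It
preserves the coset because 2ε is an integer, and the square because its sides are half-open in
opposite directions. -/
theorem sum_square_fold {M : ℕ} {ε : ℚ} (hε : ε = 0 ∨ ε = 1 / 2) (A : ℚ × ℚ → ℂ)
    (hA : ∀ p ∈ square M ε, p.1 + p.2 = (M : ℚ) → A p = 0) :
    ∑ p ∈ square M ε, A p = ∑ p ∈ OmegaFinset M ε, (A p + A (M - p.2, M - p.1)) := by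
  obtain ⟨c, hc⟩ := isHalfInt_of_eq hε
  have h1 : (square M ε).filter (fun p => p.1 + p.2 < (M : ℚ)) = OmegaFinset M ε := by
    ext p
    rw [Finset.mem_filter, mem_square hε, mem_OmegaFinset]
    constructor
    · rintro ⟨⟨ha, hb, h1, h2, h3, h4⟩, h5⟩
      exact ⟨ha, hb, h1, h5, h3, h4⟩
    · rintro ⟨ha, hb, h1, h5, h3, h4⟩
      exact ⟨⟨ha, hb, h1, by linarith, h3, h4⟩, h5⟩
  have h2 : ∑ p ∈ (square M ε).filter (fun p => ¬ p.1 + p.2 < (M : ℚ)), A p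
      = ∑ p ∈ (square M ε).filter (fun p => (M : ℚ) < p.1 + p.2), A p := by
    symm
    refine Finset.sum_subset (fun p hp => ?_) fun p hp hp' => ?_
    · rw [Finset.mem_filter] at hp ⊢
      exact ⟨hp.1, not_lt.2 hp.2.le⟩
    · rw [Finset.mem_filter] at hp hp'
      refine hA p hp.1 (le_antisymm ?_ (not_lt.1 hp.2))
      by_contra h
      exact hp' ⟨hp.1, not_le.1 h⟩
  have h3 : ∑ p ∈ (square M ε).filter (fun p => (M : ℚ) < p.1 + p.2), A p
      = ∑ p ∈ OmegaFinset M ε, A (M - p.2, M - p.1) := by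
    refine Finset.sum_nbij' (fun p => ((M : ℚ) - p.2, (M : ℚ) - p.1))
      (fun p => ((M : ℚ) - p.2, (M : ℚ) - p.1)) ?_ ?_ ?_ ?_ ?_
    · intro p hp
      rw [Finset.mem_filter, mem_square hε] at hp
      obtain ⟨⟨⟨a, ha⟩, ⟨b, hb⟩, h1, h2, h3, h4⟩, h5⟩ := hp
      rw [mem_OmegaFinset]
      exact ⟨⟨M - c - b, by push_cast; linarith⟩, ⟨M - c - a, by push_cast; linarith⟩,
        by simp only; linarith, by simp only; linarith, by simp only; linarith,
        by simp only; linarith⟩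
    · intro p hp
      rw [mem_OmegaFinset] at hp
      obtain ⟨⟨a, ha⟩, ⟨b, hb⟩, h1, h2, h3, h4⟩ := hp
      rw [Finset.mem_filter, mem_square hε]
      exact ⟨⟨⟨M - c - b, by push_cast; linarith⟩, ⟨M - c - a, by push_cast; linarith⟩,
        by simp only; linarith, by simp only; linarith, by simp only; linarith,
        by simp only; linarith⟩, by simp only; linarith⟩
    · intro p _; simp
    · intro p _; simp
    · intro p _; simp
  rw [← Finset.sum_filter_add_sum_filter_not _ (fun p => p.1 + p.2 < (M : ℚ)), h1, h2, h3,
    Finset.sum_add_distrib]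

theorem e_sub_e_eq_sin (S D : ℂ) :
    e (S + D) - e (D - S) = 2 * I * (e D * Complex.sin (2 * Real.pi * S)) := by
  rw [e_add, show D - S = D + -S by ring, e_add D, Complex.sin, e, e, e,
    show 2 * Real.pi * I * -S = -(2 * Real.pi * S) * I by ring,
    show 2 * Real.pi * I * S = (2 * Real.pi * S) * I by ring]
  linear_combination (-cexp (2 * Real.pi * I * D) * (cexp (-(2 * Real.pi * S) * I) -
    cexp (2 * Real.pi * S * I))) * Complex.I_sq

theorem G_S_fold {M m : ℕ} (hm : 0 < m) (hM : 0 < M) (hcop : Nat.Coprime m M)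
    {ε ε' j k : ℚ} (hε : ε = 0 ∨ ε = 1 / 2) (hε' : ε' = 0 ∨ ε' = 1 / 2)
    (hj : ∃ n : ℤ, j = ε' + n) (hk : ∃ n : ℤ, k = ε' + n)
    {τ : ℂ} (hτ : 0 < τ.im) {z : ℂ} (h : Generic τ z) (t : ℂ) :
    G M m ε j (-k) (-1 / τ) (z / τ) (t + z ^ 2 / τ)
      = τ ^ 2 / M * (2 * I) * ∑ p ∈ OmegaFinset M ε,
          Complex.exp (-(Real.pi * I * m / M * (p.1 - p.2) * (j - k)))
            * Complex.sin (Real.pi * m / M * (p.1 + p.2) * (j + k))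
            * G M m ε' p.1 (-p.2) τ z t := by
  have hM' : (M : ℂ) ≠ 0 := by exact_mod_cast hM.ne'
  have hεI := isHalfInt_of_eq hε
  have hεI' := isHalfInt_of_eq hε'
  obtain ⟨c, hc⟩ := isHalfInt_of_eq hε
  obtain ⟨c', hc'⟩ := isHalfInt_of_eq hε'
  rw [G_S hm hM hcop hεI hεI' hj hk (a₀ := 1 - ε) (b₀ := ε)
    ⟨1 - c, by push_cast; linarith⟩ ⟨0, by simp⟩ hτ h]
  let A : ℚ × ℚ → ℂ := fun p =>
    e (m / M * ((p.2 : ℚ) * j + (p.1 : ℚ) * k)) * G M m ε' p.1 (-p.2) τ z t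
  have hsq := sum_square M ε A
  rw [sum_square_fold hε] at hsq
  · rw [← hsq, mul_assoc (τ ^ 2 / (M : ℂ))]
    congr 1
    rw [Finset.mul_sum]
    refine Finset.sum_congr rfl fun p hp => ?_
    rw [mem_OmegaFinset] at hp
    obtain ⟨⟨a, ha⟩, ⟨b, hb⟩, -⟩ := hp
    have haI : IsHalfInt p.1 := by rw [ha]; exact hεI.add_int a
    have hbI : IsHalfInt (-p.2) := by rw [hb]; exact (hεI.add_int b).neg
    have haMI : IsHalfInt (p.1 - M) := by
      have := haI.add_int (-M)
      push_cast at this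
      rwa [← sub_eq_add_neg] at this
    -- The quasi-periodicity factors of the two shifts by M cancel, and the swap leaves the sign.
    have g1 : G M m ε' (M - p.2) (-(M - p.1)) τ z t = -G M m ε' p.1 (-p.2) τ z t := by
      have h1 := G_add_left hm hM hεI' hbI haMI hτ h t
      have h2 := G_add_right hm hM hεI' hbI haMI hτ h t
      rw [← h2, sub_add_cancel, G_swap hm hM hεI' haI hbI hτ h] at h1
      rw [← h1]
      congr 1 <;> ring
    obtain ⟨n, hn⟩ := hj
    obtain ⟨n', hn'⟩ := hk
    have hjk : (j + k : ℂ) = (c' + n + n' : ℤ) := by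
      have : j + k = (c' + n + n' : ℤ) := by push_cast; linarith
      exact_mod_cast this
    -- The exponents differ by the integer m(j + k), since 2ε' is an integer.
    have e1 : e (m / M * (((M - p.1 : ℚ) : ℂ) * j + ((M - p.2 : ℚ) : ℂ) * k))
        = e (-(m / M * (p.1 * j + p.2 * k))) := by
      rw [← e_add_int _ (-(m * (c' + n + n')))]
      congr 1
      rw [Int.cast_neg, Int.cast_mul, ← hjk]
      push_cast
      field_simp
      ring
    simp only [A]
    rw [g1, e1]
    have := e_sub_e_eq_sin (m / M * (p.1 + p.2) * (j + k) / 2) (-(m / M * (p.1 - p.2) * (j - k) / 2))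
    rw [show (m / M * (p.1 + p.2) * (j + k) / 2 + -(m / M * (p.1 - p.2) * (j - k) / 2) : ℂ)
        = m / M * (p.2 * j + p.1 * k) by ring,
      show (-(m / M * (p.1 - p.2) * (j - k) / 2) - m / M * (p.1 + p.2) * (j + k) / 2 : ℂ)
        = -(m / M * (p.1 * j + p.2 * k)) by ring,
      show (2 * Real.pi * (m / M * (p.1 + p.2) * (j + k) / 2) : ℂ)
        = Real.pi * m / M * (p.1 + p.2) * (j + k) by ring,
      show e (-(m / M * (p.1 - p.2) * (j - k) / 2))
        = Complex.exp (-(Real.pi * I * m / M * (p.1 - p.2) * (j - k))) by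
          rw [e]; congr 1; ring] at this
    linear_combination G M m ε' p.1 (-p.2) τ z t * this
  -- On a + b = M the index -b is a shifted by -M, so G is a multiple of G with equal indices, which
  -- vanishes by antisymmetry.
  · intro p hp hpM
    rw [mem_square hε] at hp
    obtain ⟨⟨a, ha⟩, ⟨b, hb⟩, -⟩ := hp
    have haI : IsHalfInt p.1 := by rw [ha]; exact hεI.add_int a
    have hbI : IsHalfInt (-p.2) := by rw [hb]; exact (hεI.add_int b).neg
    have h1 := G_add_right hm hM hεI' haI hbI hτ h t
    rw [show -p.2 + M = p.1 by linarith] at h1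
    have h2 := G_swap hm hM hεI' haI haI hτ h t
    have h3 : G M m ε' p.1 p.1 τ z t = 0 := by linear_combination h2 / 2
    rw [h3] at h1
    simp only [A]
    rw [(mul_eq_zero.1 h1.symm).resolve_left (e_ne_zero _), mul_zero]

/-! ### Theta functions with characteristics -/

/-- The theta function `∑_{r ∈ ℤ} e(τ (r + α)² / 2 + (r + α) (z + β))` with characteristics. -/
noncomputable def thetaChar (α β τ z : ℂ) : ℂ :=
  ∑' r : ℤ, e (τ * (r + α) ^ 2 / 2 + (r + α) * (z + β))

theorem thetaChar_term_eq (α β τ z : ℂ) (r : ℤ) :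
    e (τ * (r + α) ^ 2 / 2 + (r + α) * (z + β))
      = e (τ * α ^ 2 / 2 + α * (z + β)) * jacobiTheta₂_term r (z + β + α * τ) τ := by
  rw [jacobiTheta₂_term, e, e, ← Complex.exp_add]
  congr 1
  ring

theorem thetaChar_eq (α β τ z : ℂ) :
    thetaChar α β τ z
      = e (τ * α ^ 2 / 2 + α * (z + β)) * jacobiTheta₂ (z + β + α * τ) τ := by
  rw [thetaChar, jacobiTheta₂, ← tsum_mul_left]
  exact tsum_congr fun r => thetaChar_term_eq α β τ z r

theorem summable_thetaChar (α β : ℂ) {τ : ℂ} (hτ : 0 < τ.im) (z : ℂ) :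
    Summable fun r : ℤ => e (τ * (r + α) ^ 2 / 2 + (r + α) * (z + β)) := by
  simp only [thetaChar_term_eq]
  exact ((summable_jacobiTheta₂_term_iff _ _).2 hτ).mul_left _

/-- Separating even and odd r produces the degree-two functions Θ_{j,2}; for β = 1/2 the two
parities acquire opposite signs. -/
theorem thetaChar_split (α β : ℂ) {τ : ℂ} (hτ : 0 < τ.im) (z : ℂ) :
    thetaChar α β τ z
      = ∑' l : ℤ, e ((2 * l + α) * β) * e (τ * (2 * l + α) ^ 2 / 2 + (2 * l + α) * z)
        + ∑' l : ℤ, e ((2 * l + 1 + α) * β)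
            * e (τ * (2 * l + 1 + α) ^ 2 / 2 + (2 * l + 1 + α) * z) := by
  have hs := summable_thetaChar α β hτ z
  have h0 : Function.Injective fun l : ℤ => 2 * l := fun a b h => by simpa using h
  have h1 : Function.Injective fun l : ℤ => 2 * l + 1 := fun a b h => by simpa using h
  have hc : IsCompl (Set.range fun l : ℤ => 2 * l) (Set.range fun l : ℤ => 2 * l + 1) := by
    rw [range_two_mul, range_two_mul_add_one]
    exact Int.isCompl_even_odd
  have := HasSum.add_isCompl (f := fun r : ℤ => e (τ * (r + α) ^ 2 / 2 + (r + α) * (z + β))) hc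
    (h0.hasSum_range_iff.2 (hs.comp_injective h0).hasSum)
    (h1.hasSum_range_iff.2 (hs.comp_injective h1).hasSum)
  rw [thetaChar, this.tsum_eq]
  congr 1
  · refine tsum_congr fun l => ?_
    rw [← e_add]
    simp only [Function.comp]
    congr 1; push_cast; ring
  · refine tsum_congr fun l => ?_
    rw [← e_add]
    simp only [Function.comp]
    congr 1; push_cast; ring

theorem e_half : e (1 / 2) = -1 := by
  rw [e, show 2 * Real.pi * I * (1 / 2) = Real.pi * I by ring, Complex.exp_pi_mul_I]

theorem e_quarter : e (1 / 4) = I := by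
  rw [e, show 2 * Real.pi * I * (1 / 4) = Real.pi / 2 * I by ring, Complex.exp_pi_div_two_mul_I]

theorem vartheta_eq_thetaChar {a b : ℚ} (ha : a = 0 ∨ a = 1) (hb : b = 0 ∨ b = 1) {τ : ℂ}
    (hτ : 0 < τ.im) (z : ℂ) : vartheta a b τ z = thetaChar (a / 2) (b / 2) τ z := by
  have t0 : Theta 0 2 τ z
      = ∑' l : ℤ, e (τ * (2 * l + 0) ^ 2 / 2 + (2 * l + 0) * z) := by
    refine tsum_congr fun l => ?_
    rw [← e_add]; congr 1; push_cast; ring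
  have t2 : Theta 2 2 τ z
      = ∑' l : ℤ, e (τ * (2 * l + 1 + 0) ^ 2 / 2 + (2 * l + 1 + 0) * z) := by
    refine tsum_congr fun l => ?_
    rw [← e_add]; congr 1; push_cast; ring
  have t1 : Theta 1 2 τ z
      = ∑' l : ℤ, e (τ * (2 * l + 1 / 2) ^ 2 / 2 + (2 * l + 1 / 2) * z) := by
    refine tsum_congr fun l => ?_
    rw [← e_add]; congr 1; push_cast; ring
  have t3 : Theta (-1) 2 τ z
      = ∑' l : ℤ, e (τ * (2 * l + 1 + 1 / 2) ^ 2 / 2 + (2 * l + 1 + 1 / 2) * z) := by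
    -- The exponents 2l - 1/2 of Θ_{-1,2} must be matched with 2l + 3/2.
    rw [Theta, ← (Equiv.addRight (1 : ℤ)).tsum_eq]
    refine tsum_congr fun l => ?_
    simp only [Equiv.coe_addRight]
    rw [← e_add]; congr 1; push_cast; ring
  have c1 : ∀ (α : ℂ) (l : ℤ), e ((2 * l + α) * (1 / 2)) = e (α / 2) := fun α l => by
    rw [← e_add_int (α / 2) l]; congr 1; ring
  have c2 : ∀ (α : ℂ) (l : ℤ), e ((2 * l + 1 + α) * (1 / 2)) = -e (α / 2) := fun α l => by
    rw [show (2 * l + 1 + α) * (1 / 2) = (α / 2 + l) + 1 / 2 by ring, e_add, e_half, e_add_int]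
    ring
  have q : e (1 / 2 / 2) = I := by rw [← e_quarter]; congr 1; ring
  rcases ha with rfl | rfl <;> rcases hb with rfl | rfl <;>
    simp only [vartheta, if_true, one_ne_zero, if_false, Rat.cast_zero, Rat.cast_one, zero_div] <;>
    rw [thetaChar_split _ _ hτ]
  · simp only [mul_zero, e_zero, one_mul]
    rw [← t0, ← t2, add_comm]
  · simp only [c1, c2, tsum_mul_left, zero_div, e_zero]
    rw [← t0, ← t2]
    ring
  · simp only [mul_zero, e_zero, one_mul]
    rw [← t1, ← t3]
  · simp only [c1, c2, tsum_mul_left, q]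
    rw [← t1, ← t3]
    ring

/-- Jacobi inversion applied at z + βτ - α. Since 2α is 0 or 1, a period of the theta function, this
point may replace z + α + βτ. -/
theorem thetaChar_S {α : ℂ} (hα : α = 0 ∨ α = 1 / 2) (β : ℂ) {τ : ℂ} (hτ : 0 < τ.im) (z : ℂ) :
    thetaChar α β (-1 / τ) (z / τ)
      = (-I * τ) ^ (1 / 2 : ℂ) * e (z ^ 2 / (2 * τ)) * e (-(α * β)) * thetaChar β α τ z := by
  have hτ0 : τ ≠ 0 := fun h => by rw [h] at hτ; simp at hτ
  have hs : (-I * τ) ^ (1 / 2 : ℂ) ≠ 0 := by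
    rw [Ne, Complex.cpow_eq_zero_iff]
    simp [hτ0]
  have hp : jacobiTheta₂ (z + α + β * τ) τ = jacobiTheta₂ (z + β * τ - α) τ := by
    rcases hα with rfl | rfl
    · congr 1; ring
    · rw [← jacobiTheta₂_add_left (z + β * τ - 1 / 2)]
      congr 1; ring
  have hfe := jacobiTheta₂_functional_equation (z + β * τ - α) τ
  rw [thetaChar_eq, thetaChar_eq, hp, hfe,
    show z / τ + β + α * (-1 / τ) = (z + β * τ - α) / τ by field_simp; ring]
  have he : cexp (-Real.pi * I * (z + β * τ - α) ^ 2 / τ) = e (-(z + β * τ - α) ^ 2 / (2 * τ)) := by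
    rw [e]; congr 1; field_simp
  rw [he]
  have key : e (-1 / τ * α ^ 2 / 2 + α * (z / τ + β)) = e (z ^ 2 / (2 * τ)) * e (-(α * β)) *
      (e (τ * β ^ 2 / 2 + β * (z + α)) * e (-(z + β * τ - α) ^ 2 / (2 * τ))) := by
    simp only [← e_add]
    congr 1
    field_simp
    ring
  rw [key]
  field_simp

/-- (r + 1/2)²/2 is 1/8 plus the integer r(r + 1)/2. -/
theorem thetaChar_half_T (β τ z : ℂ) :
    thetaChar (1 / 2) β (τ + 1) z = e (1 / 8) * thetaChar (1 / 2) β τ z := by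
  rw [thetaChar, thetaChar, ← tsum_mul_left]
  refine tsum_congr fun r => ?_
  obtain ⟨c, hc⟩ := Int.even_mul_succ_self r
  have hc' : (r : ℂ) * (r + 1) = c + c := by exact_mod_cast hc
  rw [← e_add, ← e_add_int _ (-c)]
  congr 1
  push_cast
  linear_combination hc' / 2

/-- r²/2 and r/2 agree modulo 1, so the translation adds 1/2 to β. -/
theorem thetaChar_zero_T (β τ z : ℂ) :
    thetaChar 0 β (τ + 1) z = thetaChar 0 (β + 1 / 2) τ z := by
  refine tsum_congr fun r => ?_
  obtain ⟨c, hc⟩ := Int.even_mul_succ_self r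
  have hc' : (r : ℂ) * (r + 1) = c + c := by exact_mod_cast hc
  rw [← e_add_int (τ * (r + 0) ^ 2 / 2 + (r + 0) * (z + (β + 1 / 2))) (c - r)]
  congr 1
  push_cast
  linear_combination hc' / 2

theorem thetaChar_zero_one (τ z : ℂ) : thetaChar 0 1 τ z = thetaChar 0 0 τ z := by
  refine tsum_congr fun r => ?_
  rw [← e_add_int (τ * (r + 0) ^ 2 / 2 + (r + 0) * (z + 0)) r]
  congr 1
  ring

/-! ### The denominators -/

/-- Since 0 < arg τ < π, the logarithms of -I and τ add without leaving the principal branch, which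
matches the two forms of the square root. -/
theorem eta_S {τ : ℂ} (hτ : 0 < τ.im) :
    ModularForm.eta (-1 / τ) = (-I * τ) ^ (1 / 2 : ℂ) * ModularForm.eta τ := by
  have hτ0 : τ ≠ 0 := fun h => by rw [h] at hτ; simp at hτ
  have h := ModularForm.eta_comp_eq_csqrt_I_inv hτ
  simp only [Function.comp_apply, Pi.smul_apply, Pi.mul_apply, smul_eq_mul] at h
  rw [h, ← mul_assoc]
  congr 1
  have harg : τ.arg ∈ Set.Ioo 0 Real.pi :=
    ⟨lt_of_le_of_ne (Complex.arg_nonneg_iff.2 hτ.le) fun h0 => by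
        have := (Complex.arg_eq_zero_iff.1 h0.symm).2
        exact hτ.ne' this,
      lt_of_le_of_ne (Complex.arg_le_pi τ) fun h0 => by
        have := (Complex.arg_eq_pi_iff.1 h0).2
        exact hτ.ne' this⟩
  have hlog : Complex.log (-I * τ) = Complex.log (-I) + Complex.log τ := by
    refine (Complex.log_mul_eq_add_log_iff (by simp) hτ0).2 ?_
    rw [Complex.arg_neg_I]
    constructor <;> linarith [harg.1, harg.2, Real.pi_pos]
  rw [Complex.sqrt, Complex.sqrt, Complex.cpow_def_of_ne_zero Complex.I_ne_zero,
    Complex.cpow_def_of_ne_zero hτ0, Complex.cpow_def_of_ne_zero (by simp [hτ0]), hlog,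
    Complex.log_I, Complex.log_neg_I, ← Complex.exp_neg, ← Complex.exp_add]
  congr 1
  ring

theorem eta_T (τ : ℂ) : ModularForm.eta (τ + 1) = e (1 / 24) * ModularForm.eta τ := by
  rw [ModularForm.eta, ModularForm.eta, ← mul_assoc]
  congr 1
  · rw [Function.Periodic.qParam, Function.Periodic.qParam, e, ← Complex.exp_add]
    congr 1
    push_cast
    ring
  · refine tprod_congr fun n => ?_
    rw [ModularForm.eta_q_eq_pow, ModularForm.eta_q_eq_pow, mul_add, mul_one,
      Complex.exp_periodic]

/-- With s = (-iτ)^{1/2}, the numerator gains s³ · s and the squared theta function s², leaving s² =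
-iτ. The phase e(-1/4) = -i of ϑ₁₁ makes this -τ, and the squared phase of the lower theta function
gives the sign. -/
theorem denominator_S {ε ε' : ℚ} (hε : ε = 0 ∨ ε = 1 / 2) (hε' : ε' = 0 ∨ ε' = 1 / 2) {τ : ℂ}
    (hτ : 0 < τ.im) (z t : ℂ) :
    denominator ε ε' (-1 / τ) (z / τ) (t + z ^ 2 / τ)
      = -τ * e ((1 - 2 * ε) * (1 - 2 * ε') / 2) * denominator ε' ε τ z t := by
  have hτ0 : τ ≠ 0 := fun h => by rw [h] at hτ; simp at hτ
  have hτS := im_neg_one_div_pos hτ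
  have ha : 1 - 2 * ε = 0 ∨ 1 - 2 * ε = 1 := by rcases hε with rfl | rfl <;> norm_num
  have hb : 1 - 2 * ε' = 0 ∨ 1 - 2 * ε' = 1 := by rcases hε' with rfl | rfl <;> norm_num
  have hb' : (((1 - 2 * ε' : ℚ) : ℂ) / 2) = 0 ∨ (((1 - 2 * ε' : ℚ) : ℂ) / 2) = 1 / 2 := by
    rcases hb with h | h <;> rw [h] <;> simp
  rw [denominator, denominator, vartheta_eq_thetaChar (.inr rfl) (.inr rfl) hτS,
    vartheta_eq_thetaChar (.inr rfl) (.inr rfl) hτ, vartheta_eq_thetaChar hb ha hτS,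
    vartheta_eq_thetaChar ha hb hτ, eta_S hτ, ← mul_div_assoc 2 z τ,
    thetaChar_S (by simp) _ hτ, thetaChar_S hb' _ hτ]
  set s := (-I * τ) ^ (1 / 2 : ℂ) with hs
  have hs2 : s ^ 2 = -I * τ := by
    rw [hs, ← Complex.cpow_nat_mul]; simp
  have hs0 : s ≠ 0 := by
    intro h; rw [h] at hs2
    simp [hτ0] at hs2
  set B := thetaChar ((1 - 2 * ε : ℚ) / 2) ((1 - 2 * ε' : ℚ) / 2) τ z
  set A := thetaChar ((1 : ℚ) / 2) ((1 : ℚ) / 2) τ (2 * z)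
  set H := ModularForm.eta τ
  have hq : e (-(((1 : ℚ) / 2 : ℂ) * ((1 : ℚ) / 2))) = -I := by
    rw [show (-(((1 : ℚ) / 2 : ℂ) * ((1 : ℚ) / 2))) = -(1 / 4) by push_cast; ring, e_neg, e_quarter,
      Complex.inv_I]
  have h4 : s ^ 4 = (-I * τ) * s ^ 2 := by rw [← hs2]; ring
  have hexp : e (-(t + z ^ 2 / τ)) * e ((2 * z) ^ 2 / (2 * τ))
      = e (-t) * e ((1 - 2 * ε) * (1 - 2 * ε') / 2) * (e (z ^ 2 / (2 * τ))
        * e (-(((1 - 2 * ε' : ℚ) / 2 : ℂ) * ((1 - 2 * ε : ℚ) / 2)))) ^ 2 := by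
    rw [pow_two (e _ * e _)]
    simp only [← e_add]
    congr 1
    push_cast
    field_simp
    ring
  rw [hq]
  have hN : e (z ^ 2 / (2 * τ)) * e (-(((1 - 2 * ε' : ℚ) / 2 : ℂ) * ((1 - 2 * ε : ℚ) / 2))) ≠ 0 :=
    mul_ne_zero (e_ne_zero _) (e_ne_zero _)
  rw [mul_assoc s (e _) (e _)] 
  set N := e (z ^ 2 / (2 * τ)) * e (-(((1 - 2 * ε' : ℚ) / 2 : ℂ) * ((1 - 2 * ε : ℚ) / 2)))
  -- Only the nonzero factors s and N are cancelled, so the identity does not depend on the lower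
  -- theta function being nonzero.
  rw [mul_pow (s * N), mul_pow s N, ← mul_div_assoc, ← mul_div_assoc, ← mul_div_assoc,
    ← mul_div_mul_left _ (B ^ 2) (mul_ne_zero (pow_ne_zero 2 hs0) (pow_ne_zero 2 hN))]
  congr 1
  linear_combination (-I * H ^ 3 * A * s ^ 4) * hexp
    + (-I * H ^ 3 * A * e (-t) * e ((1 - 2 * ε) * (1 - 2 * ε') / 2) * N ^ 2) * h4
    + (H ^ 3 * A * e (-t) * e ((1 - 2 * ε) * (1 - 2 * ε') / 2) * N ^ 2 * s ^ 2 * τ) * Complex.I_sq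

/-- η³ and ϑ₁₁ together give e(1/4). In the Ramond sector the squared theta function gives the same
factor and cancels it; in the Neveu–Schwarz sector ϑ₀₀ and ϑ₀₁ are exchanged and the factor remains.
-/
theorem denominator_T {ε ε' : ℚ} (hε : ε = 0 ∨ ε = 1 / 2) (hε' : ε' = 0 ∨ ε' = 1 / 2) {τ : ℂ}
    (hτ : 0 < τ.im) (z t : ℂ) :
    denominator ε ε' (τ + 1) z t = e (ε' / 2) * denominator |ε - ε'| ε' τ z t := by
  have hτT : 0 < (τ + 1).im := by simpa using hτ
  have h8 : e (1 / 24) ^ 3 * e (1 / 8) = e (1 / 4) := by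
    rw [pow_three]; simp only [← e_add]; congr 1; norm_num
  have h8' : e (1 / 8) ^ 2 = e (1 / 4) := by
    rw [pow_two, ← e_add]; congr 1; norm_num
  have hq : ((1 : ℚ) : ℂ) / 2 = 1 / 2 := by norm_num
  have hq' : ((0 : ℚ) : ℂ) / 2 = 0 := by norm_num
  rw [denominator, denominator, vartheta_eq_thetaChar (.inr rfl) (.inr rfl) hτT,
    vartheta_eq_thetaChar (.inr rfl) (.inr rfl) hτ, eta_T, hq, thetaChar_half_T]
  rcases hε' with rfl | rfl
  · have h0 : |ε - 0| = ε := by rcases hε with rfl | rfl <;> norm_num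
    have ha : 1 - 2 * ε = 0 ∨ 1 - 2 * ε = 1 := by rcases hε with rfl | rfl <;> norm_num
    have h1 : (1 : ℚ) - 2 * 0 = 1 := by norm_num
    rw [h0, h1, vartheta_eq_thetaChar (.inr rfl) ha hτT, vartheta_eq_thetaChar (.inr rfl) ha hτ, hq,
      thetaChar_half_T]
    simp only [Rat.cast_zero, zero_div, e_zero, one_mul]
    congr 1
    rw [mul_pow, mul_pow, h8', ← mul_div_mul_left _ (thetaChar _ _ τ z ^ 2) (e_ne_zero (1 / 4))]
    congr 1
    linear_combination (ModularForm.eta τ ^ 3 * thetaChar (1 / 2) (1 / 2) τ (2 * z)) * h8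
  · have h1 : (1 : ℚ) - 2 * (1 / 2) = 0 := by norm_num
    have key : vartheta 0 (1 - 2 * ε) (τ + 1) z = vartheta 0 (1 - 2 * |ε - 1 / 2|) τ z := by
      rcases hε with rfl | rfl
      · rw [show (1 : ℚ) - 2 * 0 = 1 by norm_num,
          show (1 : ℚ) - 2 * |0 - 1 / 2| = 0 by norm_num [abs_of_neg],
          vartheta_eq_thetaChar (.inl rfl) (.inr rfl) hτT,
          vartheta_eq_thetaChar (.inl rfl) (.inl rfl) hτ, hq, hq', thetaChar_zero_T,
          show (1 / 2 + 1 / 2 : ℂ) = 1 by norm_num, thetaChar_zero_one]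
      · rw [show (1 : ℚ) - 2 * (1 / 2) = 0 by norm_num,
          show (1 : ℚ) - 2 * |1 / 2 - 1 / 2| = 1 by norm_num,
          vartheta_eq_thetaChar (.inl rfl) (.inl rfl) hτT,
          vartheta_eq_thetaChar (.inl rfl) (.inr rfl) hτ, hq, hq', thetaChar_zero_T, zero_add]
    rw [h1, key, show (((1 / 2 : ℚ) : ℂ) / 2) = 1 / 4 by push_cast; norm_num, ← h8]
    ring

/-! ### Transformation of the modified characters -/

theorem cpow_eq_e {ε ε' : ℚ} (hε : ε = 0 ∨ ε = 1 / 2) (hε' : ε' = 0 ∨ ε' = 1 / 2) :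
    (-1 : ℂ) ^ ((((1 - 2 * ε) * (1 - 2 * ε') : ℚ)) : ℂ) = e ((1 - 2 * ε) * (1 - 2 * ε') / 2) := by
  rcases hε with rfl | rfl <;> rcases hε' with rfl | rfl <;> norm_num [e_half, e_zero]

theorem e_sign_mul_self {ε ε' : ℚ} (hε : ε = 0 ∨ ε = 1 / 2) (hε' : ε' = 0 ∨ ε' = 1 / 2) :
    e ((1 - 2 * ε) * (1 - 2 * ε') / 2) * e ((1 - 2 * ε) * (1 - 2 * ε') / 2) = 1 := by
  rcases hε with rfl | rfl <;> rcases hε' with rfl | rfl <;> norm_num [e_half, e_zero]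

/-- The factor τ² of G is divided by -τ, and the sign of the denominator is its own inverse; only
this nonzero scalar has to be inverted. -/
theorem modifiedCharacter_S {M m : ℕ} (hm : 0 < m) (hM : 0 < M) (hcop : Nat.Coprime m M)
    {ε ε' j k : ℚ} (hε : ε = 0 ∨ ε = 1 / 2) (hε' : ε' = 0 ∨ ε' = 1 / 2)
    (hj : ∃ n : ℤ, j = ε' + n) (hk : ∃ n : ℤ, k = ε' + n)
    {τ : ℂ} (hτ : 0 < τ.im) {z : ℂ} (h : Generic τ z) (t : ℂ) :
    modifiedCharacter M m ε ε' j k (-1 / τ) (z / τ) (t + z ^ 2 / τ)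
      = -e ((1 - 2 * ε) * (1 - 2 * ε') / 2) * (2 * I * τ / M) * ∑ p ∈ OmegaFinset M ε,
          Complex.exp (-(Real.pi * I * m / M * (p.1 - p.2) * (j - k)))
            * Complex.sin (Real.pi * m / M * (p.1 + p.2) * (j + k))
            * modifiedCharacter M m ε' ε p.1 p.2 τ z t := by
  have hτ0 : τ ≠ 0 := fun h => by rw [h] at hτ; simp at hτ
  simp only [modifiedCharacter]
  rw [G_S_fold hm hM hcop hε hε' hj hk hτ h, denominator_S hε hε' hτ]
  simp only [mul_div_assoc', ← Finset.sum_div]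
  have he := e_ne_zero ((1 - 2 * ε) * (1 - 2 * ε') / 2)
  have hs := e_sign_mul_self hε hε'
  rw [← div_div]
  congr 1
  rw [div_eq_iff (mul_ne_zero (neg_ne_zero.2 hτ0) he)]
  linear_combination (-(τ ^ 2 / M * (2 * I)) * ∑ p ∈ OmegaFinset M ε,
    Complex.exp (-(Real.pi * I * m / M * (p.1 - p.2) * (j - k)))
      * Complex.sin (Real.pi * m / M * (p.1 + p.2) * (j + k)) * G M m ε' p.1 (-p.2) τ z t) * hs

theorem modifiedCharacter_T {M m : ℕ} (hm : 0 < m) (hM : 0 < M)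
    {ε ε' j k : ℚ} (hε : ε = 0 ∨ ε = 1 / 2) (hε' : ε' = 0 ∨ ε' = 1 / 2)
    (hj : ∃ n : ℤ, j = ε' + n) (hk : ∃ n : ℤ, k = ε' + n)
    {τ : ℂ} (hτ : 0 < τ.im) {z : ℂ} (h : Generic τ z) (t : ℂ) :
    modifiedCharacter M m ε ε' j k (τ + 1) z t
      = Complex.exp (-(2 * Real.pi * I * m * j * k / M) - Real.pi * I * ε')
        * modifiedCharacter M m |ε - ε'| ε' j k τ z t := by
  have hεI' := isHalfInt_of_eq hε'
  have hε₁ : |ε - ε'| = 0 ∨ |ε - ε'| = 1 / 2 := by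
    rcases hε with rfl | rfl <;> rcases hε' with rfl | rfl <;> norm_num [abs_of_neg]
  have hp : ∃ n : ℤ, ε + ε' - |ε - ε'| = n := by
    rcases hε with rfl | rfl <;> rcases hε' with rfl | rfl
    · exact ⟨0, by simp⟩
    · exact ⟨0, by norm_num [abs_of_neg]⟩
    · exact ⟨0, by norm_num⟩
    · exact ⟨1, by norm_num⟩
  obtain ⟨c, hc⟩ := hεI'
  obtain ⟨n, hn⟩ := hp
  have hjI : IsHalfInt j := by obtain ⟨n, rfl⟩ := hj; exact (isHalfInt_of_eq hε').add_int n
  have hkI : IsHalfInt (-k) := by obtain ⟨n, rfl⟩ := hk; exact ((isHalfInt_of_eq hε').add_int n).neg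
  obtain ⟨a, ha⟩ := hj
  obtain ⟨b, hb⟩ := hk
  rw [modifiedCharacter, modifiedCharacter, denominator_T hε hε' hτ,
    G_T hm hM (isHalfInt_of_eq hε) (isHalfInt_of_eq hε₁) hjI hkI
      ⟨n + a, by push_cast; linarith⟩ ⟨n - c - b, by push_cast; linarith⟩ hτ h, mul_div_mul_comm,
    div_eq_mul_inv (e _) (e _), ← e_neg, ← e_add]
  congr 1
  rw [e]
  congr 1
  push_cast
  ring

end N4

theorem theorem10p7
    (M m : ℕ) (hm : 0 < m) (hM : 2 ≤ M) (hcop : Nat.Coprime m M)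
    (hgcd : 1 < m → Nat.gcd M (2 * m) = 1)
    (ε ε' : ℚ) (hε : ε = 0 ∨ ε = 1 / 2) (hε' : ε' = 0 ∨ ε' = 1 / 2)
    (j k : ℚ) (hjk : (j, k) ∈ N4.Omega M ε')
    (τ z t : ℂ) (hτ : 0 < τ.im) (hz : ∀ a b : ℤ, 2 * z ≠ a + b * τ) :
    N4.modifiedCharacter M m ε ε' j k (-1 / τ) (z / τ) (t + z ^ 2 / τ)
        = -(-1 : ℂ) ^ ((((1 - 2 * ε) * (1 - 2 * ε') : ℚ)) : ℂ) * (2 * Complex.I * τ / M)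
          * ∑ p ∈ N4.OmegaFinset M ε,
              Complex.exp (-(Real.pi * Complex.I * m / M * (p.1 - p.2) * (j - k)))
                * Complex.sin (Real.pi * m / M * (p.1 + p.2) * (j + k))
                * N4.modifiedCharacter M m ε' ε p.1 p.2 τ z t
      ∧ N4.modifiedCharacter M m ε ε' j k (τ + 1) z t
        = Complex.exp (-(2 * Real.pi * Complex.I * m * j * k / M)
              - Real.pi * Complex.I * ε')
          * N4.modifiedCharacter M m |ε - ε'| ε' j k τ z t := by
  obtain ⟨hj, hk, -⟩ := hjk
  have hM0 : 0 < M := by omega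
  refine ⟨?_, N4.modifiedCharacter_T hm hM0 hε hε' hj hk hτ hz t⟩
  rw [N4.cpow_eq_e hε hε']
  exact N4.modifiedCharacter_S hm hM0 hcop hε hε' hj hk hτ hz t
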